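/- **Notation.** Let $d\ge 1$, and let $N_0,N_1,N_2,\dots$ be an enumeration (without repetition) of $\mathbb N^d$, where $\mathbb N=\{0,1,2,\dots\}$. For $\alpha\in\mathbb N^d$ write $D_\alpha=\partial^{\alpha_1+\dots+\alpha_d}/\partial z_1^{\alpha_1}\cdots\partial z_d^{\alpha_d}$, $\alpha!=\alpha_1!\cdots\alpha_d!$ and $(z-\zeta)^\alpha=\prod_{i}(z_i-\zeta_i)^{\alpha_i}$. For $1\le i\le d$ let $\Omega_i\subseteq\mathbb C$ be a simply connected domain and $S_i\subseteq\partial\Omega_i$ a set that is open in the relative topology of $\partial\Omega_i$, such that $(\mathbb C\cup\{\infty\})\setminus(\Omega_i\cup S_i)$ is a connected subset of the Riemann sphere. Put $\Omega=\prod_i\Omega_i$, $S=\prod_i S_i$ and $W=\prod_{i}(\Omega_i\cup S_i)$. Let $A^\infty(\Omega,S)$ be the space of all holomorphic $f:\Omega\to\mathbb C$ such that, for every $\alpha\in\mathbb N^d$, $D_\alpha f$ extends continuously to $W$ (the extension is again denoted by $D_\alpha f$), with the topology of the seminorms $\sup_{z\in L}|D_\alpha f(z)|$, $L\subseteq W$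 compact, $\alpha\in\mathbb N^d$; let $\sigma$ be a translation-invariant metric for this topology. Let $X^\infty(\Omega,S)$ be the closure of the set of polynomials in $A^\infty(\Omega,S)$. For compact $K\subseteq\mathbb C^d$ let $O(K)$ be the space of functions holomorphic in an open neighbourhood of $K$, with the topology of the seminorms $\sup_{z\in K}|D_\alpha h(z)|$, $\alpha\in\mathbb N^d$, and let $\rho$ be a translation-invariant (pseudo)metric for this topology. For $f\in A^\infty(\Omega,S)$, $\zeta\in W$ and $m\in\mathbb N$ put $$S_m(f,\zeta)(z)=\sum_{j=0}^{m}\frac{D_{N_j}f(\zeta)}{N_j!}\,(z-\zeta)^{N_j}.$$ **Theorem 3.9.** Let $\mu\subseteq\mathbb N$ be infinite. There exists $f\in A^\infty(\Omega,S)$ with the following property: for all compact sets $K_1,\dots,K_d\subseteq\mathbb C$ with connected complements such that $K=\prod_i K_i$ is disjoint from $\prod_{i}(\Omega_i\cup\overline{S_i})$, and for every $h\in O(K)$, there is a strictly increasing sequence $(\lambda_n)$ in $\mu$ such that, for every compact set $\widetilde L\subseteq W$, $$\sup_{\zeta\in\widetilde L}\rho\bigl(S_{\lambda_n}(f,\zeta),h\bigr)\to0\quad\text{and}\quad\sup_{\zeta\in\widetilde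 L}\sigma\bigl(S_{\lambda_n}(f,\zeta),f\bigr)\to0\qquad(n\to\infty).$$ Furthermore, the set of all $f\in X^\infty(\Omega,S)$ with this property is a dense $G_\delta$ subset of $X^\infty(\Omega,S)$, and there is a vector subspace of $X^\infty(\Omega,S)$, dense in $X^\infty(\Omega,S)$, all of whose elements except $0$ have this property. -/

import Mathlib

open Set Filter Topology

noncomputable section

namespace PartiallySmooth

variable {d : ℕ}

/-- The partial derivative `∂F/∂zᵢ` of a function of `d` complex variables. -/
def partialDeriv (i : Fin d) (F : (Fin d → ℂ) → ℂ) : (Fin d → ℂ) → ℂ :=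
  fun z => fderiv ℂ F z (Pi.single i 1)

/-- The mixed partial derivative `∂^{α₁+⋯+α_d} F / ∂z₁^{α₁} ⋯ ∂z_d^{α_d}`. -/
def mixedDeriv (α : Fin d → ℕ) (F : (Fin d → ℂ) → ℂ) : (Fin d → ℂ) → ℂ :=
  (List.finRange d).foldr (fun i G => (partialDeriv i)^[α i] G) F

/-! Holomorphic functions of several variables are the analytic ones, and mixed derivatives
act linearly on them.  These facts are needed to see that the function classes below are vector
spaces and contain the polynomials. -/

theorem partialDeriv_analyticAt {i : Fin d} {F : (Fin d → ℂ) → ℂ} {z : Fin d → ℂ}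
    (h : AnalyticAt ℂ F z) : AnalyticAt ℂ (partialDeriv i F) z :=
  ((ContinuousLinearMap.apply ℂ ℂ (Pi.single i (1 : ℂ) : Fin d → ℂ)).analyticAt _).comp h.fderiv

theorem foldr_induction (α : Fin d → ℕ)
    (P : ((Fin d → ℂ) → ℂ) → ((Fin d → ℂ) → ℂ) → ((Fin d → ℂ) → ℂ) → Prop)
    (hP : ∀ i F G H, P F G H → P (partialDeriv i F) (partialDeriv i G) (partialDeriv i H))
    {F G H : (Fin d → ℂ) → ℂ} (h : P F G H) :
    P (mixedDeriv α F) (mixedDeriv α G) (mixedDeriv α H) := by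
  unfold mixedDeriv
  generalize List.finRange d = l
  induction l with
  | nil => exact h
  | cons i l ih =>
    simp only [List.foldr_cons]
    generalize α i = k
    induction k with
    | zero => exact ih
    | succ k ihk =>
      simp only [Function.iterate_succ_apply']
      exact hP _ _ _ _ ihk

theorem mixedDeriv_analyticOnNhd {U : Set (Fin d → ℂ)} (α : Fin d → ℕ)
    {F : (Fin d → ℂ) → ℂ} (h : AnalyticOnNhd ℂ F U) : AnalyticOnNhd ℂ (mixedDeriv α F) U :=
  foldr_induction α (fun F _ _ => AnalyticOnNhd ℂ F U)
    (fun _ _ _ _ h z hz => partialDeriv_analyticAt (h z hz)) (G := F) (H := F) h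

theorem mixedDeriv_lin {U : Set (Fin d → ℂ)} (hU : IsOpen U) (α : Fin d → ℕ) (c : ℂ)
    {F G H : (Fin d → ℂ) → ℂ} (hF : AnalyticOnNhd ℂ F U) (hG : AnalyticOnNhd ℂ G U)
    (hH : EqOn H (fun z => c * F z + G z) U) :
    EqOn (mixedDeriv α H) (fun z => c * mixedDeriv α F z + mixedDeriv α G z) U := by
  refine (foldr_induction α
    (fun F G H => AnalyticOnNhd ℂ F U ∧ AnalyticOnNhd ℂ G U ∧
      EqOn H (fun z => c * F z + G z) U) ?_ ⟨hF, hG, hH⟩).2.2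
  rintro i F G H ⟨hF, hG, hH⟩
  refine ⟨fun z hz => partialDeriv_analyticAt (hF z hz),
    fun z hz => partialDeriv_analyticAt (hG z hz), fun z hz => ?_⟩
  have h1 : H =ᶠ[𝓝 z] (fun z => c * F z + G z) := hH.eventuallyEq_of_mem (hU.mem_nhds hz)
  have hFd := (hF z hz).differentiableAt
  have hGd := (hG z hz).differentiableAt
  simp only [partialDeriv]
  rw [h1.fderiv_eq, fderiv_fun_add (hFd.const_mul c) hGd, fderiv_const_mul hFd]
  simp

theorem mixedDeriv_congr {U : Set (Fin d → ℂ)} (hU : IsOpen U) (α : Fin d → ℕ)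
    {F H : (Fin d → ℂ) → ℂ} (hH : EqOn H F U) :
    EqOn (mixedDeriv α H) (mixedDeriv α F) U := by
  refine foldr_induction α (fun F _ H => EqOn H F U) ?_ (G := F) hH
  intro i F G H hH z hz
  simp only [partialDeriv]
  rw [(hH.eventuallyEq_of_mem (hU.mem_nhds hz)).fderiv_eq]

/-- The product domain `Ω = ∏ Ωᵢ`. -/
def prodDomain (Ω : Fin d → TopologicalSpace.Opens ℂ) : Set (Fin d → ℂ) :=
  Set.univ.pi fun i => (Ω i : Set ℂ)

/-- The set `∏ (Ωᵢ ∪ Sᵢ)`. -/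
def prodWithBdry (Ω : Fin d → TopologicalSpace.Opens ℂ) (S : Fin d → Set ℂ) :
    Set (Fin d → ℂ) :=
  Set.univ.pi fun i => (Ω i : Set ℂ) ∪ S i

/-- The set `∏ (Ωᵢ ∪ closure Sᵢ)`. -/
def prodWithClosedBdry (Ω : Fin d → TopologicalSpace.Opens ℂ) (S : Fin d → Set ℂ) :
    Set (Fin d → ℂ) :=
  Set.univ.pi fun i => (Ω i : Set ℂ) ∪ closure (S i)

theorem isOpen_prodDomain (Ω : Fin d → TopologicalSpace.Opens ℂ) : IsOpen (prodDomain Ω) :=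
  isOpen_set_pi Set.finite_univ fun i _ => (Ω i).isOpen

theorem prodDomain_subset (Ω : Fin d → TopologicalSpace.Opens ℂ) (S : Fin d → Set ℂ) :
    prodDomain Ω ⊆ prodWithBdry Ω S :=
  Set.pi_mono fun _ _ => subset_union_left

/-- A function on `U`, as a function on the whole space (zero outside `U`), so that its derivatives
at the points of the open set `U` can be formed. -/
def zeroExt {U : Set (Fin d → ℂ)} (f : U → ℂ) : (Fin d → ℂ) → ℂ :=
  Function.extend Subtype.val f 0

theorem zeroExt_apply {U : Set (Fin d → ℂ)} (f : U → ℂ) {z : Fin d → ℂ} (hz : z ∈ U) :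
    zeroExt f z = f ⟨z, hz⟩ :=
  Subtype.val_injective.extend_apply f 0 ⟨z, hz⟩

/-- `f : Ω → ℂ` is holomorphic, and each mixed partial derivative of `f` extends continuously
to `∏ (Ωᵢ ∪ Sᵢ)`. -/
def IsSmoothUpTo (Ω : Fin d → TopologicalSpace.Opens ℂ) (S : Fin d → Set ℂ)
    (f : prodDomain Ω → ℂ) : Prop :=
  AnalyticOnNhd ℂ (zeroExt f) (prodDomain Ω) ∧
    ∀ α : Fin d → ℕ, ∃ g : (Fin d → ℂ) → ℂ,
      ContinuousOn g (prodWithBdry Ω S) ∧ EqOn g (mixedDeriv α (zeroExt f)) (prodDomain Ω)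

theorem IsSmoothUpTo.lin {Ω : Fin d → TopologicalSpace.Opens ℂ} {S : Fin d → Set ℂ}
    {f g k : prodDomain Ω → ℂ} (c : ℂ) (hf : IsSmoothUpTo Ω S f) (hg : IsSmoothUpTo Ω S g)
    (hk : ∀ z, k z = c * f z + g z) : IsSmoothUpTo Ω S k := by
  have hk' : EqOn (zeroExt k) (fun z => c * zeroExt f z + zeroExt g z) (prodDomain Ω) := by
    intro z hz
    simp only [zeroExt_apply _ hz, hk]
  have hU := isOpen_prodDomain Ω
  refine ⟨fun z hz => ((analyticAt_const.mul (hf.1 z hz)).add (hg.1 z hz)).congr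
    (hk'.eventuallyEq_of_mem (hU.mem_nhds hz)).symm, fun α => ?_⟩
  obtain ⟨F, hF, hF'⟩ := hf.2 α
  obtain ⟨G, hG, hG'⟩ := hg.2 α
  refine ⟨fun z => c * F z + G z, (continuousOn_const.mul hF).add hG, fun z hz => ?_⟩
  rw [mixedDeriv_lin hU α c hf.1 hg.1 hk' hz]
  simp only [hF' hz, hG' hz]

/-- An entire function restricts to a function that is smooth up to the boundary. -/
theorem isSmoothUpTo_of_entire (Ω : Fin d → TopologicalSpace.Opens ℂ) (S : Fin d → Set ℂ)
    {F : (Fin d → ℂ) → ℂ} (hF : AnalyticOnNhd ℂ F univ) :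
    IsSmoothUpTo Ω S (fun z => F z) := by
  have hU := isOpen_prodDomain Ω
  have h : EqOn (zeroExt fun z : prodDomain Ω => F z) F (prodDomain Ω) :=
    fun z hz => zeroExt_apply _ hz
  refine ⟨fun z hz => (hF z trivial).congr (h.eventuallyEq_of_mem (hU.mem_nhds hz)).symm,
    fun α => ⟨mixedDeriv α F, ?_, fun z hz => (mixedDeriv_congr hU α h hz).symm⟩⟩
  exact fun z _ => (mixedDeriv_analyticOnNhd α hF z trivial).continuousAt.continuousWithinAt

/-- `A^∞(Ω, S)` as a vector subspace of the space of all functions `Ω → ℂ`. -/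
def AInftySubmodule (Ω : Fin d → TopologicalSpace.Opens ℂ) (S : Fin d → Set ℂ) :
    Submodule ℂ (prodDomain Ω → ℂ) where
  carrier := {f | IsSmoothUpTo Ω S f}
  zero_mem' := isSmoothUpTo_of_entire Ω S (F := fun _ => 0) analyticOnNhd_const
  add_mem' := fun hf hg => hf.lin 1 hg fun z => by simp
  smul_mem' := fun c _ hf =>
    hf.lin c (isSmoothUpTo_of_entire Ω S (F := fun _ => 0) analyticOnNhd_const) fun z => by simp

/-- The space `A^∞(Ω, S)`.  It is a type of its own, because it does not carry the topology of
pointwise convergence on `Ω`. -/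
def AInfty (Ω : Fin d → TopologicalSpace.Opens ℂ) (S : Fin d → Set ℂ) : Type :=
  ↥(AInftySubmodule Ω S)

namespace AInfty

variable {Ω : Fin d → TopologicalSpace.Opens ℂ} {S : Fin d → Set ℂ}

instance : AddCommGroup (AInfty Ω S) := inferInstanceAs (AddCommGroup ↥(AInftySubmodule Ω S))

instance : Module ℂ (AInfty Ω S) := inferInstanceAs (Module ℂ ↥(AInftySubmodule Ω S))

/-- The underlying function `Ω → ℂ`. -/
def toFun (f : AInfty Ω S) : prodDomain Ω → ℂ := Subtype.val f

/-- The continuous extension of `D_α f` to `∏ (Ωᵢ ∪ Sᵢ)`: its value at `z` is the limit of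
`D_α f (w)` as `w → z`, `w ∈ Ω`. -/
def extDeriv (f : AInfty Ω S) (α : Fin d → ℕ) : (Fin d → ℂ) → ℂ :=
  extendFrom (prodDomain Ω) (mixedDeriv α (zeroExt f.toFun))

/-- The topology (and uniformity) of `A^∞(Ω, S)`, given by the seminorms `sup_L |D_α f|`, for `L` a
compact subset of `∏ (Ωᵢ ∪ Sᵢ)` and `α` a multi-index: uniform convergence on compact
sets of all mixed partial derivatives. -/
instance : UniformSpace (AInfty Ω S) :=
  UniformSpace.comap
    (fun (f : AInfty Ω S) (α : Fin d → ℕ) =>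
      UniformOnFun.ofFun {L : Set (prodWithBdry Ω S) | IsCompact L}
        ((prodWithBdry Ω S).domRestrict (f.extDeriv α)))
    inferInstance

/-- A polynomial as an element of `A^∞(Ω, S)`. -/
def ofPoly (Ω : Fin d → TopologicalSpace.Opens ℂ) (S : Fin d → Set ℂ)
    (P : MvPolynomial (Fin d) ℂ) : AInfty Ω S :=
  ⟨fun z => MvPolynomial.eval (z : Fin d → ℂ) P,
    isSmoothUpTo_of_entire Ω S (F := fun z => MvPolynomial.eval z P)
      (AnalyticOnNhd.eval_mvPolynomial P)⟩

/-- The partial sum `S_m(f, ζ)(z) = ∑_{j=0}^{m} a_{N_j}(f, ζ) (z - ζ)^{N_j}` of the Taylor expansion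
of `f` with centre `ζ ∈ ∏ (Ωᵢ ∪ Sᵢ)`, a polynomial in `z`, where
`a_α(f, ζ) = D_α f (ζ) / (α₁! ⋯ α_d!)`, and `N` is an enumeration of the multi-indices. -/
def taylorSum (N : ℕ ≃ (Fin d → ℕ)) (f : AInfty Ω S) (ζ : Fin d → ℂ) (m : ℕ) :
    MvPolynomial (Fin d) ℂ :=
  ∑ j ∈ Finset.range (m + 1),
    MvPolynomial.C (f.extDeriv (N j) ζ / ∏ i, ((N j i).factorial : ℂ)) *
      ∏ i, (MvPolynomial.X i - MvPolynomial.C (ζ i)) ^ N j i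

end AInfty

/-- `X^∞(Ω, S)`, the closure of the set of polynomials in `A^∞(Ω, S)`. -/
def XInfty (Ω : Fin d → TopologicalSpace.Opens ℂ) (S : Fin d → Set ℂ) : Set (AInfty Ω S) :=
  closure (range (AInfty.ofPoly Ω S))

/-- The space `O(K)`: its elements are given by functions that are holomorphic in an open
neighbourhood of `K`. -/
structure OSpace (K : Set (Fin d → ℂ)) where
  /-- The underlying function; only its values near `K` matter. -/
  toFun : (Fin d → ℂ) → ℂ
  analytic : AnalyticOnNhd ℂ toFun K

namespace OSpace

variable {K : Set (Fin d → ℂ)}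

/-- The topology (and uniformity) of `O(K)`, given by the seminorms `sup_K |D_α h|`: uniform
convergence on `K` of all mixed partial derivatives. -/
instance : UniformSpace (OSpace K) :=
  UniformSpace.comap
    (fun (h : OSpace K) (α : Fin d → ℕ) => UniformFun.ofFun (K.domRestrict (mixedDeriv α h.toFun)))
    inferInstance

/-- A polynomial as an element of `O(K)`. -/
def ofPoly (K : Set (Fin d → ℂ)) (P : MvPolynomial (Fin d) ℂ) : OSpace K :=
  ⟨fun z => MvPolynomial.eval z P, fun z _ => AnalyticOnNhd.eval_mvPolynomial P z trivial⟩

end OSpace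

/-- The universality property with moving centre: for all compact `Kᵢ ⊆ ℂ` with connected
complements such that `K = ∏ Kᵢ` is disjoint from `∏ (Ωᵢ ∪ closure Sᵢ)` and all `h ∈ O(K)` there
are `l 0 < l 1 < ⋯` in `μ` such that, for each compact `L ⊆ ∏ (Ωᵢ ∪ Sᵢ)`, uniformly for `ζ ∈ L`,
`S_{l n}(f, ζ) → h` in `O(K)` and `S_{l n}(f, ζ) → f` in `A^∞(Ω, S)`. -/
def IsUniversal {Ω : Fin d → TopologicalSpace.Opens ℂ} {S : Fin d → Set ℂ}
    (N : ℕ ≃ (Fin d → ℕ)) (μ : Set ℕ) (f : AInfty Ω S) : Prop :=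
  ∀ K : Fin d → Set ℂ, (∀ i, IsCompact (K i)) → (∀ i, IsConnected (K i)ᶜ) →
    Disjoint (Set.univ.pi K) (prodWithClosedBdry Ω S) →
    ∀ h : OSpace (Set.univ.pi K), ∃ l : ℕ → ℕ, StrictMono l ∧ (∀ n, l n ∈ μ) ∧
      ∀ L : Set (Fin d → ℂ), IsCompact L → L ⊆ prodWithBdry Ω S →
        TendstoUniformlyOn (fun n ζ => OSpace.ofPoly (Set.univ.pi K) (f.taylorSum N ζ (l n)))
          (fun _ => h) atTop L ∧
        TendstoUniformlyOn (fun n ζ => AInfty.ofPoly Ω S (f.taylorSum N ζ (l n)))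
          (fun _ => f) atTop L

end PartiallySmooth

end

/-!
The universal functions form a countable intersection of open sets, and Baire's theorem in
`X^∞(Ω, S)` reduces their genericity to the density of each of these sets.

*Reduction to countably many conditions.* If a product of compact sets misses
`∏ (Ωᵢ ∪ closure Sᵢ)`, then one of its factors `K i` misses `Ω i ∪ closure (S i)`.  The compact
sets with connected complement that miss the connected set `Ω i` and the closed set `closure (S i)`
are contained in countably many of them, and the other factors are contained in large discs
(`exists_countable_admissible`).  As the polynomials contain a dense sequence for uniform convergence
on compact sets of all derivatives, universality amounts to countably many conditions, each of
which asks for one good Taylor sum (`isUniversal_iff_forall_mem_goodSet`).  Each condition is open,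
because the derivatives of a Taylor sum depend continuously on the function, the centre and the point.

*Density.* Taylor sums of a polynomial are eventually equal to it, whatever the centre.  Hence it is
enough to approximate, by one and the same polynomial, a given polynomial on a compact subset `L` of
`∏ (Ωᵢ ∪ Sᵢ)` and a given function on `K`, with all derivatives.  The `i`-th projection of `L` has its
filled hull in `Ω i ∪ S i`, because the complement of `Ω i ∪ S i` in the sphere is connected; so this
hull is disjoint from `K i`.  By Borsuk's argument with continuous logarithms (`IsFull.union`), the
union of two disjoint compact sets that do not separate the plane does not separate it either, and
Runge's theorem on products of such sets gives the approximation (`IsAdmissible.exists_seq_poly`).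
Runge's theorem on products follows from the Cauchy–Pompeiu formula, applied in each variable with a
smooth cut-off function: a holomorphic function near `∏ Mᵢ` is an integral of products of Cauchy
kernels whose poles lie off the `Mᵢ`, and each kernel `1 / (w - z)` is a uniform limit on `Mᵢ` of
polynomials, by moving its pole to infinity.  Derivatives are handled by approximating on slightly
larger products.

*Completeness.* The same formula shows that locally uniform limits of holomorphic functions of several
variables are holomorphic, with convergence of all derivatives.  Hence `A^∞(Ω, S)` is complete and
metrizable, and Baire's theorem applies to its closed subset `X^∞(Ω, S)`.

*The dense subspace.* The functions `F 0, F 1, …` are chosen one after the other, `F n` in the `n`-th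
set of a countable basis of `X^∞(Ω, S)` and, for each of the countably many products `T κ`, universal
for a set `ν n κ` of indices.  Universality with target `0` provides `ν (n + 1) κ ⊆ ν n κ` along which
the Taylor sums of `F n` tend to `0` on `T κ` and to `F n` in `A^∞(Ω, S)`.  In a nonzero linear
combination the last term, `c • F n`, can be steered to any target along a subset of `ν n κ`, while
all the earlier terms contribute `0` (`isUniversal_of_mem_span`).
-/

noncomputable section

namespace PartiallySmooth

/-! ### Planar sets that do not separate the plane from infinity -/

/-- The union of the unbounded connected components of the complement of `M`. -/
def outer (M : Set ℂ) : Set ℂ := {w | ¬ Bornology.IsBounded (connectedComponentIn Mᶜ w)}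

/-- A set whose complement has no bounded components.  For compact sets this is the same as
polynomial convexity, and as connectedness of the complement. -/
def IsFull (M : Set ℂ) : Prop := Mᶜ ⊆ outer M

theorem outer_subset_compl (M : Set ℂ) : outer M ⊆ Mᶜ := by
  intro w hw
  by_contra h
  exact hw (by rw [connectedComponentIn_eq_empty h]; exact Bornology.isBounded_empty)

theorem outer_anti {M M' : Set ℂ} (h : M ⊆ M') : outer M' ⊆ outer M :=
  fun _ hw hb => hw (hb.subset (connectedComponentIn_mono _ (compl_subset_compl.2 h)))

theorem mem_outer_of_mem_component {M : Set ℂ} {w z : ℂ} (hw : w ∈ outer M)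
    (hz : z ∈ connectedComponentIn Mᶜ w) : z ∈ outer M := by
  simpa only [outer, mem_ofPred_eq, ← connectedComponentIn_eq hz] using hw

theorem mem_outer_of_isPreconnected {M V : Set ℂ} {w z : ℂ} (hV : IsPreconnected V) (hVM : V ⊆ Mᶜ)
    (hw : w ∈ V) (hz : z ∈ V) (h : w ∈ outer M) : z ∈ outer M :=
  mem_outer_of_mem_component h (hV.subset_connectedComponentIn hw hVM hz)

theorem component_subset_outer {M : Set ℂ} {w : ℂ} (hw : w ∈ outer M) :
    connectedComponentIn Mᶜ w ⊆ outer M := fun _ hz => mem_outer_of_mem_component hw hz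

theorem isOpen_outer {M : Set ℂ} (hM : IsClosed M) : IsOpen (outer M) := by
  rw [isOpen_iff_mem_nhds]
  intro w hw
  exact mem_of_superset (connectedComponentIn_mem_nhds
    (hM.isOpen_compl.mem_nhds (outer_subset_compl M hw))) (component_subset_outer hw)

theorem isOpen_compl_diff_outer {M : Set ℂ} (hM : IsClosed M) : IsOpen (Mᶜ \ outer M) := by
  rw [isOpen_iff_mem_nhds]
  rintro w ⟨hw, hw'⟩
  refine mem_of_superset (connectedComponentIn_mem_nhds (hM.isOpen_compl.mem_nhds hw)) fun z hz =>
    ⟨connectedComponentIn_subset _ _ hz, fun hz' => hw' ?_⟩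
  refine mem_outer_of_mem_component hz' ?_
  rw [← connectedComponentIn_eq hz]
  exact mem_connectedComponentIn hw

/-- The exterior of a disc is connected: it is the image of a half-plane under `exp`. -/
theorem isPreconnected_norm_gt {R : ℝ} (hR : 0 < R) : IsPreconnected {w : ℂ | R < ‖w‖} := by
  have h : {w : ℂ | R < ‖w‖} = Complex.exp '' {ζ : ℂ | Real.log R < ζ.re} := by
    ext w
    simp only [mem_ofPred_eq, mem_image]
    constructor
    · intro hw
      have h0 : 0 < ‖w‖ := hR.trans hw
      refine ⟨Complex.log w, ?_, Complex.exp_log (norm_pos_iff.1 h0)⟩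
      rw [Complex.log_re]
      exact Real.log_lt_log hR hw
    · rintro ⟨ζ, hζ, rfl⟩
      rw [Complex.norm_exp, ← Real.exp_log hR]
      exact Real.exp_lt_exp.2 hζ
  rw [h]
  exact ((convex_halfSpace_re_gt _).isPreconnected).image _ Complex.continuous_exp.continuousOn

theorem not_isBounded_norm_gt (R : ℝ) : ¬ Bornology.IsBounded {w : ℂ | R < ‖w‖} := by
  intro h
  obtain ⟨C, hC⟩ := h.exists_norm_le
  have h1 := hC ((max R C + 1 : ℝ) + (0 : ℂ)) (by
    have h2 : ‖((max R C + 1 : ℝ) : ℂ)‖ = |max R C + 1| := Complex.norm_real _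
    simp only [add_zero, mem_ofPred_eq]
    rw [h2]
    exact lt_of_lt_of_le (by linarith [le_max_left R C]) (le_abs_self _))
  have h2 : ‖((max R C + 1 : ℝ) : ℂ)‖ = |max R C + 1| := Complex.norm_real _
  rw [add_zero, h2] at h1
  linarith [le_abs_self (max R C + 1), le_max_right R C]

theorem norm_gt_subset_outer {M : Set ℂ} {R : ℝ} (hR : 0 < R) (hM : ∀ z ∈ M, ‖z‖ ≤ R) :
    {w : ℂ | R < ‖w‖} ⊆ outer M := by
  intro w hw hb
  refine not_isBounded_norm_gt R (hb.subset ?_)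
  exact (isPreconnected_norm_gt hR).subset_connectedComponentIn hw
    fun z hz hzM => not_lt.2 (hM z hzM) hz

theorem outer_empty : outer ∅ = univ := by
  refine eq_univ_of_forall fun b hb => not_isBounded_norm_gt 1 (hb.subset ?_)
  rw [compl_empty, connectedComponentIn_univ, PreconnectedSpace.connectedComponent_eq_univ]
  exact subset_univ _

theorem exists_pos_norm_le {M : Set ℂ} (hM : IsCompact M) : ∃ R : ℝ, 0 < R ∧ ∀ z ∈ M, ‖z‖ ≤ R := by
  obtain ⟨R, hR⟩ := hM.isBounded.exists_norm_le
  exact ⟨max R 1, by positivity, fun z hz => (hR z hz).trans (le_max_left _ _)⟩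

/-- A property that is locally constant off `M` and holds near infinity holds on all of
`outer M`. -/
theorem outer_induction {M : Set ℂ} {P : ℂ → Prop}
    (hloc : ∀ w ∉ M, ∃ r > 0, ∀ a ∈ Metric.ball w r, ∀ b ∈ Metric.ball w r, P a → P b)
    (hinf : ∃ R : ℝ, ∀ w ∉ M, R < ‖w‖ → P w) {w : ℂ} (hw : w ∈ outer M) : P w := by
  obtain ⟨R, hR⟩ := hinf
  set V := connectedComponentIn Mᶜ w with hV
  have hVM : V ⊆ Mᶜ := connectedComponentIn_subset _ _
  obtain ⟨w₀, hw₀, hw₀R⟩ : ∃ w₀ ∈ V, R < ‖w₀‖ := by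
    by_contra! h
    exact hw (isBounded_iff_forall_norm_le.2 ⟨R, h⟩)
  let A : Set ℂ := {z | ∃ r > 0, ∀ a ∈ Metric.ball z r, P a}
  let B : Set ℂ := {z | ∃ r > 0, ∀ a ∈ Metric.ball z r, ¬ P a}
  have hopen : ∀ Q : ℂ → Prop, IsOpen {z | ∃ r > 0, ∀ a ∈ Metric.ball z r, Q a} := by
    intro Q
    have : {z | ∃ r > 0, ∀ a ∈ Metric.ball z r, Q a} = interior {z | Q z} := by
      ext z
      rw [mem_interior_iff_mem_nhds, Metric.mem_nhds_iff]
      rfl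
    rw [this]
    exact isOpen_interior
  have hself : ∀ (z : ℂ) (r : ℝ), r > 0 → z ∈ Metric.ball z r :=
    fun z r hr => Metric.mem_ball_self hr
  have hcov : V ⊆ A ∪ B := by
    intro z hz
    obtain ⟨r, hr, h⟩ := hloc z (hVM hz)
    by_cases hP : P z
    · exact Or.inl ⟨r, hr, fun a ha => h z (hself z r hr) a ha hP⟩
    · exact Or.inr ⟨r, hr, fun a ha hPa => hP (h a ha z (hself z r hr) hPa)⟩
  have hdis : Disjoint A B := by
    rw [Set.disjoint_left]
    rintro z ⟨r, hr, h⟩ ⟨s, hs, h'⟩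
    exact h' z (hself z s hs) (h z (hself z r hr))
  have hA : V ⊆ A := by
    refine isPreconnected_connectedComponentIn.subset_left_of_subset_union (hopen _) (hopen _)
      hdis hcov ⟨w₀, hw₀, ?_⟩
    obtain ⟨r, hr, h⟩ := hloc w₀ (hVM hw₀)
    exact ⟨r, hr, fun a ha => h w₀ (hself w₀ r hr) a ha (hR w₀ (hVM hw₀) hw₀R)⟩
  obtain ⟨r, hr, h⟩ := hA (mem_connectedComponentIn (outer_subset_compl M hw))
  exact h w (hself w r hr)

theorem isFull_of_isConnected_compl {K : Set ℂ} (hK : IsCompact K)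
    (hc : IsConnected Kᶜ) : IsFull K := by
  obtain ⟨R, hR, hKR⟩ := exists_pos_norm_le hK
  have hout := norm_gt_subset_outer hR hKR
  obtain ⟨w₀, hw₀⟩ : {w : ℂ | R < ‖w‖}.Nonempty := by
    by_contra h
    exact not_isBounded_norm_gt R (by
      rw [not_nonempty_iff_eq_empty.1 h]; exact Bornology.isBounded_empty)
  exact fun w hw => mem_outer_of_isPreconnected hc.isPreconnected Subset.rfl
    (outer_subset_compl _ (hout hw₀)) hw (hout hw₀)

theorem IsFull.isConnected_compl {K : Set ℂ} (hf : IsFull K) (hK : IsCompact K) :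
    IsConnected Kᶜ := by
  obtain ⟨R, hR, hKR⟩ := exists_pos_norm_le hK
  set X := {w : ℂ | R < ‖w‖} with hX
  have hXK : X ⊆ Kᶜ := fun z hz hzM => not_lt.2 (hKR z hzM) hz
  obtain ⟨w₀, hw₀⟩ : X.Nonempty := by
    by_contra h
    exact not_isBounded_norm_gt R (by
      rw [← hX, not_nonempty_iff_eq_empty.1 h]; exact Bornology.isBounded_empty)
  refine ⟨⟨w₀, hXK hw₀⟩, isPreconnected_of_forall w₀ fun w hw => ?_⟩
  refine ⟨connectedComponentIn Kᶜ w, connectedComponentIn_subset _ _, ?_,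
    mem_connectedComponentIn hw, isPreconnected_connectedComponentIn⟩
  have h1 : w ∈ outer K := hf hw
  obtain ⟨w₁, hw₁, hw₁R⟩ : ∃ w₁ ∈ connectedComponentIn Kᶜ w, R < ‖w₁‖ := by
    by_contra! h
    exact h1 (isBounded_iff_forall_norm_le.2 ⟨R, h⟩)
  rw [connectedComponentIn_eq hw₁]
  exact (isPreconnected_norm_gt hR).subset_connectedComponentIn hw₁R hXK hw₀

/-- The set `M` with the bounded components of its complement filled in. -/
def hull (M : Set ℂ) : Set ℂ := (outer M)ᶜ

theorem subset_hull (M : Set ℂ) : M ⊆ hull M :=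
  fun _ hz h => outer_subset_compl M h hz

theorem hull_mono {M M' : Set ℂ} (h : M ⊆ M') : hull M ⊆ hull M' :=
  compl_subset_compl.2 (outer_anti h)

theorem IsFull.hull_subset {M : Set ℂ} (h : IsFull M) : hull M ⊆ M := compl_subset_comm.1 h

theorem isFull_hull (M : Set ℂ) : IsFull (hull M) := by
  intro w hw
  have hw' : w ∈ outer M := by simpa [hull] using hw
  intro hb
  refine hw' (hb.subset (isPreconnected_connectedComponentIn.subset_connectedComponentIn
    (mem_connectedComponentIn (outer_subset_compl M hw')) ?_))
  rw [hull, compl_compl]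
  exact component_subset_outer hw'

theorem isCompact_hull {M : Set ℂ} (hM : IsCompact M) : IsCompact (hull M) := by
  obtain ⟨R, hR, hMR⟩ := exists_pos_norm_le hM
  refine Metric.isCompact_of_isClosed_isBounded (isOpen_outer hM.isClosed).isClosed_compl
    (isBounded_iff_forall_norm_le.2 ⟨R, fun w hw => ?_⟩)
  by_contra! h
  exact hw (norm_gt_subset_outer hR hMR h)

/-- If the complement of `E` in the Riemann sphere is connected, filling the holes of a compact
subset of `E` does not lead out of `E`. -/
theorem hull_subset_of_isConnected_sphere_compl {E L : Set ℂ}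
    (hE : IsConnected ((fun z : ℂ => (z : OnePoint ℂ)) '' E)ᶜ) (hL : IsCompact L) (hLE : L ⊆ E) :
    hull L ⊆ E := by
  intro w hw
  by_contra hwE
  let c : ℂ → OnePoint ℂ := fun z => (z : OnePoint ℂ)
  have hA : IsOpen (c '' hull L)ᶜ := by
    rw [isOpen_compl_iff]
    exact ((isCompact_hull hL).image OnePoint.continuous_coe).isClosed
  have hB : IsOpen (c '' (Lᶜ \ outer L)) :=
    OnePoint.isOpenEmbedding_coe.isOpenMap _ (isOpen_compl_diff_outer hL.isClosed)
  have hinj : Function.Injective c := OnePoint.coe_injective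
  have hsub : (c '' E)ᶜ ⊆ (c '' hull L)ᶜ ∪ c '' (Lᶜ \ outer L) := by
    intro x hx
    by_cases h : x ∈ c '' hull L
    · obtain ⟨z, hz, rfl⟩ := h
      exact Or.inr ⟨z, ⟨fun hzL => hx ⟨z, hLE hzL, rfl⟩, hz⟩, rfl⟩
    · exact Or.inl h
  have hdis : Disjoint (c '' hull L)ᶜ (c '' (Lᶜ \ outer L)) := by
    rw [Set.disjoint_left]
    rintro _ hx ⟨z, hz, rfl⟩
    exact hx ⟨z, hz.2, rfl⟩
  have h1 := hE.isPreconnected.subset_left_of_subset_union hA hB hdis hsub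
    ⟨OnePoint.infty, fun ⟨z, _, hz⟩ => OnePoint.coe_ne_infty z hz,
      fun ⟨z, _, hz⟩ => OnePoint.coe_ne_infty z hz⟩
  exact h1 (by
    rintro ⟨z, hz, h⟩
    exact hwE (hinj h ▸ hz)) ⟨w, hw, rfl⟩

/-- A full compact set has a basis of full compact neighbourhoods. -/
theorem IsFull.exists_nhd {K U : Set ℂ} (hf : IsFull K) (hK : IsCompact K) (hU : IsOpen U)
    (hKU : K ⊆ U) : ∃ M, IsCompact M ∧ IsFull M ∧ K ⊆ interior M ∧ M ⊆ U := by
  let T : ℕ → Set ℂ := fun n => Metric.cthickening (1 / ((n : ℝ) + 1)) K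
  have hT : ∀ n, IsCompact (T n) := fun n => hK.cthickening
  have hpos : ∀ n : ℕ, 0 < 1 / ((n : ℝ) + 1) := fun n => Nat.one_div_pos_of_nat
  have hanti : ∀ {m n : ℕ}, m ≤ n → T n ⊆ T m := fun h =>
    Metric.cthickening_mono (Nat.one_div_le_one_div h) _
  have key : ∀ w ∈ outer K, ∃ n, w ∈ outer (T n) := by
    intro w hw
    refine outer_induction (P := fun w => ∃ n, w ∈ outer (T n)) ?_ ?_ hw
    · intro w hw
      have hd : 0 < Metric.infDist w K ∨ K = ∅ := by
        rcases K.eq_empty_or_nonempty with h | h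
        · exact Or.inr h
        · exact Or.inl ((hK.isClosed.notMem_iff_infDist_pos h).1 hw)
      rcases hd with hd | rfl
      · refine ⟨Metric.infDist w K / 2, by positivity, ?_⟩
        rintro a ha b hb ⟨n, hn⟩
        obtain ⟨m, hm⟩ := exists_nat_one_div_lt (half_pos hd)
        refine ⟨max m n, ?_⟩
        have hdis : Metric.ball w (Metric.infDist w K / 2) ⊆ (T (max m n))ᶜ := by
          intro z hz hzT
          have h1 : Metric.infDist z K ≤ 1 / ((m : ℝ) + 1) := by
            have := hanti (le_max_left m n) hzT
            rw [Metric.mem_cthickening_iff] at this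
            exact ENNReal.toReal_le_of_le_ofReal (hpos m).le this
          have h2 := Metric.infDist_le_infDist_add_dist (s := K) (x := w) (y := z)
          have h3 : dist w z < Metric.infDist w K / 2 := by rw [dist_comm]; exact hz
          linarith
        exact mem_outer_of_isPreconnected (convex_ball _ _).isPreconnected hdis ha hb
          (outer_anti (hanti (le_max_right m n)) hn)
      · refine ⟨1, one_pos, fun a _ b _ _ => ⟨0, ?_⟩⟩
        have : T 0 = ∅ := by simp [T]
        rw [this]
        exact outer_empty ▸ mem_univ b
    · obtain ⟨R, hR, hTR⟩ := exists_pos_norm_le (hT 0)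
      exact ⟨R, fun w _ hw => ⟨0, norm_gt_subset_outer hR hTR hw⟩⟩
  have hB : IsCompact (hull (T 0) \ U) := (isCompact_hull (hT 0)).diff hU
  obtain ⟨n, hn⟩ := hB.elim_directed_cover (fun n => outer (T n))
    (fun n => isOpen_outer (hT n).isClosed)
    (fun w hw => mem_iUnion.2 (key w (hf fun h => hw.2 (hKU h))))
    (directed_of_isDirected_le fun m n h => outer_anti (hanti h))
  refine ⟨hull (T n), isCompact_hull (hT n), isFull_hull _, ?_, ?_⟩
  · intro z hz
    refine interior_mono (subset_hull _) ?_
    rw [mem_interior_iff_mem_nhds]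
    exact mem_of_superset (Metric.thickening_mem_nhdsSet K (hpos n) |>
      fun h => (mem_nhdsSet_iff_forall.1 h) z hz) (Metric.thickening_subset_cthickening _ _)
  · intro z hz
    by_contra hzU
    exact hz (hn ⟨hull_mono (hanti (Nat.zero_le n)) hz, hzU⟩)

/-- The translates `z - w` have a continuous logarithm on a compact set `K`, for all `w` in an
unbounded component of the complement of `K`. -/
theorem exists_continuousOn_log_sub {K : Set ℂ} (hK : IsCompact K) {w : ℂ} (hw : w ∈ outer K) :
    ∃ g : ℂ → ℂ, ContinuousOn g K ∧ ∀ z ∈ K, Complex.exp (g z) = z - w := by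
  refine outer_induction
    (P := fun w => ∃ g : ℂ → ℂ, ContinuousOn g K ∧ ∀ z ∈ K, Complex.exp (g z) = z - w) ?_ ?_ hw
  · intro w hw
    obtain ⟨r, hr, hrK⟩ := Metric.isOpen_iff.1 hK.isClosed.isOpen_compl w hw
    refine ⟨r / 4, by positivity, ?_⟩
    rintro a ha b hb ⟨g, hg, hgz⟩
    have hlow : ∀ z ∈ K, r ≤ ‖z - w‖ := by
      intro z hz
      by_contra! h
      exact hrK (by simpa [dist_eq_norm] using h) hz
    have hab : ‖a - b‖ < r / 2 := by
      have h1 : ‖a - w‖ < r / 4 := by simpa [dist_eq_norm] using ha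
      have h2 : ‖b - w‖ < r / 4 := by simpa [dist_eq_norm] using hb
      calc ‖a - b‖ = ‖(a - w) - (b - w)‖ := by ring_nf
        _ ≤ ‖a - w‖ + ‖b - w‖ := norm_sub_le _ _
        _ < r / 2 := by linarith
    have hza : ∀ z ∈ K, r / 2 < ‖z - a‖ := by
      intro z hz
      have h1 : ‖a - w‖ < r / 4 := by simpa [dist_eq_norm] using ha
      have h2 : ‖z - w‖ ≤ ‖z - a‖ + ‖a - w‖ := by
        simpa using norm_add_le (z - a) (a - w)
      linarith [hlow z hz]
    have hslit : ∀ z ∈ K, 1 + (a - b) / (z - a) ∈ Complex.slitPlane := by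
      intro z hz
      apply Complex.mem_slitPlane_of_norm_lt_one
      rw [norm_div, div_lt_one (by linarith [hza z hz])]
      linarith [hza z hz]
    have hne : ∀ z ∈ K, z - a ≠ 0 := fun z hz => norm_pos_iff.1 (by linarith [hza z hz])
    refine ⟨fun z => g z + Complex.log (1 + (a - b) / (z - a)), ?_, ?_⟩
    · refine hg.add (ContinuousOn.clog ?_ hslit)
      exact continuousOn_const.add (continuousOn_const.div (by fun_prop) hne)
    · intro z hz
      rw [Complex.exp_add, hgz z hz, Complex.exp_log (Complex.slitPlane_ne_zero (hslit z hz))]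
      field_simp [hne z hz]
      ring
  · obtain ⟨R, hR, hKR⟩ := exists_pos_norm_le hK
    refine ⟨R, fun w _ hw => ?_⟩
    have hw0 : w ≠ 0 := norm_pos_iff.1 (hR.trans hw)
    have hslit : ∀ z ∈ K, 1 + (-z / w) ∈ Complex.slitPlane := by
      intro z hz
      apply Complex.mem_slitPlane_of_norm_lt_one
      rw [norm_div, norm_neg, div_lt_one (hR.trans hw)]
      linarith [hKR z hz]
    refine ⟨fun z => Complex.log (-w) + Complex.log (1 + (-z / w)), ?_, ?_⟩
    · refine continuousOn_const.add (ContinuousOn.clog (by fun_prop) hslit)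
    · intro z hz
      rw [Complex.exp_add, Complex.exp_log (neg_ne_zero.2 hw0),
        Complex.exp_log (Complex.slitPlane_ne_zero (hslit z hz))]
      field_simp
      ring

/-- A nonvanishing continuous function on the plane cannot agree with `z - w` near infinity. -/
theorem not_continuous_nonvanishing {F : ℂ → ℂ} (hF : Continuous F) (h0 : ∀ z, F z ≠ 0) {w : ℂ}
    {R : ℝ} (hR : 0 < R) (hFw : ∀ z, ‖z - w‖ = R → F z = z - w) : False := by
  obtain ⟨G, ⟨-, hG⟩, -⟩ := Complex.isCoveringMapOn_exp.existsUnique_continuousMap_lifts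
    (⟨F, hF⟩ : C(ℂ, ℂ)) (a₀ := 0) (Complex.exp_log (h0 0)) (fun z => h0 z)
  have hG' : ∀ z, Complex.exp (G z) = F z := fun z => congrFun hG z
  let γ : ℝ → ℂ := fun θ => w + R * Complex.exp (θ * Complex.I)
  have hγ : Continuous γ := by fun_prop
  have hγR : ∀ θ, ‖γ θ - w‖ = R := fun θ => by
    simp [γ, Complex.norm_exp_ofReal_mul_I, abs_of_pos hR]
  have hexp : ∀ θ, Complex.exp (G (γ θ) - θ * Complex.I) = R := by
    intro θ
    rw [Complex.exp_sub, hG', hFw _ (hγR θ), div_eq_iff (Complex.exp_ne_zero _)]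
    simp [γ]
  -- A continuous function with constant exponential on a connected set is constant.
  let u : ℝ → ℂ := fun θ => G (γ θ) - θ * Complex.I
  have hu : Continuous u := by fun_prop
  obtain ⟨c, hc⟩ : ∃ c : ℂ, ∀ θ, u θ = c := by
    obtain ⟨H, -, hH⟩ := Complex.isCoveringMapOn_exp.existsUnique_continuousMap_lifts
      (⟨fun _ => (R : ℂ), continuous_const⟩ : C(ℝ, ℂ)) (a₀ := 0) (hexp 0)
      (fun z => by simpa using hR.ne')
    have h1 := hH ⟨u, hu⟩ ⟨rfl, funext fun θ => hexp θ⟩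
    have h2 := hH ⟨fun _ => u 0, continuous_const⟩ ⟨rfl, funext fun θ => hexp 0⟩
    exact ⟨u 0, fun θ => by simpa using congrArg (fun f : C(ℝ, ℂ) => f θ) (h1.trans h2.symm)⟩
  have h1 := (hc 0).trans (hc (2 * Real.pi)).symm
  have h2 : γ (2 * Real.pi) = γ 0 := by simp [γ, Complex.exp_two_pi_mul_I]
  simp only [u, h2] at h1
  have h3 : (2 * Real.pi : ℂ) * Complex.I = 0 := by
    push_cast at h1
    linear_combination h1
  simp [Real.pi_ne_zero] at h3

/-- The union of two disjoint full compact sets is full.  For a point `w` in a bounded component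
of the complement, logarithms of `z - w` on both sets would give a continuous nonvanishing
function on the plane that agrees with `z - w` near infinity. -/
theorem IsFull.union {K L : Set ℂ} (hKf : IsFull K) (hLf : IsFull L) (hK : IsCompact K)
    (hL : IsCompact L) (hKL : Disjoint K L) : IsFull (K ∪ L) := by
  classical
  intro w hw hb
  have hwK : w ∉ K := fun h => hw (Or.inl h)
  have hwL : w ∉ L := fun h => hw (Or.inr h)
  set V := connectedComponentIn (K ∪ L)ᶜ w with hV
  have hcl : IsClosed (K ∪ L) := hK.isClosed.union hL.isClosed
  have hVo : IsOpen V := hcl.isOpen_compl.connectedComponentIn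
  have hwV : w ∈ V := mem_connectedComponentIn hw
  have hfr : frontier V ⊆ K ∪ L := by
    intro x hx
    by_contra hxc
    obtain ⟨y, hy, hyV⟩ := mem_closure_iff_nhds.1 hx.1 _
      (connectedComponentIn_mem_nhds (hcl.isOpen_compl.mem_nhds hxc))
    have h1 : connectedComponentIn (K ∪ L)ᶜ w = connectedComponentIn (K ∪ L)ᶜ x :=
      (connectedComponentIn_eq hyV).trans (connectedComponentIn_eq hy).symm
    have h2 : x ∈ V := by
      rw [hV, h1]
      exact mem_connectedComponentIn hxc
    exact hx.2 (by rwa [hVo.interior_eq])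
  obtain ⟨g₁, hg₁, hg₁'⟩ := exists_continuousOn_log_sub hK (hKf hwK)
  obtain ⟨g₂, hg₂, hg₂'⟩ := exists_continuousOn_log_sub hL (hLf hwL)
  let g : ℂ → ℂ := fun z => if z ∈ K then g₁ z else g₂ z
  have hgL : EqOn g g₂ L := fun z hz => if_neg fun h => Set.disjoint_left.1 hKL h hz
  have hg : ContinuousOn g (K ∪ L) := by
    refine ContinuousOn.union_of_isClosed ?_ ?_ hK.isClosed hL.isClosed
    · exact hg₁.congr fun z hz => if_pos hz
    · exact hg₂.congr hgL
  have hg' : ∀ z ∈ K ∪ L, Complex.exp (g z) = z - w := by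
    rintro z (hz | hz)
    · simp only [g, if_pos hz, hg₁' z hz]
    · rw [hgL hz, hg₂' z hz]
  obtain ⟨G, hG⟩ := ContinuousMap.exists_restrict_eq hcl
    (⟨(K ∪ L).domRestrict g, continuousOn_iff_continuous_domRestrict.1 hg⟩ : C(↥(K ∪ L), ℂ))
  have hG' : ∀ z ∈ K ∪ L, G z = g z := fun z hz => congrArg (fun f : C(↥(K ∪ L), ℂ) => f ⟨z, hz⟩) hG
  obtain ⟨R, hR⟩ := hb.exists_norm_le
  refine not_continuous_nonvanishing (w := w) (R := |R| + ‖w‖ + 1)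
    (F := V.piecewise (fun z => Complex.exp (G z)) fun z => z - w) ?_ ?_ (by positivity) ?_
  · refine Continuous.piecewise (fun z hz => ?_) (by fun_prop) (by fun_prop)
    rw [hG' z (hfr hz), hg' z (hfr hz)]
  · intro z
    by_cases hz : z ∈ V
    · rw [piecewise_eq_of_mem _ _ _ hz]
      exact Complex.exp_ne_zero _
    · rw [piecewise_eq_of_notMem _ _ _ hz]
      exact sub_ne_zero.2 fun h => hz (h ▸ hwV)
  · intro z hz
    refine piecewise_eq_of_notMem _ _ _ fun hzV => ?_
    have h1 := norm_sub_le z w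
    linarith [hR z hzV, le_abs_self R]

/-! ### Polynomial approximation of Cauchy kernels and exhaustion by full sets -/

theorem isFull_empty : IsFull ∅ := by simp [IsFull, outer_empty]

/-- Runge's theorem for a single pole: off a full compact set `M` the function `1 / (w - z)` is
a uniform limit of polynomials on `M`.  The pole is moved along `outer M` from near infinity. -/
theorem IsFull.exists_polynomial {M : Set ℂ} (hf : IsFull M) (hM : IsCompact M) {w : ℂ}
    (hw : w ∉ M) {η : ℝ} (hη : 0 < η) :
    ∃ p : Polynomial ℂ, ∀ z ∈ M, ‖1 - (w - z) * p.eval z‖ < η := by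
  -- Powers of `1 - (w - z) p(z)` are again of this form.
  have boost : ∀ w : ℂ, (∃ p : Polynomial ℂ, ∀ z ∈ M, ‖1 - (w - z) * p.eval z‖ ≤ 3 / 4) →
      ∀ η > 0, ∃ p : Polynomial ℂ, ∀ z ∈ M, ‖1 - (w - z) * p.eval z‖ < η := by
    rintro w ⟨p, hp⟩ η hη
    obtain ⟨n, hn⟩ := exists_pow_lt_of_lt_one hη (show (3 / 4 : ℝ) < 1 by norm_num)
    let q : Polynomial ℂ := 1 - (Polynomial.C w - Polynomial.X) * p
    refine ⟨p * ∑ k ∈ Finset.range n, q ^ k, fun z hz => ?_⟩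
    have h1 : 1 - (w - z) * (p * ∑ k ∈ Finset.range n, q ^ k).eval z
        = (1 - (w - z) * p.eval z) ^ n := by
      have h2 := congrArg (Polynomial.eval z) (mul_neg_geom_sum q n)
      simp only [q, Polynomial.eval_mul, Polynomial.eval_sub, Polynomial.eval_one,
        Polynomial.eval_C, Polynomial.eval_X, Polynomial.eval_pow] at h2 ⊢
      linear_combination -h2
    rw [h1, norm_pow]
    exact (pow_le_pow_left₀ (norm_nonneg _) (hp z hz) n).trans_lt hn
  refine boost w ?_ η hη
  refine outer_induction
    (P := fun w => ∃ p : Polynomial ℂ, ∀ z ∈ M, ‖1 - (w - z) * p.eval z‖ ≤ 3 / 4) ?_ ?_ (hf hw)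
  · intro w hw
    obtain ⟨r, hr, hrM⟩ := Metric.isOpen_iff.1 hM.isClosed.isOpen_compl w hw
    refine ⟨r / 16, by positivity, ?_⟩
    intro a ha b hb h
    obtain ⟨p, hp⟩ := boost a h (1 / 4) (by norm_num)
    refine ⟨p, fun z hz => ?_⟩
    have hzw : r ≤ ‖w - z‖ := by
      by_contra! h
      exact hrM (by rwa [Metric.mem_ball, dist_eq_norm, norm_sub_rev]) hz
    have h1 : ‖w - a‖ < r / 16 := by simpa [dist_eq_norm, norm_sub_rev] using ha
    have h2 : ‖w - b‖ < r / 16 := by simpa [dist_eq_norm, norm_sub_rev] using hb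
    have hza : r / 2 ≤ ‖a - z‖ := by
      have : ‖w - z‖ ≤ ‖w - a‖ + ‖a - z‖ := by simpa using norm_add_le (w - a) (a - z)
      linarith
    have hab : ‖a - b‖ ≤ r / 8 := by
      have : ‖a - b‖ ≤ ‖w - b‖ + ‖w - a‖ := by simpa using norm_sub_le (w - b) (w - a)
      linarith
    have h3 : ‖(a - z) * p.eval z‖ ≤ 5 / 4 := by
      have : ‖(a - z) * p.eval z‖ ≤ ‖(1 : ℂ)‖ + ‖1 - (a - z) * p.eval z‖ := by
        simpa using norm_sub_le (1 : ℂ) (1 - (a - z) * p.eval z)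
      rw [norm_one] at this
      linarith [hp z hz]
    have h4 : ‖p.eval z‖ * (r / 2) ≤ 5 / 4 := by
      rw [norm_mul] at h3
      nlinarith [norm_nonneg (p.eval z)]
    have h5 : ‖(a - b) * p.eval z‖ ≤ 1 / 2 := by
      rw [norm_mul]
      nlinarith [norm_nonneg (p.eval z), norm_nonneg (a - b)]
    calc ‖1 - (b - z) * p.eval z‖ = ‖(1 - (a - z) * p.eval z) + (a - b) * p.eval z‖ := by
          congr 1; ring
      _ ≤ ‖1 - (a - z) * p.eval z‖ + ‖(a - b) * p.eval z‖ := norm_add_le _ _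
      _ ≤ 3 / 4 := by linarith [hp z hz]
  · obtain ⟨R, hR, hMR⟩ := exists_pos_norm_le hM
    refine ⟨2 * R, fun w _ hw => ⟨Polynomial.C (1 / w), fun z hz => ?_⟩⟩
    have hw0 : 0 < ‖w‖ := by linarith
    have hw0' : w ≠ 0 := norm_pos_iff.1 hw0
    have : 1 - (w - z) * (Polynomial.C (1 / w)).eval z = z / w := by
      rw [Polynomial.eval_C]
      field_simp
      ring
    rw [this, norm_div, div_le_iff₀ hw0]
    linarith [hMR z hz]

/-- There is a countable family of full compact sets that separates full compact sets from
closed sets. -/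
theorem exists_seq_full : ∃ T : ℕ → Set ℂ, (∀ n, IsCompact (T n) ∧ IsFull (T n)) ∧
    ∀ K U : Set ℂ, IsCompact K → IsFull K → IsOpen U → K ⊆ U → ∃ n, K ⊆ T n ∧ T n ⊆ U := by
  let D : ℕ × ℕ → Set ℂ := fun x =>
    Metric.closedBall (TopologicalSpace.denseSeq ℂ x.1) (1 / (x.2 + 1))
  let B : Finset (ℕ × ℕ) → Set ℂ := fun t => ⋃ x ∈ t, D x
  have hB : ∀ t, IsCompact (B t) := fun t =>
    t.isCompact_biUnion fun x _ => isCompact_closedBall _ _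
  obtain ⟨e, he⟩ := exists_surjective_nat (Finset (ℕ × ℕ))
  refine ⟨fun n => hull (B (e n)), fun n => ⟨isCompact_hull (hB _), isFull_hull _⟩, ?_⟩
  intro K U hK hKf hU hKU
  obtain ⟨M, -, hMf, hKM, hMU⟩ := hKf.exists_nhd hK hU hKU
  have hloc : ∀ z ∈ K, ∃ x : ℕ × ℕ, z ∈ interior (D x) ∧ D x ⊆ M := by
    intro z hz
    obtain ⟨r, hr, hrM⟩ := Metric.isOpen_iff.1 isOpen_interior z (hKM hz)
    obtain ⟨n, hn⟩ := exists_nat_one_div_lt (half_pos hr)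
    have hn0 : (0 : ℝ) < 1 / (n + 1) := Nat.one_div_pos_of_nat
    obtain ⟨m, hm⟩ := Metric.denseRange_iff.1 (TopologicalSpace.denseRange_denseSeq ℂ) z _ hn0
    refine ⟨(m, n), Metric.ball_subset_interior_closedBall hm, fun y hy => interior_subset (hrM ?_)⟩
    have h1 : dist y (TopologicalSpace.denseSeq ℂ m) ≤ 1 / (n + 1) := hy
    have h2 := dist_triangle_right y z (TopologicalSpace.denseSeq ℂ m)
    rw [Metric.mem_ball]
    linarith
  choose! x hx hxM using hloc
  obtain ⟨t, ht, hKt⟩ := hK.elim_nhds_subcover (fun z => interior (D (x z)))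
    fun z hz => isOpen_interior.mem_nhds (hx z hz)
  obtain ⟨n, hn⟩ := he (t.image x)
  refine ⟨n, ?_, ?_⟩
  · change K ⊆ hull (B (e n))
    rw [hn]
    refine Subset.trans (fun z hz => ?_) (subset_hull _)
    obtain ⟨y, hy, hzy⟩ := mem_iUnion₂.1 (hKt hz)
    exact mem_iUnion₂.2 ⟨x y, Finset.mem_image_of_mem _ hy, interior_subset hzy⟩
  · change hull (B (e n)) ⊆ U
    rw [hn]
    refine ((hull_mono ?_).trans hMf.hull_subset).trans hMU
    refine iUnion₂_subset fun y hy => ?_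
    obtain ⟨z, hz, rfl⟩ := Finset.mem_image.1 hy
    exact hxM z (ht z hz)

/-- The full compact sets that do not meet a domain `Ω` and a closed set `C` are contained in
countably many of them.  Given such a set, a full neighbourhood that omits a point `x₀` of `Ω` stays
full when `Ω` is removed from it. -/
theorem exists_seq_full_disjoint {Ω C : Set ℂ} (hΩ : IsOpen Ω) (hΩc : IsConnected Ω)
    (hC : IsClosed C) : ∃ T : ℕ → Set ℂ,
      (∀ n, IsCompact (T n) ∧ IsFull (T n) ∧ Disjoint (T n) (Ω ∪ C)) ∧
      ∀ K : Set ℂ, IsCompact K → IsFull K → Disjoint K (Ω ∪ C) → ∃ n, K ⊆ T n := by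
  classical
  obtain ⟨M, hM, hMK⟩ := exists_seq_full
  obtain ⟨x₀, hx₀⟩ := hΩc.nonempty
  refine ⟨fun n => if x₀ ∉ M n ∧ Disjoint (M n) C then M n \ Ω else ∅, fun n => ?_, ?_⟩
  · by_cases h : x₀ ∉ M n ∧ Disjoint (M n) C
    · simp only [if_pos h]
      refine ⟨(hM n).1.diff hΩ, fun w hw => ?_, ?_⟩
      · have hanti : outer (M n) ⊆ outer (M n \ Ω) := outer_anti sdiff_subset
        by_cases hwM : w ∈ M n
        · have hwΩ : w ∈ Ω := by
            by_contra hwΩ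
            exact hw ⟨hwM, hwΩ⟩
          exact mem_outer_of_isPreconnected hΩc.isPreconnected (fun z hz h => h.2 hz) hx₀ hwΩ
            (hanti ((hM n).2 h.1))
        · exact hanti ((hM n).2 hwM)
      · exact Disjoint.union_right disjoint_sdiff_left (h.2.mono_left sdiff_subset)
    · simp only [if_neg h]
      exact ⟨isCompact_empty, isFull_empty, empty_disjoint _⟩
  · intro K hK hKf hKd
    obtain ⟨n, hn, hnU⟩ := hMK K (C ∪ {x₀})ᶜ hK hKf (hC.union isClosed_singleton).isOpen_compl
      (by
        rintro z hz (hzC | rfl)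
        · exact Set.disjoint_left.1 hKd hz (Or.inr hzC)
        · exact Set.disjoint_left.1 hKd hz (Or.inl hx₀))
    refine ⟨n, ?_⟩
    have h : x₀ ∉ M n ∧ Disjoint (M n) C :=
      ⟨fun h => hnU h (Or.inr rfl), Set.disjoint_left.2 fun z hz hzC => hnU hz (Or.inl hzC)⟩
    simp only [if_pos h]
    exact fun z hz => ⟨hn hz, fun hzΩ => Set.disjoint_left.1 hKd hz (Or.inl hzΩ)⟩

section Integrals

open MeasureTheory

/-! ### Cauchy–Pompeiu kernels -/

/-- Twice the Wirtinger derivative `∂F/∂z̄`. -/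
def dbar (F : ℂ → ℂ) (w : ℂ) : ℂ := fderiv ℝ F w 1 + Complex.I * fderiv ℝ F w Complex.I

theorem continuous_dbar {F : ℂ → ℂ} (hF : ContDiff ℝ 1 F) : Continuous (dbar F) := by
  have h := hF.continuous_fderiv one_ne_zero
  unfold dbar
  fun_prop

theorem dbar_eq_zero_of_eventuallyEq_const {F : ℂ → ℂ} {w c : ℂ} (h : F =ᶠ[𝓝 w] fun _ => c) :
    dbar F w = 0 := by
  simp [dbar, h.fderiv_eq]

theorem tsupport_dbar_subset (F : ℂ → ℂ) : tsupport (dbar F) ⊆ tsupport F := by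
  refine closure_minimal (fun w hw => ?_) (isClosed_tsupport F)
  by_contra h
  exact hw (dbar_eq_zero_of_eventuallyEq_const (c := 0) (notMem_tsupport_iff_eventuallyEq.1 h))

theorem integral_dbar_eq_zero {F : ℂ → ℂ} (hF : ContDiff ℝ 1 F) (hc : HasCompactSupport F) :
    ∫ w, dbar F w = 0 := by
  have hcont : ∀ v : ℂ, Continuous fun w => fderiv ℝ F w v := fun v => by
    have h := hF.continuous_fderiv one_ne_zero
    fun_prop
  have hint : ∀ v : ℂ, Integrable fun w => fderiv ℝ F w v := fun v =>
    (hcont v).integrable_of_hasCompactSupport (hc.fderiv_apply ℝ v)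
  have hzero : ∀ v : ℂ, ∫ w, fderiv ℝ F w v = 0 := by
    intro v
    have h := integral_mul_fderiv_eq_neg_fderiv_mul_of_integrable (μ := volume) (v := v)
      (f := fun _ : ℂ => (1 : ℂ)) (g := F) (by simp) (by simpa using hint v)
      (by simpa using hF.continuous.integrable_of_hasCompactSupport hc)
      (fun _ _ => differentiableAt_const _) (fun w _ => hF.differentiable one_ne_zero w)
    simpa using h
  unfold dbar
  rw [integral_add (hint _) ((hint _).const_mul _), integral_const_mul, hzero, hzero]
  simp

theorem dbar_mul {χ g : ℂ → ℂ} {w : ℂ} (hχ : DifferentiableAt ℝ χ w)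
    (hg : DifferentiableAt ℂ g w) : dbar (fun w => χ w * g w) w = dbar χ w * g w := by
  have hg' := hg.hasFDerivAt.restrictScalars ℝ
  have h := (hχ.hasFDerivAt.fun_mul hg').fderiv
  have hI : fderiv ℂ g w Complex.I = Complex.I * fderiv ℂ g w 1 := by
    simpa only [smul_eq_mul, mul_one] using (fderiv ℂ g w).map_smul Complex.I (1 : ℂ)
  simp only [dbar, h]
  simp only [add_apply, smul_apply,
    ContinuousLinearMap.coe_restrictScalars', smul_eq_mul, hI]
  linear_combination (χ w * fderiv ℂ g w 1) * Complex.I_mul_I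

/-- Stokes' theorem for a cut-off function and a function holomorphic near its support. -/
theorem integral_dbar_mul_eq_zero {χ g : ℂ → ℂ} {U : Set ℂ} (hχ : ContDiff ℝ 1 χ)
    (hc : HasCompactSupport χ) (hU : IsOpen U) (hχU : tsupport χ ⊆ U)
    (hg : DifferentiableOn ℂ g U) : ∫ w, dbar χ w * g w = 0 := by
  have hF : ContDiff ℝ 1 fun w => χ w * g w := by
    rw [contDiff_iff_contDiffAt]
    intro w
    by_cases hw : w ∈ tsupport χ
    · have : ContDiffAt ℂ 1 g w := (hg.analyticAt (hU.mem_nhds (hχU hw))).contDiffAt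
      exact hχ.contDiffAt.mul (this.restrict_scalars ℝ)
    · refine contDiffAt_const (c := 0) |>.congr_of_eventuallyEq ?_
      filter_upwards [notMem_tsupport_iff_eventuallyEq.1 hw] with x hx
      simp [hx]
  rw [← integral_dbar_eq_zero hF hc.mul_right]
  congr 1
  ext w
  by_cases hw : w ∈ tsupport χ
  · rw [dbar_mul (hχ.differentiable one_ne_zero w)
      (hg.differentiableAt (hU.mem_nhds (hχU hw)))]
  · have h := notMem_tsupport_iff_eventuallyEq.1 hw
    rw [dbar_eq_zero_of_eventuallyEq_const (c := 0) h, dbar_eq_zero_of_eventuallyEq_const (c := 0),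
      zero_mul]
    filter_upwards [h] with x hx
    simp [hx]

/-- A radial cut-off function, equal to `1` for `‖w - z‖ ≤ 1`. -/
def radialBump (z w : ℂ) : ℂ := (Real.smoothTransition (2 - ‖w - z‖ ^ 2) : ℂ)

theorem contDiff_radialBump (z : ℂ) : ContDiff ℝ 1 (radialBump z) := by
  have h1 : ContDiff ℝ 1 fun w : ℂ => 2 - ‖w - z‖ ^ 2 :=
    contDiff_const.sub ((contDiff_norm_sq ℝ).comp (contDiff_id.sub contDiff_const))
  exact Complex.ofRealCLM.contDiff.comp (Real.smoothTransition.contDiff.comp h1)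

theorem radialBump_eventuallyEq (z : ℂ) : radialBump z =ᶠ[𝓝 z] fun _ => 1 := by
  filter_upwards [Metric.ball_mem_nhds z one_pos] with w hw
  have : ‖w - z‖ < 1 := by simpa [dist_eq_norm] using hw
  rw [radialBump, Real.smoothTransition.one_of_one_le (by nlinarith [norm_nonneg (w - z)])]
  simp

theorem hasCompactSupport_radialBump (z : ℂ) : HasCompactSupport (radialBump z) := by
  refine HasCompactSupport.of_support_subset_isCompact (isCompact_closedBall z 2) fun w hw => ?_
  by_contra h
  have h' : 2 < ‖w - z‖ := by simpa [dist_eq_norm] using h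
  refine hw ?_
  rw [radialBump, Real.smoothTransition.zero_of_nonpos (by nlinarith)]
  simp

theorem dbar_radialBump (z w : ℂ) : dbar (radialBump z) w
    = -2 * ((deriv Real.smoothTransition (2 - ‖w - z‖ ^ 2) : ℝ) : ℂ) * (w - z) := by
  have h1 := ((hasFDerivAt_id (𝕜 := ℝ) w).sub_const z).norm_sq
  have h2 := ((Real.smoothTransition.contDiff (n := 1)).differentiable (by simp)
    (2 - ‖w - z‖ ^ 2)).hasDerivAt.comp_hasFDerivAt w (h1.const_sub 2)
  have h3 : HasFDerivAt (radialBump z) _ w := (Complex.ofRealCLM.hasFDerivAt).comp w h2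
  rw [dbar, h3.fderiv]
  simp [Complex.inner]
  apply Complex.ext <;> simp <;> ring

theorem integral_dbar_radialBump (z : ℂ) :
    ∫ w, dbar (radialBump z) w / (w - z) = -(2 * Real.pi : ℂ) := by
  let ψ : ℝ → ℝ := Real.smoothTransition
  have hψ : ContDiff ℝ 1 ψ := Real.smoothTransition.contDiff (n := 1)
  have h1 : ∀ w, dbar (radialBump z) w / (w - z)
      = ((-2 * deriv ψ (2 - ‖w - z‖ ^ 2) : ℝ) : ℂ) := by
    intro w
    rw [dbar_radialBump]
    by_cases hw : w = z
    · subst hw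
      have : deriv ψ 2 = 0 := by
        have : ψ =ᶠ[𝓝 2] fun _ => 1 := by
          filter_upwards [lt_mem_nhds (show (1 : ℝ) < 2 by norm_num)] with x hx
          exact Real.smoothTransition.one_of_one_le hx.le
        rw [this.deriv_eq]
        simp
      simp [this]
    · have : w - z ≠ 0 := sub_ne_zero.2 hw
      field_simp
      push_cast
      rfl
  simp_rw [h1]
  rw [integral_complex_ofReal,
    integral_sub_right_eq_self (fun w : ℂ => -2 * deriv ψ (2 - ‖w‖ ^ 2)) z,
    integral_const_mul, integral_fun_norm_addHaar volume (fun y => deriv ψ (2 - y ^ 2))]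
  let G : ℝ → ℝ := fun y => ψ (2 - y ^ 2) * (-1 / 2)
  have hG : ContDiff ℝ 1 G := (hψ.comp (by fun_prop)).mul contDiff_const
  have hGc : HasCompactSupport G := by
    refine HasCompactSupport.of_support_subset_isCompact (isCompact_Icc (a := (-2 : ℝ)) (b := 2)) ?_
    intro y hy
    by_contra h
    refine hy ?_
    have : 2 - y ^ 2 ≤ 0 := by
      rw [mem_Icc, not_and_or] at h
      rcases h with h | h <;> nlinarith
    simp [G, ψ, Real.smoothTransition.zero_of_nonpos this]
  have hGd : ∀ y, deriv G y = y ^ (2 - 1) • deriv ψ (2 - y ^ 2) := by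
    intro y
    have h2 : HasDerivAt (fun y : ℝ => 2 - y ^ 2) (-(2 * y)) y := by
      simpa using ((hasDerivAt_pow 2 y).const_sub 2)
    have h3 := (((hψ.differentiable one_ne_zero _).hasDerivAt.comp y h2).mul_const (-1 / 2 : ℝ))
    have h4 : HasDerivAt G _ y := h3
    rw [h4.deriv]
    simp
    ring
  have hint := hGc.integral_Ioi_deriv_eq hG 0
  simp_rw [hGd] at hint
  rw [Complex.finrank_real_complex, hint]
  have hv : (volume : Measure ℂ).real (Metric.ball 0 1) = Real.pi := by
    simp [Measure.real, Complex.volume_ball]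
  have h0 : ψ 2 = 1 := Real.smoothTransition.one_of_one_le (by norm_num)
  rw [hv]
  simp [G, h0]
  ring

/-- The Cauchy–Pompeiu formula: holomorphic functions on `U` are reproduced on the compact set `M`
by a kernel supported in a compact subset of `U \ M`. -/
theorem exists_cauchy_kernel {M U : Set ℂ} (hM : IsCompact M) (hU : IsOpen U) (hMU : M ⊆ U) :
    ∃ φ : ℂ → ℂ, Continuous φ ∧ HasCompactSupport φ ∧ tsupport φ ⊆ U \ M ∧
      ∀ f : ℂ → ℂ, DifferentiableOn ℂ f U → ∀ z ∈ M, ∫ w, φ w / (w - z) * f w = f z := by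
  obtain ⟨K, hK, hMK, hKU⟩ := exists_compact_between hM hU hMU
  obtain ⟨η, hη0, hη1, -⟩ := exists_contMDiffMap_zero_one_nhds_of_isClosed
    (modelWithCornersSelf ℝ ℂ) (n := 1) (s := (interior K)ᶜ) (t := M)
    isOpen_interior.isClosed_compl hM.isClosed (disjoint_compl_left_iff_subset.2 hMK)
  let χ : ℂ → ℂ := fun w => (η w : ℂ)
  have hχ : ContDiff ℝ 1 χ := Complex.ofRealCLM.contDiff.comp η.contMDiff.contDiff
  have hχK : tsupport χ ⊆ K := by
    refine closure_minimal (fun w hw => ?_) hK.isClosed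
    by_contra h
    refine hw ?_
    have h2 : w ∈ (interior K)ᶜ := fun h' => h (interior_subset h')
    simp [χ, (hη0.self_of_nhdsSet) w h2]
  have hχc : HasCompactSupport χ := hK.of_isClosed_subset (isClosed_tsupport _) hχK
  have hχ1 : ∀ z ∈ M, χ =ᶠ[𝓝 z] fun _ => 1 := by
    intro z hz
    filter_upwards [(eventually_nhdsSet_iff_forall.1 hη1) z hz] with w hw
    simp [χ, hw]
  have hsupp : tsupport (dbar χ) ⊆ U \ M := by
    intro w hw
    refine ⟨hKU (hχK (tsupport_dbar_subset χ hw)), fun hwM => ?_⟩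
    refine (notMem_tsupport_iff_eventuallyEq.2 ?_) hw
    filter_upwards [(hχ1 w hwM).eventuallyEq_nhds] with x hx
    exact dbar_eq_zero_of_eventuallyEq_const hx
  have hd0 : ∀ z ∈ M, dbar χ z = 0 := fun z hz => dbar_eq_zero_of_eventuallyEq_const (hχ1 z hz)
  have hcs : HasCompactSupport (dbar χ) :=
    hχc.of_isClosed_subset (isClosed_tsupport _) (tsupport_dbar_subset χ)
  have hint : ∀ z ∈ M, ∀ f : ℂ → ℂ, ContinuousOn f U →
      Integrable fun w => dbar χ w / (w - z) * f w := by
    intro z hz f hf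
    rw [← integrableOn_iff_integrable_of_support_subset (s := tsupport (dbar χ))]
    · refine ContinuousOn.integrableOn_compact hcs ?_
      refine ((continuous_dbar hχ).continuousOn.div (by fun_prop) fun w hw => ?_).mul
        (hf.mono fun w hw => (hsupp hw).1)
      exact sub_ne_zero.2 fun h => (hsupp hw).2 (h ▸ hz)
    · intro w hw
      refine subset_tsupport _ fun h => hw ?_
      simp [h]
  -- The value of the kernel on constants does not depend on the cut-off.
  have hone : ∀ z ∈ M, ∫ w, dbar χ w / (w - z) = -(2 * Real.pi : ℂ) := by
    intro z hz
    rw [← integral_dbar_radialBump z, ← sub_eq_zero, ← integral_sub]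
    · have h0 : tsupport (fun w => χ w - radialBump z w) ⊆ {z}ᶜ := by
        rintro w hw rfl
        refine (notMem_tsupport_iff_eventuallyEq.2 ?_) hw
        filter_upwards [hχ1 w hz, radialBump_eventuallyEq w] with x h1 h2
        simp [h1, h2]
      have h := integral_dbar_mul_eq_zero (hχ.sub (contDiff_radialBump z))
        (hχc.sub (hasCompactSupport_radialBump z)) isOpen_compl_singleton h0
        (g := fun w => (w - z)⁻¹) (fun w hw => by
          have : w - z ≠ 0 := sub_ne_zero.2 hw
          fun_prop (disch := assumption))
      rw [← h]
      congr 1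
      ext w
      have h2 : dbar (fun w => χ w - radialBump z w) w = dbar χ w - dbar (radialBump z) w := by
        have h3 := ((hχ.differentiable one_ne_zero w).hasFDerivAt.fun_sub
          ((contDiff_radialBump z).differentiable one_ne_zero w).hasFDerivAt).fderiv
        simp only [dbar]
        rw [h3]
        simp only [sub_apply]
        ring
      rw [h2]
      ring
    · simpa using hint z hz (fun _ => 1) continuousOn_const
    · by_contra h
      have h1 := integral_undef h
      rw [integral_dbar_radialBump] at h1
      simp [Real.pi_ne_zero] at h1
  refine ⟨fun w => -(2 * Real.pi : ℂ)⁻¹ * dbar χ w, by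
    have := continuous_dbar hχ
    fun_prop, hcs.mul_left, (tsupport_mul_subset_right).trans hsupp, ?_⟩
  intro f hf z hz
  have hpi : (2 * Real.pi : ℂ) ≠ 0 := by simp [Real.pi_ne_zero]
  have h1 := integral_dbar_mul_eq_zero hχ hχc hU (hχK.trans hKU)
    ((Complex.differentiableOn_dslope (hU.mem_nhds (hMU hz))).2 hf)
  have h2 : ∀ w, dbar χ w * dslope f z w
      = dbar χ w / (w - z) * f w - dbar χ w / (w - z) * f z := by
    intro w
    by_cases hw : w = z
    · subst hw
      simp [hd0 w hz]
    · rw [dslope_of_ne _ hw, slope_def_field]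
      ring
  simp_rw [h2] at h1
  rw [integral_sub (hint z hz f hf.continuousOn) (hint z hz _ continuousOn_const),
    integral_mul_const, hone z hz, sub_eq_zero] at h1
  have h3 : ∀ w, -(2 * Real.pi : ℂ)⁻¹ * dbar χ w / (w - z) * f w
      = -(2 * Real.pi : ℂ)⁻¹ * (dbar χ w / (w - z) * f w) := fun w => by ring
  simp_rw [h3]
  rw [integral_const_mul, h1]
  field_simp

/-! ### Cauchy–Pompeiu formula on products and Osgood's lemma -/

/-- `φ` is a kernel that reproduces, on `M`, the functions holomorphic on `U`, and has compact
support in `U \ M`. -/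
structure IsCauchyKernel (M U : Set ℂ) (φ : ℂ → ℂ) : Prop where
  continuous : Continuous φ
  compact : HasCompactSupport φ
  tsupport_subset : tsupport φ ⊆ U \ M
  integral_eq : ∀ f : ℂ → ℂ, DifferentiableOn ℂ f U → ∀ z ∈ M, ∫ w, φ w / (w - z) * f w = f z

variable {d : ℕ}

/-- Continuity together with holomorphy in each variable separately. -/
def IsSeparatelyHolomorphicOn (f : (Fin d → ℂ) → ℂ) (O : Set (Fin d → ℂ)) : Prop :=
  ContinuousOn f O ∧ ∀ z ∈ O, ∀ i, DifferentiableAt ℂ (fun w => f (Function.update z i w)) (z i)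

theorem isSeparatelyHolomorphicOn_of_analyticOnNhd {f : (Fin d → ℂ) → ℂ} {O : Set (Fin d → ℂ)}
    (h : AnalyticOnNhd ℂ f O) : IsSeparatelyHolomorphicOn f O := by
  refine ⟨h.continuousOn, fun z hz i => ?_⟩
  have h1 : DifferentiableAt ℂ f (Function.update z i (z i)) := by
    rw [Function.update_eq_self]
    exact (h z hz).differentiableAt
  exact h1.comp (z i) (hasDerivAt_update z i (z i)).differentiableAt

/-- The product kernel. -/
def prodKernel (φ : Fin d → ℂ → ℂ) (z w : Fin d → ℂ) : ℂ := ∏ i, φ i (w i) / (w i - z i)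

theorem isCompact_pi_tsupport {M U : Fin d → Set ℂ} {φ : Fin d → ℂ → ℂ}
    (hφ : ∀ i, IsCauchyKernel (M i) (U i) (φ i)) :
    IsCompact (univ.pi fun i => tsupport (φ i)) :=
  isCompact_univ_pi fun i => (hφ i).compact

theorem prodKernel_eq_zero {φ : Fin d → ℂ → ℂ} (z : Fin d → ℂ) {w : Fin d → ℂ}
    (hw : w ∉ univ.pi fun i => tsupport (φ i)) : prodKernel φ z w = 0 := by
  rw [mem_univ_pi, not_forall] at hw
  obtain ⟨i, hi⟩ := hw
  refine Finset.prod_eq_zero (Finset.mem_univ i) ?_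
  rw [image_eq_zero_of_notMem_tsupport hi, zero_div]

theorem continuousOn_prodKernel {M U : Fin d → Set ℂ} {φ : Fin d → ℂ → ℂ}
    (hφ : ∀ i, IsCauchyKernel (M i) (U i) (φ i)) {z : Fin d → ℂ} (hz : z ∈ univ.pi M) :
    ContinuousOn (prodKernel φ z) (univ.pi fun i => tsupport (φ i)) := by
  refine continuousOn_finsetProd _ fun i _ => ContinuousOn.div ?_ (by fun_prop) fun w hw => ?_
  · exact ((hφ i).continuous.comp (continuous_apply i)).continuousOn
  · exact sub_ne_zero.2 fun h => ((hφ i).tsupport_subset (hw i trivial)).2 (h ▸ hz i trivial)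

theorem integrable_prodKernel_mul {M U : Fin d → Set ℂ} {φ : Fin d → ℂ → ℂ}
    (hφ : ∀ i, IsCauchyKernel (M i) (U i) (φ i)) {z : Fin d → ℂ} (hz : z ∈ univ.pi M)
    {f : (Fin d → ℂ) → ℂ} (hf : ContinuousOn f (univ.pi U)) :
    Integrable fun w => prodKernel φ z w * f w := by
  rw [← integrableOn_iff_integrable_of_support_subset (s := univ.pi fun i => tsupport (φ i))]
  · refine ContinuousOn.integrableOn_compact (isCompact_pi_tsupport hφ) ?_
    exact (continuousOn_prodKernel hφ hz).mul
      (hf.mono (pi_mono fun i _ => (hφ i).tsupport_subset.trans sdiff_subset))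
  · intro w hw
    by_contra h
    exact hw (by simp [prodKernel_eq_zero z h])

/-- The Cauchy–Pompeiu formula in several variables. -/
theorem integral_prodKernel_mul {d : ℕ} {M U : Fin d → Set ℂ} {φ : Fin d → ℂ → ℂ}
    (hφ : ∀ i, IsCauchyKernel (M i) (U i) (φ i)) (hMU : ∀ i, M i ⊆ U i)
    {f : (Fin d → ℂ) → ℂ}
    (hf : IsSeparatelyHolomorphicOn f (univ.pi U)) {z : Fin d → ℂ} (hz : z ∈ univ.pi M) :
    ∫ w, prodKernel φ z w * f w = f z := by
  induction d with
  | zero =>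
    have : ∀ w, prodKernel φ z w * f w = f z := fun w => by
      simp [prodKernel, Subsingleton.elim w z]
    simp_rw [this]
    simp [Measure.real, volume_pi]
  | succ n ih =>
    have hmp := volume_preserving_piFinSuccAbove (fun _ : Fin (n + 1) => ℂ) 0
    have hsymm : ∀ p : ℂ × (Fin n → ℂ),
        (MeasurableEquiv.piFinSuccAbove (fun _ : Fin (n + 1) => ℂ) 0).symm p
          = Fin.cons p.1 p.2 := fun p => by
      simp [MeasurableEquiv.piFinSuccAbove, Fin.insertNthEquiv]
    have hint := integrable_prodKernel_mul hφ hz hf.1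
    rw [← hmp.symm.integral_comp', Measure.volume_eq_prod, integral_prod]
    swap
    · rw [← Measure.volume_eq_prod]
      exact (hmp.symm.integrable_comp_emb (MeasurableEquiv.measurableEmbedding _)).2 hint
    simp_rw [hsymm]
    have hzt : Fin.tail z ∈ univ.pi (Fin.tail M) := fun i _ => hz i.succ trivial
    have hztU : Fin.tail z ∈ univ.pi (Fin.tail U) := fun i _ => hMU _ (hz i.succ trivial)
    have hcons : ∀ w₀ ∈ U 0, ∀ w ∈ univ.pi (Fin.tail U),
        (Fin.cons w₀ w : Fin (n + 1) → ℂ) ∈ univ.pi U := by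
      intro w₀ h₀ w hw i _
      refine Fin.cases ?_ (fun j => ?_) i
      · exact h₀
      · exact hw j trivial
    have hinner : ∀ w₀ : ℂ, ∫ w : Fin n → ℂ,
        prodKernel φ z (Fin.cons w₀ w) * f (Fin.cons w₀ w)
          = φ 0 w₀ / (w₀ - z 0) * f (Fin.cons w₀ (Fin.tail z)) := by
      intro w₀
      have h1 : ∀ w : Fin n → ℂ, prodKernel φ z (Fin.cons w₀ w) * f (Fin.cons w₀ w)
          = φ 0 w₀ / (w₀ - z 0) * (prodKernel (Fin.tail φ) (Fin.tail z) w
            * f (Fin.cons w₀ w)) := by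
        intro w
        simp only [prodKernel, Fin.prod_univ_succ, Fin.cons_zero, Fin.cons_succ, Fin.tail]
        ring
      simp_rw [h1]
      rw [integral_const_mul]
      by_cases h0 : w₀ ∈ tsupport (φ 0)
      · have h0U := ((hφ 0).tsupport_subset h0).1
        rw [ih (φ := Fin.tail φ) (f := fun w => f (Fin.cons w₀ w)) (fun i => hφ i.succ)
          (fun i => hMU i.succ) ⟨?_, ?_⟩ hzt]
        · exact hf.1.comp (by fun_prop) fun w hw => hcons _ h0U _ hw
        · intro w hw i
          have h2 := hf.2 _ (hcons _ h0U _ hw) i.succ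
          simpa only [← Fin.cons_update, Fin.cons_succ] using h2
      · simp [image_eq_zero_of_notMem_tsupport h0]
    simp_rw [hinner]
    rw [(hφ 0).integral_eq (fun w₀ => f (Fin.cons w₀ (Fin.tail z))) _ _ (hz 0 trivial),
      Fin.cons_self_tail]
    intro w₀ h₀
    have h2 := hf.2 _ (hcons _ h₀ _ hztU) 0
    simp only [Fin.update_cons_zero, Fin.cons_zero] at h2
    exact h2.differentiableWithinAt

theorem exists_isCauchyKernel {M U : Set ℂ} (hM : IsCompact M) (hU : IsOpen U) (hMU : M ⊆ U) :
    ∃ φ, IsCauchyKernel M U φ := by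
  obtain ⟨φ, h1, h2, h3, h4⟩ := exists_cauchy_kernel hM hU hMU
  exact ⟨φ, h1, h2, h3, h4⟩

/-- Integration against a continuous density, as a functional on continuous functions on a compact
set. -/
theorem exists_integral_functional {T : Set (Fin d → ℂ)} (hT : IsCompact T)
    {F : (Fin d → ℂ) → ℂ} (hF : ContinuousOn F T) :
    ∃ Λ : C(T, ℂ) →L[ℂ] ℂ, ∀ (g : (Fin d → ℂ) → ℂ) (k : C(T, ℂ)), (∀ t : T, k t = g t) →
      Λ k = ∫ t in T, F t * g t := by
  have : CompactSpace T := isCompact_iff_compactSpace.1 hT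
  let ν : Measure T := Measure.comap Subtype.val volume
  have : IsFiniteMeasure ν := ⟨by
    rw [Measure.comap_apply _ Subtype.val_injective
      (fun s hs => hT.measurableSet.subtype_image hs) _ MeasurableSet.univ]
    simpa using hT.measure_lt_top⟩
  let F' : C(T, ℂ) := ⟨T.domRestrict F, continuousOn_iff_continuous_domRestrict.1 hF⟩
  have hint : ∀ k : C(T, ℂ), Integrable (fun t => F' t * k t) ν := fun k =>
    (F' * k).continuous.integrable_of_hasCompactSupport (HasCompactSupport.of_compactSpace _)
  let Λ : C(T, ℂ) →ₗ[ℂ] ℂ :=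
    { toFun := fun k => ∫ t, F' t * k t ∂ν
      map_add' := fun k l => by
        rw [← integral_add (hint k) (hint l)]
        simp [mul_add]
      map_smul' := fun c k => by
        rw [RingHom.id_apply, smul_eq_mul, ← integral_const_mul]
        simp [mul_left_comm] }
  refine ⟨Λ.mkContinuous (‖F'‖ * ν.real univ) fun k => ?_, fun g k hk => ?_⟩
  · have h := norm_integral_le_of_norm_le_const (μ := ν) (f := fun t => F' t * k t)
      (C := ‖F'‖ * ‖k‖) (ae_of_all _ fun t => by
        rw [norm_mul]
        exact mul_le_mul (F'.norm_coe_le_norm t) (k.norm_coe_le_norm t) (norm_nonneg _)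
          (norm_nonneg _))
    refine h.trans (le_of_eq ?_)
    ring
  · rw [← integral_subtype_comap hT.measurableSet]
    change ∫ t, F' t * k t ∂ν = _
    simp_rw [hk]
    rfl

/-- Osgood's lemma: a continuous, separately holomorphic function is analytic.  By the product
Cauchy–Pompeiu formula, near a point it is a continuous linear functional of the function
`w ↦ ∏ (wᵢ - zᵢ)⁻¹`, which depends analytically on `z` in the Banach algebra of continuous
functions. -/
theorem IsSeparatelyHolomorphicOn.analyticOnNhd {f : (Fin d → ℂ) → ℂ} {O : Set (Fin d → ℂ)}
    (hO : IsOpen O) (hf : IsSeparatelyHolomorphicOn f O) : AnalyticOnNhd ℂ f O := by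
  intro a ha
  obtain ⟨R, hR, hRO⟩ := Metric.isOpen_iff.1 hO a ha
  let U : Fin d → Set ℂ := fun i => Metric.ball (a i) R
  let M : Fin d → Set ℂ := fun i => Metric.closedBall (a i) (R / 2)
  have hMU : ∀ i, M i ⊆ U i := fun i => Metric.closedBall_subset_ball (by linarith)
  choose φ hφ using fun i => exists_isCauchyKernel (isCompact_closedBall (a i) (R / 2))
    Metric.isOpen_ball (hMU i)
  have hUO : univ.pi U ⊆ O := by rwa [← ball_pi a hR]
  have hf' : IsSeparatelyHolomorphicOn f (univ.pi U) :=
    ⟨hf.1.mono hUO, fun z hz => hf.2 z (hUO hz)⟩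
  set T : Set (Fin d → ℂ) := univ.pi fun i => tsupport (φ i) with hTdef
  have hT : IsCompact T := isCompact_pi_tsupport hφ
  have hTU : T ⊆ univ.pi U := pi_mono fun i _ => (hφ i).tsupport_subset.trans sdiff_subset
  have : CompactSpace T := isCompact_iff_compactSpace.1 hT
  have hF : ContinuousOn (fun w => (∏ i, φ i (w i)) * f w) T := by
    refine ContinuousOn.mul (continuousOn_finsetProd _ fun i _ => ?_) (hf'.1.mono hTU)
    exact ((hφ i).continuous.comp (continuous_apply i)).continuousOn
  obtain ⟨Λ, hΛ⟩ := exists_integral_functional hT hF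
  let c : Fin d → C(T, ℂ) := fun i =>
    ⟨fun t => t.1 i, (continuous_apply i).comp continuous_subtype_val⟩
  let k : (Fin d → ℂ) → C(T, ℂ) := fun z =>
    ∏ i, Ring.inverse (c i - algebraMap ℂ C(T, ℂ) (z i))
  have hunit : ∀ z ∈ univ.pi M, ∀ i, ∃ u : C(T, ℂ)ˣ, (u : C(T, ℂ)) = c i - algebraMap ℂ _ (z i) ∧
      ∀ t : T, Ring.inverse (c i - algebraMap ℂ C(T, ℂ) (z i)) t = (t.1 i - z i)⁻¹ := by
    intro z hz i
    have hne : ∀ t : T, t.1 i - z i ≠ 0 := fun t => sub_ne_zero.2 fun h =>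
      ((hφ i).tsupport_subset (t.2 i trivial)).2 (h ▸ hz i trivial)
    let v : C(T, ℂ) := ⟨fun t => (t.1 i - z i)⁻¹, Continuous.inv₀
      (((continuous_apply i).comp continuous_subtype_val).sub continuous_const) hne⟩
    let u : C(T, ℂ)ˣ := ⟨c i - algebraMap ℂ _ (z i), v,
      by ext t; exact mul_inv_cancel₀ (hne t), by ext t; exact inv_mul_cancel₀ (hne t)⟩
    exact ⟨u, rfl, fun t => by
      rw [show c i - algebraMap ℂ C(T, ℂ) (z i) = (u : C(T, ℂ)) from rfl, Ring.inverse_unit]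
      rfl⟩
  have haM : a ∈ univ.pi M := fun i _ => Metric.mem_closedBall_self (by positivity)
  have hk : AnalyticAt ℂ k a := by
    refine Finset.analyticAt_fun_prod _ fun i _ => ?_
    obtain ⟨u, hu, -⟩ := hunit a haM i
    have h1 : AnalyticAt ℂ (fun z : Fin d → ℂ => c i - algebraMap ℂ C(T, ℂ) (z i)) a := by
      refine analyticAt_const.sub ?_
      simp_rw [Algebra.algebraMap_eq_smul_one]
      exact ((ContinuousLinearMap.proj (R := ℂ) (φ := fun _ : Fin d => ℂ) i).analyticAt a).smul
        analyticAt_const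
    refine AnalyticAt.comp (g := Ring.inverse) ?_ h1
    rw [← hu]
    exact analyticAt_inverse u
  refine ((Λ.analyticAt _).comp hk).congr ?_
  filter_upwards [Metric.ball_mem_nhds a (half_pos hR)] with z hz
  have hzM : z ∈ univ.pi M := by
    rw [← closedBall_pi a (by positivity)]
    exact Metric.ball_subset_closedBall hz
  rw [Function.comp_apply, ← integral_prodKernel_mul hφ hMU hf' hzM,
    hΛ (fun w => ∏ i, (w i - z i)⁻¹) (k z) fun t => ?_]
  · have hpt : ∀ w, (∏ i, φ i (w i)) * f w * ∏ i, (w i - z i)⁻¹ = prodKernel φ z w * f w := by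
      intro w
      simp only [prodKernel, div_eq_mul_inv, Finset.prod_mul_distrib]
      ring
    simp_rw [hpt]
    exact setIntegral_eq_integral_of_forall_compl_eq_zero
      fun w hw => by rw [prodKernel_eq_zero z hw, zero_mul]
  · change (∏ i, Ring.inverse (c i - algebraMap ℂ C(T, ℂ) (z i)) : C(T, ℂ)) t = _
    rw [ContinuousMap.prod_apply]
    exact Finset.prod_congr rfl fun i _ => (hunit z hzM i).choose_spec.2 t

/-! ### Locally uniform limits -/

theorem partialDeriv_eq_deriv {F : (Fin d → ℂ) → ℂ} {z : Fin d → ℂ}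
    (h : DifferentiableAt ℂ F z) (i : Fin d) :
    partialDeriv i F z = deriv (fun w => F (Function.update z i w)) (z i) := by
  have h1 : HasFDerivAt F (fderiv ℂ F z) (Function.update z i (z i)) := by
    rw [Function.update_eq_self]
    exact h.hasFDerivAt
  exact ((h1.comp_hasDerivAt (z i) (hasDerivAt_update z i (z i))).deriv).symm

/-- Cauchy's estimate for partial derivatives. -/
theorem norm_partialDeriv_le {F : (Fin d → ℂ) → ℂ} {a z : Fin d → ℂ} {r C : ℝ} (hr : 0 < r)
    (hF : AnalyticOnNhd ℂ F (Metric.ball a (2 * r))) (hC : ∀ w ∈ Metric.ball a (2 * r), ‖F w‖ ≤ C)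
    (hz : z ∈ Metric.ball a r) (i : Fin d) : ‖partialDeriv i F z‖ ≤ C / r := by
  have hsub : Metric.closedBall z r ⊆ Metric.ball a (2 * r) := by
    refine Metric.closedBall_subset_ball' ?_
    have : dist z a < r := hz
    linarith
  have hmem : ∀ w ∈ Metric.closedBall (z i) r, Function.update z i w ∈ Metric.ball a (2 * r) := by
    intro w hw
    refine hsub ?_
    rw [Metric.mem_closedBall, dist_pi_le_iff hr.le]
    intro j
    by_cases hj : j = i
    · subst hj
      simpa using hw
    · simp [Function.update_of_ne hj, hr.le]
  rw [partialDeriv_eq_deriv (hF z (hsub (Metric.mem_closedBall_self hr.le))).differentiableAt]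
  refine Complex.norm_deriv_le_of_forall_mem_sphere_norm_le hr ?_
    fun w hw => hC _ (hmem w (Metric.sphere_subset_closedBall hw))
  refine DifferentiableOn.diffContOnCl fun w hw => ?_
  have h1 := (hF _ (hmem w (Metric.closure_ball_subset_closedBall hw))).differentiableAt
  exact (h1.comp w (hasDerivAt_update z i w).differentiableAt).differentiableWithinAt

theorem analyticOnNhd_of_tendstoLocallyUniformlyOn {ι : Type*} {p : Filter ι} [p.NeBot]
    {F : ι → (Fin d → ℂ) → ℂ} {f : (Fin d → ℂ) → ℂ} {O : Set (Fin d → ℂ)} (hO : IsOpen O)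
    (hF : ∀ n, AnalyticOnNhd ℂ (F n) O) (h : TendstoLocallyUniformlyOn F f p O) :
    AnalyticOnNhd ℂ f O := by
  refine IsSeparatelyHolomorphicOn.analyticOnNhd hO ⟨?_, fun z hz i => ?_⟩
  · exact h.continuousOn (Frequently.of_forall fun n => (hF n).continuousOn)
  · have hc : Continuous fun w : ℂ => Function.update z i w := by fun_prop
    have hV : IsOpen ((fun w : ℂ => Function.update z i w) ⁻¹' O) := hO.preimage hc
    have h1 := h.comp (fun w : ℂ => Function.update z i w)
      (mapsTo_preimage _ O) hc.continuousOn
    refine (h1.differentiableOn (Eventually.of_forall fun n w hw => ?_) hV).differentiableAt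
      (hV.mem_nhds (by simpa using hz))
    exact (((hF n) _ hw).differentiableAt.comp w
      (hasDerivAt_update z i w).differentiableAt).differentiableWithinAt

theorem tendstoLocallyUniformlyOn_partialDeriv {ι : Type*} {p : Filter ι} [p.NeBot]
    {F : ι → (Fin d → ℂ) → ℂ} {f : (Fin d → ℂ) → ℂ} {O : Set (Fin d → ℂ)} (hO : IsOpen O)
    (hF : ∀ n, AnalyticOnNhd ℂ (F n) O) (h : TendstoLocallyUniformlyOn F f p O) (i : Fin d) :
    TendstoLocallyUniformlyOn (fun n => partialDeriv i (F n)) (partialDeriv i f) p O := by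
  have hf := analyticOnNhd_of_tendstoLocallyUniformlyOn hO hF h
  rw [Metric.tendstoLocallyUniformlyOn_iff]
  intro ε hε a ha
  obtain ⟨R, hR, hRO⟩ := Metric.nhds_basis_closedBall.mem_iff.1 (hO.mem_nhds ha)
  set r := R / 2 with hrdef
  have hr : 0 < r := by positivity
  have hball : Metric.ball a (2 * r) ⊆ O := by
    rw [hrdef, mul_div_cancel₀ _ (two_ne_zero)]
    exact Metric.ball_subset_closedBall.trans hRO
  have hu := (tendstoLocallyUniformlyOn_iff_forall_isCompact hO).1 h _ hRO
    (isCompact_closedBall a R)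
  rw [Metric.tendstoUniformlyOn_iff] at hu
  refine ⟨Metric.ball a r, mem_nhdsWithin_of_mem_nhds (Metric.ball_mem_nhds a hr), ?_⟩
  filter_upwards [hu (ε / 2 * r) (by positivity)] with n hn z hz
  have hzO : z ∈ O := hball (Metric.ball_subset_ball (by linarith) hz)
  have hd : PartiallySmooth.partialDeriv i (fun w => f w - F n w) z
      = PartiallySmooth.partialDeriv i f z - PartiallySmooth.partialDeriv i (F n) z := by
    simp only [PartiallySmooth.partialDeriv]
    rw [fderiv_fun_sub (hf z hzO).differentiableAt ((hF n) z hzO).differentiableAt]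
    rfl
  rw [dist_eq_norm, ← hd]
  refine (norm_partialDeriv_le (C := ε / 2 * r) hr
    (fun w hw => (hf w (hball hw)).sub ((hF n) w (hball hw))) (fun w hw => ?_) hz i).trans_lt ?_
  · have := hn w (Metric.ball_subset_closedBall (by
      rwa [hrdef, mul_div_cancel₀ _ (two_ne_zero)] at hw))
    rw [dist_eq_norm] at this
    exact this.le
  · rw [mul_div_assoc, div_self hr.ne', mul_one]
    linarith

/-- All mixed derivatives of a locally uniformly convergent family of analytic functions
converge. -/
theorem tendstoLocallyUniformlyOn_mixedDeriv {ι : Type*} {p : Filter ι} [p.NeBot]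
    {F : ι → (Fin d → ℂ) → ℂ} {f : (Fin d → ℂ) → ℂ} {O : Set (Fin d → ℂ)} (hO : IsOpen O)
    (hF : ∀ n, AnalyticOnNhd ℂ (F n) O) (h : TendstoLocallyUniformlyOn F f p O)
    (α : Fin d → ℕ) :
    TendstoLocallyUniformlyOn (fun n => mixedDeriv α (F n)) (mixedDeriv α f) p O := by
  suffices H : (∀ n, AnalyticOnNhd ℂ (PartiallySmooth.mixedDeriv α (F n)) O) ∧
      TendstoLocallyUniformlyOn (fun n => PartiallySmooth.mixedDeriv α (F n))
        (PartiallySmooth.mixedDeriv α f) p O from H.2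
  unfold PartiallySmooth.mixedDeriv
  generalize List.finRange d = l
  induction l with
  | nil => exact ⟨hF, h⟩
  | cons i l ih =>
    simp only [List.foldr_cons]
    generalize α i = k
    induction k with
    | zero => exact ih
    | succ k ihk =>
      simp only [Function.iterate_succ_apply']
      exact ⟨fun n z hz => partialDeriv_analyticAt (ihk.1 n z hz),
        tendstoLocallyUniformlyOn_partialDeriv hO ihk.1 ihk.2 i⟩

/-! ### Polynomial approximation on products of full compact sets -/

theorem integral_mem_submodule {X E : Type*} [MeasurableSpace X] {ν : Measure X}
    [IsFiniteMeasure ν] [NormedAddCommGroup E] [NormedSpace ℝ E] [CompleteSpace E]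
    {S : Submodule ℝ E} (hS : IsClosed (S : Set E)) {Φ : X → E} (hΦ : Integrable Φ ν)
    (h : ∀ x, Φ x ∈ S) : ∫ x, Φ x ∂ν ∈ S := by
  rcases eq_or_ne ν 0 with rfl | hν
  · simp
  · have : NeZero ν := ⟨hν⟩
    have h1 := Convex.average_mem S.convex hS (ae_of_all ν h) hΦ
    rw [← measure_smul_average]
    exact S.smul_mem _ h1

/-- The polynomials in the coordinates, as continuous functions on `M`. -/
def polyAlgebra (M : Set (Fin d → ℂ)) : Subalgebra ℂ C(M, ℂ) :=
  (MvPolynomial.aeval fun i : Fin d =>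
    (⟨fun z => z.1 i, (continuous_apply i).comp continuous_subtype_val⟩ : C(M, ℂ))).range

theorem polyAlgebra_apply (M : Set (Fin d → ℂ)) (P : MvPolynomial (Fin d) ℂ) (z : M) :
    (MvPolynomial.aeval fun i : Fin d =>
      (⟨fun z => z.1 i, (continuous_apply i).comp continuous_subtype_val⟩ : C(M, ℂ))) P z
      = MvPolynomial.eval z.1 P := by
  have h := MvPolynomial.comp_aeval_apply (fun i : Fin d =>
      (⟨fun z => z.1 i, (continuous_apply i).comp continuous_subtype_val⟩ : C(M, ℂ)))
    (ContinuousMap.evalAlgHom ℂ ℂ z) P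
  exact h

/-- The Cauchy kernel in one variable is a uniform limit of polynomials, for poles off a full
compact set. -/
theorem kernel_mem_closure {M : Set (Fin d → ℂ)} [CompactSpace M] {i : Fin d} {Mi : Set ℂ}
    (hMi : IsCompact Mi) (hf : IsFull Mi) (hM : ∀ z ∈ M, z i ∈ Mi) {w : ℂ} (hw : w ∉ Mi)
    {k : C(M, ℂ)} (hk : ∀ z : M, k z = (w - z.1 i)⁻¹) :
    k ∈ (polyAlgebra M).topologicalClosure := by
  change k ∈ closure (polyAlgebra M : Set C(M, ℂ))
  obtain ⟨r, hr, hrM⟩ := Metric.isOpen_iff.1 hMi.isClosed.isOpen_compl w hw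
  rw [Metric.mem_closure_iff]
  intro ε hε
  obtain ⟨p, hp⟩ := hf.exists_polynomial hMi hw (η := ε * r) (by positivity)
  let c : C(M, ℂ) := ⟨fun z => z.1 i, (continuous_apply i).comp continuous_subtype_val⟩
  refine ⟨Polynomial.aeval c p, ⟨Polynomial.aeval (MvPolynomial.X i) p, ?_⟩, ?_⟩
  · change MvPolynomial.aeval _ _ = _
    rw [← Polynomial.aeval_algHom_apply, MvPolynomial.aeval_X]
  · rw [ContinuousMap.dist_lt_iff hε]
    intro z
    have hz := hM z.1 z.2
    have hzw : r ≤ ‖w - z.1 i‖ := by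
      by_contra! h
      exact hrM (by rwa [Metric.mem_ball, dist_eq_norm, norm_sub_rev]) hz
    have hpos : 0 < ‖w - z.1 i‖ := hr.trans_le hzw
    have hne : w - z.1 i ≠ 0 := norm_pos_iff.1 hpos
    rw [hk, Polynomial.aeval_continuousMap_apply, dist_eq_norm]
    change ‖(w - z.1 i)⁻¹ - p.eval (z.1 i)‖ < ε
    have h1 : (w - z.1 i)⁻¹ - p.eval (z.1 i)
        = (1 - (w - z.1 i) * p.eval (z.1 i)) / (w - z.1 i) := by
      field_simp
    rw [h1, norm_div, div_lt_iff₀ hpos]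
    exact (hp _ hz).trans_le (by gcongr)

/-- Runge's theorem on a product of full compact sets.  The product Cauchy–Pompeiu formula writes the
function as an integral of kernels, each in the closed algebra generated by the coordinates. -/
theorem exists_poly_of_separatelyHolomorphic {M U : Fin d → Set ℂ} (hM : ∀ i, IsCompact (M i))
    (hf : ∀ i, IsFull (M i)) (hU : ∀ i, IsOpen (U i)) (hMU : ∀ i, M i ⊆ U i)
    {f : (Fin d → ℂ) → ℂ} (h : IsSeparatelyHolomorphicOn f (univ.pi U)) {ε : ℝ} (hε : 0 < ε) :
    ∃ P : MvPolynomial (Fin d) ℂ, ∀ z ∈ univ.pi M, ‖f z - MvPolynomial.eval z P‖ < ε := by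
  choose φ hφ using fun i => exists_isCauchyKernel (hM i) (hU i) (hMU i)
  set N : Set (Fin d → ℂ) := univ.pi M with hN
  have hNc : IsCompact N := isCompact_univ_pi hM
  have : CompactSpace N := isCompact_iff_compactSpace.1 hNc
  set T : Set (Fin d → ℂ) := univ.pi fun i => tsupport (φ i) with hTdef
  have hT : IsCompact T := isCompact_pi_tsupport hφ
  have : CompactSpace T := isCompact_iff_compactSpace.1 hT
  have hTU : T ⊆ univ.pi U := pi_mono fun i _ => (hφ i).tsupport_subset.trans sdiff_subset
  let ν : Measure T := Measure.comap Subtype.val volume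
  have : IsFiniteMeasure ν := ⟨by
    rw [Measure.comap_apply _ Subtype.val_injective
      (fun s hs => hT.measurableSet.subtype_image hs) _ MeasurableSet.univ]
    simpa using hT.measure_lt_top⟩
  have hne : ∀ (t : T) (z : N) (i : Fin d), t.1 i - z.1 i ≠ 0 := fun t z i =>
    sub_ne_zero.2 fun he => ((hφ i).tsupport_subset (t.2 i trivial)).2 (he ▸ z.2 i trivial)
  have hcont : Continuous fun x : T × N => prodKernel φ x.2.1 x.1.1 * f x.1.1 := by
    refine Continuous.mul (continuous_finsetProd _ fun i _ => Continuous.div ?_ ?_ ?_) ?_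
    · exact (hφ i).continuous.comp
        ((continuous_apply i).comp (continuous_subtype_val.comp continuous_fst))
    · exact ((continuous_apply i).comp (continuous_subtype_val.comp continuous_fst)).sub
        ((continuous_apply i).comp (continuous_subtype_val.comp continuous_snd))
    · exact fun x => hne x.1 x.2 i
    · exact (continuousOn_iff_continuous_domRestrict.1 (h.1.mono hTU)).comp continuous_fst
  let Φ : C(T, C(N, ℂ)) := ContinuousMap.curry ⟨_, hcont⟩
  have hΦint : Integrable Φ ν :=
    Φ.continuous.integrable_of_hasCompactSupport (HasCompactSupport.of_compactSpace _)
  have hΦmem : ∀ t, Φ t ∈ (polyAlgebra N).topologicalClosure := by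
    intro t
    let k : Fin d → C(N, ℂ) := fun i => ⟨fun z => (t.1 i - z.1 i)⁻¹, Continuous.inv₀
      (continuous_const.sub ((continuous_apply i).comp continuous_subtype_val))
      fun z => hne t z i⟩
    have h1 : Φ t = ((∏ i, φ i (t.1 i)) * f t.1) • ∏ i, k i := by
      ext z
      rw [ContinuousMap.smul_apply, ContinuousMap.prod_apply, smul_eq_mul]
      change prodKernel φ z.1 t.1 * f t.1 = _ * ∏ i, (t.1 i - z.1 i)⁻¹
      simp only [prodKernel, div_eq_mul_inv, Finset.prod_mul_distrib]
      ring
    rw [h1]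
    refine Subalgebra.smul_mem _ (Subalgebra.prod_mem _ fun i _ => ?_) _
    exact kernel_mem_closure (hM i) (hf i) (fun z (hz : z ∈ univ.pi M) => hz i trivial)
      ((hφ i).tsupport_subset (t.2 i trivial)).2 fun z => rfl
  have hmem := integral_mem_submodule (ν := ν)
    (S := (Subalgebra.toSubmodule (polyAlgebra N).topologicalClosure).restrictScalars ℝ)
    (polyAlgebra N).isClosed_topologicalClosure hΦint hΦmem
  have hval : ∀ z : N, (∫ t, Φ t ∂ν) z = f z.1 := by
    intro z
    have h1 := (ContinuousMap.evalCLM ℝ z : C(N, ℂ) →L[ℝ] ℂ).integral_comp_comm hΦint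
    change _ = (∫ t, Φ t ∂ν) z at h1
    rw [← h1, ← integral_prodKernel_mul hφ hMU h z.2]
    change ∫ t : T, (fun w => prodKernel φ z.1 w * f w) t.1 ∂ν = _
    rw [integral_subtype_comap (μ := volume) hT.measurableSet (fun w => prodKernel φ z.1 w * f w)]
    exact setIntegral_eq_integral_of_forall_compl_eq_zero
      fun w hw => by rw [prodKernel_eq_zero z.1 hw, zero_mul]
  change _ ∈ closure (polyAlgebra N : Set C(N, ℂ)) at hmem
  obtain ⟨_, ⟨P, rfl⟩, hP⟩ := Metric.mem_closure_iff.1 hmem ε hε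
  refine ⟨P, fun z hz => ?_⟩
  have h1 := (ContinuousMap.dist_lt_iff hε).1 hP ⟨z, hz⟩
  rw [hval, dist_eq_norm] at h1
  erw [polyAlgebra_apply] at h1
  exact h1

/-- A neighbourhood of a product of compact sets contains a product of open
neighbourhoods. -/
theorem exists_pi_open_subset {K : Fin d → Set ℂ} (hK : ∀ i, IsCompact (K i))
    {O : Set (Fin d → ℂ)} (hO : IsOpen O) (hKO : univ.pi K ⊆ O) :
    ∃ U : Fin d → Set ℂ, (∀ i, IsOpen (U i)) ∧ (∀ i, K i ⊆ U i) ∧ univ.pi U ⊆ O := by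
  obtain ⟨δ, hδ, h⟩ := (isCompact_univ_pi hK).exists_thickening_subset_open hO hKO
  refine ⟨fun i => Metric.thickening δ (K i), fun i => Metric.isOpen_thickening,
    fun i => Metric.self_subset_thickening hδ _, Subset.trans (fun z hz => ?_) h⟩
  choose x hx hxz using fun i => Metric.mem_thickening_iff.1 (hz i trivial)
  exact Metric.mem_thickening_iff.2 ⟨x, fun i _ => hx i, (dist_pi_lt_iff hδ).2 hxz⟩

theorem exists_poly_of_analyticOnNhd {M : Fin d → Set ℂ} (hM : ∀ i, IsCompact (M i))
    (hf : ∀ i, IsFull (M i)) {f : (Fin d → ℂ) → ℂ} (h : AnalyticOnNhd ℂ f (univ.pi M)) {ε : ℝ}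
    (hε : 0 < ε) :
    ∃ P : MvPolynomial (Fin d) ℂ, ∀ z ∈ univ.pi M, ‖f z - MvPolynomial.eval z P‖ < ε := by
  obtain ⟨U, hU, hMU, hUf⟩ := exists_pi_open_subset hM (isOpen_analyticAt ℂ f) h
  exact exists_poly_of_separatelyHolomorphic hM hf hU hMU
    (isSeparatelyHolomorphicOn_of_analyticOnNhd fun z hz => hUf hz) hε

theorem isFull_closedBall {R : ℝ} (hR : 0 < R) : IsFull (Metric.closedBall (0 : ℂ) R) := by
  intro w hw
  exact norm_gt_subset_outer hR (fun z hz => by simpa using hz)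
    (by simpa [dist_zero_right] using hw)

/-- Uniform convergence on a neighbourhood of a compact set gives uniform convergence of all
mixed derivatives on the compact set. -/
theorem tendstoUniformlyOn_mixedDeriv {ι : Type*} {p : Filter ι} [p.NeBot]
    {F : ι → (Fin d → ℂ) → ℂ} {f : (Fin d → ℂ) → ℂ} {K N : Set (Fin d → ℂ)} (hK : IsCompact K)
    (hKN : K ⊆ interior N) (hF : ∀ n, AnalyticOnNhd ℂ (F n) (interior N))
    (h : TendstoUniformlyOn F f p N) (α : Fin d → ℕ) :
    TendstoUniformlyOn (fun n => mixedDeriv α (F n)) (mixedDeriv α f) p K := by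
  have h1 := tendstoLocallyUniformlyOn_mixedDeriv isOpen_interior hF
    (h.mono interior_subset).tendstoLocallyUniformlyOn α
  exact (tendstoLocallyUniformlyOn_iff_tendstoUniformlyOn_of_compact hK).1 (h1.mono hKN)

/-- Simultaneous approximation.  If in one coordinate `i` the sets `K i` and `L i` are disjoint and
full, a function holomorphic near `∏ K j` and a polynomial can be approximated on `∏ K j` and on `L`
by the same polynomials: a polynomial in the `i`-th variable, close to `1` near `K i`
and to `0` near `L i`, interpolates between the two. -/
theorem exists_seq_poly_simultaneous {K : Fin d → Set ℂ} (hK : ∀ j, IsCompact (K j))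
    (hKf : ∀ j, IsFull (K j)) {h : (Fin d → ℂ) → ℂ} (hh : AnalyticOnNhd ℂ h (univ.pi K))
    (g : MvPolynomial (Fin d) ℂ) {L : Set (Fin d → ℂ)} (hL : IsCompact L) (i : Fin d) {Li : Set ℂ}
    (hLi : IsCompact Li) (hLif : IsFull Li) (hLLi : ∀ z ∈ L, z i ∈ Li)
    (hdis : Disjoint (K i) Li) :
    ∃ P : ℕ → MvPolynomial (Fin d) ℂ, ∀ α : Fin d → ℕ,
      TendstoUniformlyOn (fun n => mixedDeriv α fun z => MvPolynomial.eval z (P n))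
        (mixedDeriv α h) atTop (univ.pi K) ∧
      TendstoUniformlyOn (fun n => mixedDeriv α fun z => MvPolynomial.eval z (P n))
        (mixedDeriv α fun z => MvPolynomial.eval z g) atTop L := by
  classical
  obtain ⟨O, hO, hKO, hOh⟩ := exists_pi_open_subset hK (isOpen_analyticAt ℂ h) hh
  obtain ⟨V, V', hV, hV', hKV, hLV', hVV'⟩ :=
    SeparatedNhds.of_isCompact_isCompact (hK i) hLi hdis
  choose M hMc hMf hKM hMO using fun j => (hKf j).exists_nhd (hK j)
    (U := if j = i then O j ∩ V else O j) (by split_ifs; exacts [(hO j).inter hV, hO j])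
    (by
      split_ifs with hj
      · subst hj
        exact subset_inter (hKO j) hKV
      · exact hKO j)
  have hMO' : ∀ j, M j ⊆ O j := fun j => (hMO j).trans (by
    split_ifs
    exacts [inter_subset_left, Subset.rfl])
  have hMV : M i ⊆ V := (hMO i).trans (by simp)
  obtain ⟨M', hM'c, hM'f, hLM', hM'V⟩ := hLif.exists_nhd hLi hV' hLV'
  obtain ⟨R₀, hR₀⟩ := ((isCompact_univ_pi hMc).union hL).isBounded.exists_norm_le
  set R := max R₀ 0 + 1 with hR
  have hRpos : 0 < R := by positivity
  have hRlt : ∀ z ∈ univ.pi M ∪ L, ∀ j, ‖z j‖ < R := fun z hz j =>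
    ((norm_le_pi_norm z j).trans (hR₀ z hz)).trans_lt (by
      rw [hR]
      linarith [le_max_left R₀ 0])
  -- The sets on which uniform approximation takes place.
  set N := univ.pi M with hN
  set N' : Set (Fin d → ℂ) :=
    univ.pi fun j => if j = i then M' ∩ Metric.closedBall 0 R else Metric.closedBall 0 R with hN'
  have hNc : IsCompact N := isCompact_univ_pi hMc
  have hN'c : IsCompact N' := isCompact_univ_pi fun j => by
    split_ifs
    exacts [hM'c.inter_right Metric.isClosed_closedBall, isCompact_closedBall _ _]
  have hKN : univ.pi K ⊆ interior N := by
    rw [hN, interior_pi_set finite_univ]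
    exact pi_mono fun j _ => hKM j
  have hLN' : L ⊆ interior N' := by
    rw [hN', interior_pi_set finite_univ]
    intro z hz j _
    have h1 : z j ∈ interior (Metric.closedBall (0 : ℂ) R) :=
      Metric.ball_subset_interior_closedBall (by simpa using hRlt z (Or.inr hz) j)
    dsimp only
    split_ifs with hj
    · subst hj
      rw [interior_inter]
      exact ⟨hLM' (hLLi z hz), h1⟩
    · exact h1
  -- The interpolating polynomial in the coordinate `i`.
  let Q : Fin d → Set ℂ := fun j => if j = i then M i ∪ M' else Metric.closedBall 0 R
  have hQc : ∀ j, IsCompact (Q j) := fun j => by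
    simp only [Q]
    split_ifs
    exacts [(hMc i).union hM'c, isCompact_closedBall _ _]
  have hQf : ∀ j, IsFull (Q j) := fun j => by
    simp only [Q]
    split_ifs
    exacts [(hMf i).union hM'f (hMc i) hM'c (hVV'.mono hMV hM'V), isFull_closedBall hRpos]
  let χ : (Fin d → ℂ) → ℂ := fun z => if z i ∈ V then 1 else 0
  have hχ : AnalyticOnNhd ℂ χ (univ.pi Q) := by
    intro z hz
    have h1 : z i ∈ M i ∪ M' := by simpa [Q] using hz i trivial
    have hci : Continuous fun z : Fin d → ℂ => z i := continuous_apply i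
    rcases h1 with h1 | h1
    · refine (analyticAt_const (v := (1 : ℂ))).congr ?_
      filter_upwards [(hV.preimage hci).mem_nhds (hMV h1)] with x hx
      exact (if_pos hx).symm
    · refine (analyticAt_const (v := (0 : ℂ))).congr ?_
      filter_upwards [(hV'.preimage hci).mem_nhds (hM'V h1)] with x hx
      exact (if_neg fun hxV => Set.disjoint_left.1 hVV' hxV hx).symm
  have hNQ : N ⊆ univ.pi Q := by
    intro z hz j _
    simp only [Q]
    split_ifs with hj
    · subst hj
      exact Or.inl (hz j trivial)
    · simpa using (hRlt z (Or.inl hz) j).le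
  have hN'Q : N' ⊆ univ.pi Q := by
    intro z hz j _
    have h1 := hz j trivial
    simp only [Q]
    split_ifs with hj
    · simp only [if_pos hj] at h1
      exact Or.inr h1.1
    · simpa only [if_neg hj] using h1
  have hχN : ∀ z ∈ N, χ z = 1 := fun z hz => if_pos (hMV (hz i trivial))
  have hχN' : ∀ z ∈ N', χ z = 0 := fun z hz => if_neg fun hzV =>
    Set.disjoint_left.1 hVV' hzV (hM'V (by
      have h1 := hz i trivial
      simp only [if_true] at h1
      exact h1.1))
  have main : ∀ n : ℕ, ∃ P : MvPolynomial (Fin d) ℂ,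
      (∀ z ∈ N, ‖h z - MvPolynomial.eval z P‖ ≤ 2 / ((n : ℝ) + 1)) ∧
      ∀ z ∈ N', ‖MvPolynomial.eval z g - MvPolynomial.eval z P‖ ≤ 2 / ((n : ℝ) + 1) := by
    intro n
    have hn : 0 < 1 / ((n : ℝ) + 1) := Nat.one_div_pos_of_nat
    obtain ⟨P, hP⟩ := exists_poly_of_analyticOnNhd hMc hMf
      (f := h) (fun z hz => hOh fun j _ => hMO' j (hz j trivial)) hn
    obtain ⟨C, hC⟩ := ((hNc.union hN'c).image_of_continuousOn
      (f := fun z => MvPolynomial.eval z (P - g))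
      (MvPolynomial.continuous_eval _).continuousOn).isBounded.exists_norm_le
    set C' := max C 0 + 1 with hC'
    have hC'pos : 0 < C' := by positivity
    have hCle : ∀ z ∈ N ∪ N', ‖MvPolynomial.eval z (P - g)‖ ≤ C' := fun z hz =>
      (hC _ ⟨z, hz, rfl⟩).trans (by rw [hC']; linarith [le_max_left C 0])
    obtain ⟨q, hq⟩ := exists_poly_of_analyticOnNhd hQc hQf hχ (ε := 1 / ((n : ℝ) + 1) / C')
      (by positivity)
    have hbound : ∀ z ∈ N ∪ N',
        ‖(χ z - MvPolynomial.eval z q) * MvPolynomial.eval z (P - g)‖ ≤ 1 / ((n : ℝ) + 1) := by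
      intro z hz
      rw [norm_mul]
      calc _ ≤ 1 / ((n : ℝ) + 1) / C' * C' :=
            mul_le_mul (hq z (hz.elim (fun h => hNQ h) fun h => hN'Q h)).le (hCle z hz)
              (norm_nonneg _) (by positivity)
        _ = 1 / ((n : ℝ) + 1) := div_mul_cancel₀ _ hC'pos.ne'
    have htwo : 1 / ((n : ℝ) + 1) + 1 / ((n : ℝ) + 1) = 2 / ((n : ℝ) + 1) := by ring
    refine ⟨g + q * (P - g), fun z hz => ?_, fun z hz => ?_⟩
    · have h1 := hbound z (Or.inl hz)
      rw [hχN z hz] at h1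
      have h2 : h z - MvPolynomial.eval z (g + q * (P - g)) = (h z - MvPolynomial.eval z P)
          + (1 - MvPolynomial.eval z q) * MvPolynomial.eval z (P - g) := by
        simp only [map_add, map_mul, map_sub]
        ring
      rw [h2, ← htwo]
      exact (norm_add_le _ _).trans (add_le_add (hP z hz).le h1)
    · have h1 := hbound z (Or.inr hz)
      rw [hχN' z hz] at h1
      have h2 : MvPolynomial.eval z g - MvPolynomial.eval z (g + q * (P - g))
          = (0 - MvPolynomial.eval z q) * MvPolynomial.eval z (P - g) := by
        simp only [map_add, map_mul, map_sub]
        ring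
      rw [h2, ← htwo]
      linarith
  choose P hP hP' using main
  have hlim : Tendsto (fun n : ℕ => 2 / ((n : ℝ) + 1)) atTop (𝓝 0) := by
    have := (tendsto_one_div_add_atTop_nhds_zero_nat (𝕜 := ℝ)).const_mul 2
    simpa [mul_div_assoc, div_eq_mul_inv] using this
  have hunif : ∀ (S : Set (Fin d → ℂ)) (u : (Fin d → ℂ) → ℂ),
      (∀ n, ∀ z ∈ S, ‖u z - MvPolynomial.eval z (P n)‖ ≤ 2 / ((n : ℝ) + 1)) →
      TendstoUniformlyOn (fun n z => MvPolynomial.eval z (P n)) u atTop S := by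
    intro S u hu
    rw [Metric.tendstoUniformlyOn_iff]
    intro ε hε
    filter_upwards [hlim.eventually (gt_mem_nhds hε)] with n hn z hz
    rw [dist_eq_norm]
    exact (hu n z hz).trans_lt hn
  have han : ∀ (S : Set (Fin d → ℂ)) (n : ℕ),
      AnalyticOnNhd ℂ (fun z => MvPolynomial.eval z (P n)) S := fun S n z _ =>
    AnalyticOnNhd.eval_mvPolynomial (P n) z trivial
  exact ⟨P, fun α => ⟨tendstoUniformlyOn_mixedDeriv (isCompact_univ_pi hK) hKN (han _)
    (hunif N h hP) α, tendstoUniformlyOn_mixedDeriv hL hLN' (han _) (hunif N' _ hP') α⟩⟩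

end Integrals

variable {d : ℕ}

/-! ### Mixed derivatives of polynomials and Taylor's formula -/

/-- The monomial function `z ↦ z₁^{s₁} ⋯ z_d^{s_d}`. -/
def monoFn (s : Fin d → ℕ) (z : Fin d → ℂ) : ℂ := ∏ i, z i ^ s i

theorem analyticOnNhd_monoFn (s : Fin d → ℕ) : AnalyticOnNhd ℂ (monoFn s) univ := by
  intro z _
  exact Finset.analyticAt_fun_prod _ fun i _ =>
    ((ContinuousLinearMap.proj (R := ℂ) (φ := fun _ : Fin d => ℂ) i).analyticAt z).pow _

theorem partialDeriv_const_mul_monoFn (c : ℂ) (s : Fin d → ℕ) (i : Fin d) :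
    partialDeriv i (fun z => c * monoFn s z)
      = fun z => (c * s i) * monoFn (Function.update s i (s i - 1)) z := by
  funext z
  have hd : DifferentiableAt ℂ (fun z => c * monoFn s z) z :=
    (analyticAt_const.mul (analyticOnNhd_monoFn s z trivial)).differentiableAt
  rw [partialDeriv_eq_deriv hd]
  have h1 : (fun w => c * monoFn s (Function.update z i w))
      = fun w => (c * ∏ j ∈ Finset.univ.erase i, z j ^ s j) * w ^ s i := by
    funext w
    rw [monoFn, ← Finset.mul_prod_erase _ _ (Finset.mem_univ i), Function.update_self,
      Finset.prod_congr rfl fun j hj => by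
        rw [Function.update_of_ne (Finset.ne_of_mem_erase hj)]]
    ring
  rw [h1, deriv_const_mul _ (by fun_prop), deriv_pow_field, monoFn,
    ← Finset.mul_prod_erase _ _ (Finset.mem_univ i), Function.update_self]
  have h2 : ∏ j ∈ Finset.univ.erase i, z j ^ Function.update s i (s i - 1) j
      = ∏ j ∈ Finset.univ.erase i, z j ^ s j := Finset.prod_congr rfl fun j hj => by
    rw [Function.update_of_ne (Finset.ne_of_mem_erase hj)]
  rw [h2]
  ring

theorem iterate_partialDeriv_const_mul_monoFn (c : ℂ) (s : Fin d → ℕ) (i : Fin d) (k : ℕ) :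
    (partialDeriv i)^[k] (fun z => c * monoFn s z)
      = fun z => (c * (s i).descFactorial k) * monoFn (Function.update s i (s i - k)) z := by
  induction k with
  | zero => simp
  | succ k ih =>
    rw [Function.iterate_succ_apply', ih, partialDeriv_const_mul_monoFn, Function.update_self,
      Function.update_idem, Nat.descFactorial_succ, Nat.sub_sub]
    push_cast
    funext z
    ring

theorem foldr_partialDeriv_const_mul_monoFn (α : Fin d → ℕ) (c : ℂ) (s : Fin d → ℕ)
    {l : List (Fin d)} (hl : l.Nodup) :
    l.foldr (fun i G => (partialDeriv i)^[α i] G) (fun z => c * monoFn s z)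
      = fun z => (c * (l.map fun i => ((s i).descFactorial (α i) : ℂ)).prod) *
        monoFn (fun j => if j ∈ l then s j - α j else s j) z := by
  induction l with
  | nil => simp
  | cons i l ih =>
    obtain ⟨hi, hl'⟩ := List.nodup_cons.1 hl
    rw [List.foldr_cons, ih hl', iterate_partialDeriv_const_mul_monoFn]
    have h1 : Function.update (fun j => if j ∈ l then s j - α j else s j) i
        ((if i ∈ l then s i - α i else s i) - α i)
        = fun j => if j ∈ i :: l then s j - α j else s j := by
      funext j
      by_cases hj : j = i
      · subst hj
        simp [hi]
      · simp [hj]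
    funext z
    rw [h1]
    simp only [if_neg hi, List.map_cons, List.prod_cons]
    ring

theorem mixedDeriv_monoFn (α s : Fin d → ℕ) :
    mixedDeriv α (monoFn s)
      = fun z => (∏ i, ((s i).descFactorial (α i) : ℂ)) * monoFn (s - α) z := by
  have h := foldr_partialDeriv_const_mul_monoFn α 1 s (List.nodup_finRange d)
  simp only [one_mul, List.mem_finRange, if_true] at h
  rw [mixedDeriv, show monoFn s = fun z => monoFn s z from rfl, h, ← List.ofFn_eq_map,
    List.prod_ofFn]
  rfl

theorem prod_descFactorial_eq_zero {α s : Fin d → ℕ} {i : Fin d} (hi : s i < α i) :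
    ∏ i, ((s i).descFactorial (α i) : ℂ) = 0 :=
  Finset.prod_eq_zero (Finset.mem_univ i) (by
    rw [Nat.descFactorial_of_lt hi, Nat.cast_zero])

theorem mixedDeriv_monoFn_zero (α s : Fin d → ℕ) :
    mixedDeriv α (monoFn s) 0 = if α = s then ∏ i, ((α i).factorial : ℂ) else 0 := by
  rw [mixedDeriv_monoFn]
  split_ifs with h
  · subst h
    simp [monoFn, Nat.descFactorial_self]
  · obtain ⟨i, hi⟩ := Function.ne_iff.1 h
    rcases lt_or_gt_of_ne hi with hi | hi
    · have : monoFn (s - α) 0 = 0 :=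
        Finset.prod_eq_zero (Finset.mem_univ i) (zero_pow (Nat.sub_ne_zero_of_lt hi))
      simp only [this, mul_zero]
    · simp only [prod_descFactorial_eq_zero hi, zero_mul]

theorem mixedDeriv_const_zero (α : Fin d → ℕ) : mixedDeriv α (fun _ : Fin d → ℂ => (0 : ℂ)) = 0 :=
    by
  refine foldr_induction α (fun F _ _ => F = 0) ?_ (G := fun _ => 0) (H := fun _ => 0) rfl
  rintro i F _ _ rfl
  funext z
  simp [partialDeriv]

theorem mixedDeriv_finset_sum {ι : Type*} (t : Finset ι) (α : Fin d → ℕ) (c : ι → ℂ)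
    {G : ι → (Fin d → ℂ) → ℂ} (hG : ∀ j ∈ t, AnalyticOnNhd ℂ (G j) univ) (z : Fin d → ℂ) :
    mixedDeriv α (fun z => ∑ j ∈ t, c j * G j z) z = ∑ j ∈ t, c j * mixedDeriv α (G j) z := by
  classical
  induction t using Finset.induction_on with
  | empty => simp [mixedDeriv_const_zero]
  | insert a t ha ih =>
    have hsum : AnalyticOnNhd ℂ (fun z => ∑ j ∈ t, c j * G j z) univ := fun z _ =>
      Finset.analyticAt_fun_sum _ fun j hj =>
        analyticAt_const.mul (hG j (Finset.mem_insert_of_mem hj) z trivial)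
    rw [Finset.sum_insert ha, ← ih fun j hj => hG j (Finset.mem_insert_of_mem hj)]
    refine mixedDeriv_lin isOpen_univ α (c a) (hG a (Finset.mem_insert_self a t)) hsum ?_
      (mem_univ z)
    intro z _
    exact Finset.sum_insert ha

theorem mixedDeriv_comp_sub (α : Fin d → ℕ) (F : (Fin d → ℂ) → ℂ) (ζ z : Fin d → ℂ) :
    mixedDeriv α (fun z => F (z - ζ)) z = mixedDeriv α F (z - ζ) := by
  have h := foldr_induction α (fun F G _ => F = fun z => G (z - ζ)) (F := fun z => F (z - ζ))
    (G := F) (H := F) ?_ rfl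
  · exact congrFun h z
  · rintro i F G _ rfl
    funext z
    simp only [partialDeriv]
    rw [fderiv_comp_sub]

theorem eval_eq_sum_monoFn (P : MvPolynomial (Fin d) ℂ) (z : Fin d → ℂ) :
    MvPolynomial.eval z P = ∑ s ∈ P.support, P.coeff s * monoFn s z := by
  rw [MvPolynomial.eval_eq']
  rfl

theorem mixedDeriv_eval (P : MvPolynomial (Fin d) ℂ) (α : Fin d → ℕ) (z : Fin d → ℂ) :
    mixedDeriv α (fun z => MvPolynomial.eval z P) z
      = ∑ s ∈ P.support, P.coeff s * mixedDeriv α (monoFn s) z := by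
  rw [show (fun z => MvPolynomial.eval z P)
    = fun z => ∑ s ∈ P.support, P.coeff s * monoFn s z from funext (eval_eq_sum_monoFn P)]
  exact mixedDeriv_finset_sum P.support α (fun s => P.coeff s) (G := fun s => monoFn s)
    (fun s _ => analyticOnNhd_monoFn s) z

theorem mixedDeriv_eval_zero (P : MvPolynomial (Fin d) ℂ) (s : Fin d →₀ ℕ) :
    mixedDeriv s (fun z => MvPolynomial.eval z P) 0
      = (∏ i, ((s i).factorial : ℂ)) * P.coeff s := by
  rw [mixedDeriv_eval]
  simp only [mixedDeriv_monoFn_zero, DFunLike.coe_fn_eq, mul_ite, mul_zero]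
  rw [Finset.sum_ite_eq]
  split_ifs with h
  · ring
  · rw [MvPolynomial.notMem_support_iff.1 h, mul_zero]

/-- Only finitely many mixed derivatives of a polynomial are nonzero. -/
theorem exists_finset_mixedDeriv_eval_eq_zero (P : MvPolynomial (Fin d) ℂ) :
    ∃ A : Finset (Fin d →₀ ℕ), ∀ s ∉ A, ∀ z,
      mixedDeriv s (fun z => MvPolynomial.eval z P) z = 0 := by
  refine ⟨P.support.biUnion fun s => Finset.Iic s, fun s hs z => ?_⟩
  rw [mixedDeriv_eval]
  refine Finset.sum_eq_zero fun t ht => ?_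
  have hst : ¬ s ≤ t := fun h => hs (Finset.mem_biUnion.2 ⟨t, ht, Finset.mem_Iic.2 h⟩)
  rw [Finsupp.le_def, not_forall] at hst
  obtain ⟨i, hi⟩ := hst
  rw [mixedDeriv_monoFn]
  simp only [prod_descFactorial_eq_zero (not_le.1 hi), zero_mul, mul_zero]

/-- Taylor's formula for a polynomial, with a length that does not depend on the centre. -/
theorem exists_taylor_eval (N : ℕ ≃ (Fin d → ℕ)) (P : MvPolynomial (Fin d) ℂ) :
    ∃ m₀ : ℕ, ∀ m ≥ m₀, ∀ ζ z : Fin d → ℂ,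
      ∑ j ∈ Finset.range (m + 1), mixedDeriv (N j) (fun z => MvPolynomial.eval z P) ζ /
        (∏ i, ((N j i).factorial : ℂ)) * monoFn (N j) (z - ζ) = MvPolynomial.eval z P := by
  obtain ⟨A, hA⟩ := exists_finset_mixedDeriv_eval_eq_zero P
  let e : (Fin d →₀ ℕ) → ℕ := fun s => N.symm s
  refine ⟨A.sup e, fun m hm ζ z => ?_⟩
  -- Expand the translate of `P` in monomials.
  let Q : MvPolynomial (Fin d) ℂ :=
    MvPolynomial.bind₁ (fun i => MvPolynomial.X i + MvPolynomial.C (ζ i)) P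
  have hQ : ∀ x, MvPolynomial.eval x Q = MvPolynomial.eval (x + ζ) P := by
    intro x
    change MvPolynomial.eval₂Hom _ _ (MvPolynomial.bind₁ _ P) = _
    rw [MvPolynomial.eval₂Hom_bind₁]
    simp only [map_add, MvPolynomial.eval₂Hom_X', MvPolynomial.eval₂Hom_C, RingHom.id_apply]
    rfl
  have hPQ : (fun x => MvPolynomial.eval x P) = fun x => MvPolynomial.eval (x - ζ) Q := by
    funext x
    rw [hQ, sub_add_cancel]
  have hcoeff : ∀ s : Fin d →₀ ℕ, mixedDeriv s (fun z => MvPolynomial.eval z P) ζ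
      = (∏ i, ((s i).factorial : ℂ)) * Q.coeff s := by
    intro s
    rw [hPQ, mixedDeriv_comp_sub s (fun x => MvPolynomial.eval x Q), sub_self,
      mixedDeriv_eval_zero]
  have hfac : ∀ s : Fin d → ℕ, (∏ i, ((s i).factorial : ℂ)) ≠ 0 := fun s =>
    Finset.prod_ne_zero_iff.2 fun i _ => Nat.cast_ne_zero.2 (Nat.factorial_ne_zero _)
  have hsupp : Q.support ⊆ A := by
    intro s hs
    by_contra h
    have h1 := (hcoeff s).symm.trans (hA s h ζ)
    exact MvPolynomial.mem_support_iff.1 hs ((mul_eq_zero.1 h1).resolve_left (hfac s))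
  let N' : ℕ ≃ (Fin d →₀ ℕ) := N.trans Finsupp.equivFunOnFinite.symm
  have hN' : ∀ j, N j = ⇑(N' j) := fun j => rfl
  rw [congrFun hPQ z, eval_eq_sum_monoFn Q,
    Finset.sum_congr rfl (g := fun j => Q.coeff (N' j) * monoFn (N' j) (z - ζ)) fun j _ => by
      rw [hN', hcoeff, mul_div_cancel_left₀ _ (hfac _)]]
  have hmap := Finset.sum_map (Finset.range (m + 1)) N'.toEmbedding
    (fun s => Q.coeff s * monoFn s (z - ζ))
  refine hmap.symm.trans ?_
  refine (Finset.sum_subset (fun s hs => ?_) fun s _ hs => ?_).symm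
  · rw [Finset.mem_map]
    refine ⟨N'.symm s, Finset.mem_range.2 (Nat.lt_succ_of_le ?_), N'.apply_symm_apply s⟩
    exact (Finset.le_sup (f := e) (hsupp hs)).trans hm
  · rw [MvPolynomial.notMem_support_iff.1 hs, zero_mul]

/-! ### The space `A^∞(Ω, S)` -/

section Spaces

variable {Ω : Fin d → TopologicalSpace.Opens ℂ} {S : Fin d → Set ℂ}

theorem prodWithBdry_subset_closure (hS : ∀ i, S i ⊆ frontier (Ω i : Set ℂ)) :
    prodWithBdry Ω S ⊆ closure (prodDomain Ω) := by
  rw [prodDomain, closure_pi_set]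
  exact pi_mono fun i _ => union_subset subset_closure ((hS i).trans frontier_subset_closure)

/-- `Ωᵢ ∪ Sᵢ` is the intersection of the closure of `Ωᵢ` with an open set. -/
theorem locallyCompactSpace_prodWithBdry
    (hSopen : ∀ i, ∃ U : Set ℂ, IsOpen U ∧ S i = U ∩ frontier (Ω i : Set ℂ)) :
    LocallyCompactSpace (prodWithBdry Ω S) := by
  choose U hU hSU using hSopen
  have h : prodWithBdry Ω S
      = (univ.pi fun i => (Ω i : Set ℂ) ∪ U i) ∩ univ.pi fun i => closure (Ω i : Set ℂ) := by
    rw [← pi_inter_distrib]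
    refine pi_congr rfl fun i _ => ?_
    rw [hSU i, frontier, (Ω i).isOpen.interior_eq]
    ext z
    simp only [mem_union, mem_inter_iff, Set.mem_sdiff]
    constructor
    · rintro (h | ⟨h1, h2, h3⟩)
      · exact ⟨Or.inl h, subset_closure h⟩
      · exact ⟨Or.inr h1, h2⟩
    · rintro ⟨h1, h2⟩
      by_cases h : z ∈ (Ω i : Set ℂ)
      · exact Or.inl h
      · exact Or.inr ⟨h1.resolve_left h, h2, h⟩
  refine IsLocallyClosed.locallyCompactSpace ⟨_, _,
    isOpen_set_pi finite_univ fun i _ => (Ω i).isOpen.union (hU i),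
    isClosed_set_pi fun i _ => isClosed_closure, h⟩

theorem eqOn_extDeriv_of_continuousOn (hS : ∀ i, S i ⊆ frontier (Ω i : Set ℂ)) (f : AInfty Ω S)
    {α : Fin d → ℕ} {g : (Fin d → ℂ) → ℂ} (hg : ContinuousOn g (prodWithBdry Ω S))
    (hgf : EqOn g (mixedDeriv α (zeroExt f.toFun)) (prodDomain Ω)) :
    EqOn (f.extDeriv α) g (prodWithBdry Ω S) := fun z hz =>
  extendFrom_eq (prodWithBdry_subset_closure hS hz)
    (((hg z hz).mono (prodDomain_subset Ω S)).tendsto.congr'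
      (hgf.eventuallyEq_of_mem self_mem_nhdsWithin))

theorem continuousOn_extDeriv (hS : ∀ i, S i ⊆ frontier (Ω i : Set ℂ)) (f : AInfty Ω S)
    (α : Fin d → ℕ) : ContinuousOn (f.extDeriv α) (prodWithBdry Ω S) := by
  obtain ⟨g, hg, hgf⟩ := f.2.2 α
  exact hg.congr (eqOn_extDeriv_of_continuousOn hS f hg hgf)

theorem eqOn_extDeriv_mixedDeriv (hS : ∀ i, S i ⊆ frontier (Ω i : Set ℂ)) (f : AInfty Ω S)
    (α : Fin d → ℕ) :
    EqOn (f.extDeriv α) (mixedDeriv α (zeroExt f.toFun)) (prodDomain Ω) := by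
  obtain ⟨g, hg, hgf⟩ := f.2.2 α
  exact ((eqOn_extDeriv_of_continuousOn hS f hg hgf).mono (prodDomain_subset Ω S)).trans hgf

theorem mixedDeriv_eval_analyticOnNhd (α : Fin d → ℕ) (P : MvPolynomial (Fin d) ℂ) :
    AnalyticOnNhd ℂ (mixedDeriv α fun z => MvPolynomial.eval z P) univ :=
  mixedDeriv_analyticOnNhd α (AnalyticOnNhd.eval_mvPolynomial P)

theorem eqOn_extDeriv_ofPoly (hS : ∀ i, S i ⊆ frontier (Ω i : Set ℂ))
    (P : MvPolynomial (Fin d) ℂ) (α : Fin d → ℕ) :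
    EqOn ((AInfty.ofPoly Ω S P).extDeriv α) (mixedDeriv α fun z => MvPolynomial.eval z P)
      (prodWithBdry Ω S) :=
  eqOn_extDeriv_of_continuousOn hS _
    ((mixedDeriv_eval_analyticOnNhd α P).continuousOn.mono (subset_univ _))
    (mixedDeriv_congr (isOpen_prodDomain Ω) α fun _ hz => zeroExt_apply _ hz).symm

theorem eqOn_extDeriv_smul_add (hS : ∀ i, S i ⊆ frontier (Ω i : Set ℂ)) (c : ℂ)
    (f g : AInfty Ω S) (α : Fin d → ℕ) :
    EqOn ((c • f + g).extDeriv α) (fun z => c * f.extDeriv α z + g.extDeriv α z)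
      (prodWithBdry Ω S) := by
  refine eqOn_extDeriv_of_continuousOn hS _
    ((continuousOn_const.mul (continuousOn_extDeriv hS f α)).add (continuousOn_extDeriv hS g α)) ?_
  intro z hz
  have h : EqOn (zeroExt (c • f + g).toFun) (fun z => c * zeroExt f.toFun z + zeroExt g.toFun z)
      (prodDomain Ω) := fun z hz => by
    simp only [zeroExt_apply _ hz]
    rfl
  rw [mixedDeriv_lin (isOpen_prodDomain Ω) α c f.2.1 g.2.1 h hz]
  simp only [eqOn_extDeriv_mixedDeriv hS f α hz, eqOn_extDeriv_mixedDeriv hS g α hz]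
  rfl

/-- The extensions of all mixed derivatives, as continuous functions on `∏ (Ωᵢ ∪ Sᵢ)`. -/
def jet (hS : ∀ i, S i ⊆ frontier (Ω i : Set ℂ)) (f : AInfty Ω S) (α : Fin d → ℕ) :
    C(prodWithBdry Ω S, ℂ) :=
  ⟨(prodWithBdry Ω S).domRestrict (f.extDeriv α),
    continuousOn_iff_continuous_domRestrict.1 (continuousOn_extDeriv hS f α)⟩

theorem isUniformInducing_jet (hS : ∀ i, S i ⊆ frontier (Ω i : Set ℂ)) :
    IsUniformInducing (jet hS) := by
  rw [isUniformInducing_iff_uniformSpace]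
  change _ = UniformSpace.comap
    (fun (f : AInfty Ω S) (α : Fin d → ℕ) =>
      UniformOnFun.ofFun {L : Set (prodWithBdry Ω S) | IsCompact L}
        ((prodWithBdry Ω S).domRestrict (f.extDeriv α))) inferInstance
  simp only [Pi.uniformSpace_eq, UniformSpace.comap_iInf, ← UniformSpace.comap_comap]
  congr 1
  funext α
  rw [←
    ContinuousMap.isUniformEmbedding_toUniformOnFunIsCompact.isUniformInducing.comap_uniformSpace,
    ← UniformSpace.comap_comap]
  rfl

/-- Convergence in `A^∞(Ω, S)`. -/
theorem tendsto_aInfty_iff (hS : ∀ i, S i ⊆ frontier (Ω i : Set ℂ)) {ι : Type*} {p : Filter ι}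
    {F : ι → AInfty Ω S} {f : AInfty Ω S} :
    Tendsto F p (𝓝 f) ↔ ∀ α, ∀ L : Set (prodWithBdry Ω S), IsCompact L → ∀ ε > 0,
      ∀ᶠ n in p, ∀ z ∈ L, ‖(F n).extDeriv α z - f.extDeriv α z‖ < ε := by
  rw [(isUniformInducing_jet hS).isInducing.tendsto_nhds_iff, tendsto_pi_nhds]
  refine forall_congr' fun α => ?_
  rw [ContinuousMap.tendsto_iff_forall_isCompact_tendstoUniformlyOn]
  refine forall₂_congr fun L _ => ?_
  rw [Metric.tendstoUniformlyOn_iff]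
  refine forall₂_congr fun ε _ => eventually_congr (Eventually.of_forall fun n =>
    forall₂_congr fun z _ => ?_)
  rw [dist_comm, dist_eq_norm]
  rfl

theorem tendsto_oSpace_iff {K : Set (Fin d → ℂ)} {ι : Type*} {p : Filter ι}
    {F : ι → OSpace K} {h : OSpace K} :
    Tendsto F p (𝓝 h) ↔ ∀ α, ∀ ε > 0,
      ∀ᶠ n in p, ∀ z ∈ K, ‖mixedDeriv α (F n).toFun z - mixedDeriv α h.toFun z‖ < ε := by
  have hind : IsInducing (fun (h : OSpace K) (α : Fin d → ℕ) =>
      UniformFun.ofFun (K.domRestrict (mixedDeriv α h.toFun))) := ⟨rfl⟩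
  rw [hind.tendsto_nhds_iff, tendsto_pi_nhds]
  refine forall_congr' fun α => ?_
  rw [UniformFun.tendsto_iff_tendstoUniformly, Metric.tendstoUniformly_iff]
  refine forall₂_congr fun ε _ => eventually_congr (Eventually.of_forall fun n => ?_)
  rw [Subtype.forall]
  refine forall₂_congr fun z _ => ?_
  rw [dist_comm, dist_eq_norm]
  rfl

theorem mixedDeriv_zero_index (F : (Fin d → ℂ) → ℂ) : mixedDeriv 0 F = F := by
  unfold mixedDeriv
  generalize List.finRange d = l
  induction l with
  | nil => rfl
  | cons i l ih => exact ih

/-- The jets form a closed set: locally uniform limits of holomorphic functions are holomorphic, and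
the mixed derivatives converge. -/
theorem isClosed_range_jet (hS : ∀ i, S i ⊆ frontier (Ω i : Set ℂ)) :
    IsClosed (range (jet (Ω := Ω) hS)) := by
  refine isClosed_of_closure_subset fun g hg => ?_
  have hne : (comap (jet hS) (𝓝 g)).NeBot := by
    rw [comap_neBot_iff]
    intro t ht
    obtain ⟨_, hx, f, rfl⟩ := mem_closure_iff_nhds.1 hg t ht
    exact ⟨f, hx⟩
  have hlim : Tendsto (jet hS) (comap (jet hS) (𝓝 g)) (𝓝 g) := tendsto_comap
  rw [tendsto_pi_nhds] at hlim
  -- The functions `G α` on the whole space restrict to the limits `g α`.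
  let G : (Fin d → ℕ) → (Fin d → ℂ) → ℂ := fun α => Function.extend Subtype.val (g α) 0
  have hG : ∀ α (z : prodWithBdry Ω S), G α z = g α z := fun α z =>
    Subtype.val_injective.extend_apply _ _ z
  have hGc : ∀ α, ContinuousOn (G α) (prodWithBdry Ω S) := fun α => by
    rw [continuousOn_iff_continuous_domRestrict]
    convert (g α).continuous using 1
    funext z
    exact hG α z
  have hloc : ∀ α, TendstoLocallyUniformlyOn
      (fun f : AInfty Ω S => mixedDeriv α (zeroExt f.toFun)) (G α) (comap (jet hS) (𝓝 g))
      (prodDomain Ω) := by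
    intro α
    rw [tendstoLocallyUniformlyOn_iff_forall_isCompact (isOpen_prodDomain Ω)]
    intro K hK hKc
    have hKW : K ⊆ prodWithBdry Ω S := hK.trans (prodDomain_subset Ω S)
    have h1 := ContinuousMap.tendsto_iff_forall_isCompact_tendstoUniformlyOn.1 (hlim α)
      (Subtype.val ⁻¹' K) (IsEmbedding.subtypeVal.isInducing.isCompact_preimage' hKc
        (by rwa [Subtype.range_coe]))
    rw [Metric.tendstoUniformlyOn_iff] at h1 ⊢
    intro ε hε
    filter_upwards [h1 ε hε] with f hf z hz
    have h2 := hf ⟨z, hKW hz⟩ hz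
    rw [← hG] at h2
    rwa [← eqOn_extDeriv_mixedDeriv hS f α (hK hz)]
  have hloc0 := hloc 0
  simp only [mixedDeriv_zero_index] at hloc0
  have han : ∀ f : AInfty Ω S, AnalyticOnNhd ℂ (zeroExt f.toFun) (prodDomain Ω) := fun f => f.2.1
  have hGan := analyticOnNhd_of_tendstoLocallyUniformlyOn (isOpen_prodDomain Ω) han hloc0
  have hGα : ∀ α, EqOn (mixedDeriv α (G 0)) (G α) (prodDomain Ω) := fun α =>
    (tendstoLocallyUniformlyOn_mixedDeriv (isOpen_prodDomain Ω) han hloc0 α).unique (hloc α)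
  let f₀ : prodDomain Ω → ℂ := fun z => G 0 z
  have hf₀ : EqOn (zeroExt f₀) (G 0) (prodDomain Ω) := fun z hz => zeroExt_apply _ hz
  have hf₀α : ∀ α, EqOn (G α) (mixedDeriv α (zeroExt f₀)) (prodDomain Ω) := fun α z hz =>
    ((mixedDeriv_congr (isOpen_prodDomain Ω) α hf₀ hz).trans (hGα α hz)).symm
  have hsm : IsSmoothUpTo Ω S f₀ :=
    ⟨fun z hz => (hGan z hz).congr
      (hf₀.eventuallyEq_of_mem ((isOpen_prodDomain Ω).mem_nhds hz)).symm,
      fun α => ⟨G α, hGc α, hf₀α α⟩⟩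
  refine ⟨(⟨f₀, hsm⟩ : AInftySubmodule Ω S), ?_⟩
  funext α
  ext z
  exact (eqOn_extDeriv_of_continuousOn hS _ (hGc α) (hf₀α α) z.2).trans (hG α z)

theorem completeSpace_aInfty (hS : ∀ i, S i ⊆ frontier (Ω i : Set ℂ))
    [LocallyCompactSpace (prodWithBdry Ω S)] : CompleteSpace (AInfty Ω S) :=
  (isUniformInducing_jet hS).completeSpace (isClosed_range_jet hS).isComplete

theorem isCountablyGenerated_uniformity_aInfty (hS : ∀ i, S i ⊆ frontier (Ω i : Set ℂ))
    [LocallyCompactSpace (prodWithBdry Ω S)] :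
    IsCountablyGenerated (uniformity (AInfty Ω S)) := by
  rw [← (isUniformInducing_jet hS).comap_uniformity]
  infer_instance

theorem secondCountableTopology_aInfty (hS : ∀ i, S i ⊆ frontier (Ω i : Set ℂ))
    [LocallyCompactSpace (prodWithBdry Ω S)] : SecondCountableTopology (AInfty Ω S) :=
  (isUniformInducing_jet hS).isInducing.secondCountableTopology

theorem baireSpace_xInfty (hS : ∀ i, S i ⊆ frontier (Ω i : Set ℂ))
    [LocallyCompactSpace (prodWithBdry Ω S)] : BaireSpace (XInfty Ω S) := by
  have := completeSpace_aInfty (Ω := Ω) hS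
  have := isCountablyGenerated_uniformity_aInfty (Ω := Ω) hS
  have hc : IsClosed (XInfty Ω S) := isClosed_closure
  have : CompleteSpace (XInfty Ω S) := hc.isComplete.completeSpace_coe
  have : IsCountablyGenerated (uniformity (XInfty Ω S)) := by
    rw [uniformity_subtype]
    infer_instance
  infer_instance

/-! ### Taylor sums -/

theorem eval_taylorSum (N : ℕ ≃ (Fin d → ℕ)) (f : AInfty Ω S) (ζ : Fin d → ℂ) (m : ℕ)
    (z : Fin d → ℂ) : MvPolynomial.eval z (f.taylorSum N ζ m)
      = ∑ j ∈ Finset.range (m + 1),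
        (f.extDeriv (N j) ζ / ∏ i, ((N j i).factorial : ℂ)) * monoFn (N j) (z - ζ) := by
  simp [AInfty.taylorSum, monoFn]

theorem mixedDeriv_taylorSum (N : ℕ ≃ (Fin d → ℕ)) (f : AInfty Ω S) (ζ : Fin d → ℂ) (m : ℕ)
    (α : Fin d → ℕ) (z : Fin d → ℂ) :
    mixedDeriv α (fun z => MvPolynomial.eval z (f.taylorSum N ζ m)) z
      = ∑ j ∈ Finset.range (m + 1), (f.extDeriv (N j) ζ / ∏ i, ((N j i).factorial : ℂ)) *
        mixedDeriv α (monoFn (N j)) (z - ζ) := by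
  rw [show (fun z => MvPolynomial.eval z (f.taylorSum N ζ m))
    = fun z => ∑ j ∈ Finset.range (m + 1),
        (f.extDeriv (N j) ζ / ∏ i, ((N j i).factorial : ℂ)) * monoFn (N j) (z - ζ) from
    funext (eval_taylorSum N f ζ m),
    mixedDeriv_finset_sum _ α _ (G := fun j z => monoFn (N j) (z - ζ)) fun j _ z _ => ?_]
  · exact Finset.sum_congr rfl fun j _ => by rw [mixedDeriv_comp_sub α (monoFn (N j))]
  · exact (analyticOnNhd_monoFn (N j) (z - ζ) trivial).comp (f := fun z => z - ζ)
      (analyticAt_id.sub analyticAt_const)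

theorem exists_taylorSum_ofPoly (hS : ∀ i, S i ⊆ frontier (Ω i : Set ℂ)) (N : ℕ ≃ (Fin d → ℕ))
    (P : MvPolynomial (Fin d) ℂ) : ∃ m₀ : ℕ, ∀ m ≥ m₀, ∀ ζ ∈ prodWithBdry Ω S,
      (fun z => MvPolynomial.eval z ((AInfty.ofPoly Ω S P).taylorSum N ζ m))
        = fun z => MvPolynomial.eval z P := by
  obtain ⟨m₀, h⟩ := exists_taylor_eval N P
  refine ⟨m₀, fun m hm ζ hζ => funext fun z => ?_⟩
  rw [eval_taylorSum, ← h m hm ζ z]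
  exact Finset.sum_congr rfl fun j _ => by rw [eqOn_extDeriv_ofPoly hS P (N j) hζ]

theorem mixedDeriv_taylorSum_smul_add (hS : ∀ i, S i ⊆ frontier (Ω i : Set ℂ))
    (N : ℕ ≃ (Fin d → ℕ)) (c : ℂ) (f g : AInfty Ω S) {ζ : Fin d → ℂ} (hζ : ζ ∈ prodWithBdry Ω S)
    (m : ℕ) (α : Fin d → ℕ) (z : Fin d → ℂ) :
    mixedDeriv α (fun z => MvPolynomial.eval z ((c • f + g).taylorSum N ζ m)) z
      = c * mixedDeriv α (fun z => MvPolynomial.eval z (f.taylorSum N ζ m)) z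
        + mixedDeriv α (fun z => MvPolynomial.eval z (g.taylorSum N ζ m)) z := by
  simp only [mixedDeriv_taylorSum, Finset.mul_sum, ← Finset.sum_add_distrib]
  refine Finset.sum_congr rfl fun j _ => ?_
  rw [eqOn_extDeriv_smul_add hS c f g (N j) hζ]
  ring

/-- The derivatives of a Taylor sum depend jointly continuously on the function, the centre and the
point of evaluation. -/
theorem continuous_mixedDeriv_taylorSum (hS : ∀ i, S i ⊆ frontier (Ω i : Set ℂ))
    [LocallyCompactSpace (prodWithBdry Ω S)] (N : ℕ ≃ (Fin d → ℕ)) (m : ℕ) (α : Fin d → ℕ) :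
    Continuous fun x : AInfty Ω S × prodWithBdry Ω S × (Fin d → ℂ) =>
      mixedDeriv α (fun z => MvPolynomial.eval z (x.1.taylorSum N x.2.1 m)) x.2.2 := by
  simp only [mixedDeriv_taylorSum]
  refine continuous_finsetSum _ fun j _ => Continuous.mul (Continuous.div_const ?_ _) ?_
  · have h1 : Continuous fun f : AInfty Ω S => jet hS f (N j) :=
      (continuous_apply (N j)).comp (isUniformInducing_jet hS).isInducing.continuous
    exact (h1.comp continuous_fst).eval (continuous_fst.comp continuous_snd)
  · have h1 := continuousOn_univ.1
      (mixedDeriv_analyticOnNhd α (analyticOnNhd_monoFn (N j))).continuousOn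
    exact h1.comp ((continuous_snd.comp continuous_snd).sub
      (continuous_subtype_val.comp (continuous_fst.comp continuous_snd)))

theorem continuous_extDeriv_apply (hS : ∀ i, S i ⊆ frontier (Ω i : Set ℂ))
    [LocallyCompactSpace (prodWithBdry Ω S)] (α : Fin d → ℕ) :
    Continuous fun x : AInfty Ω S × prodWithBdry Ω S => x.1.extDeriv α x.2 := by
  have h1 : Continuous fun f : AInfty Ω S => jet hS f α :=
    (continuous_apply α).comp (isUniformInducing_jet hS).isInducing.continuous
  exact (h1.comp continuous_fst).eval continuous_snd

end Spaces

/-! ### Approximation along sets of indices -/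

section Approx

variable {Ω : Fin d → TopologicalSpace.Opens ℂ} {S : Fin d → Set ℂ}

/-- The value at `z` of the mixed derivative of order `α` of the Taylor sum with centre `ζ`. -/
def taylorDeriv (N : ℕ ≃ (Fin d → ℕ)) (f : AInfty Ω S) (m : ℕ) (α : Fin d → ℕ)
    (ζ z : Fin d → ℂ) : ℂ :=
  mixedDeriv α (fun z => MvPolynomial.eval z (f.taylorSum N ζ m)) z

/-- Along the filter `p`, the Taylor sums of `f` converge to `h` in `O(K)` and to `f` in
`A^∞(Ω, S)`, uniformly for centres in compact subsets of `∏ (Ωᵢ ∪ Sᵢ)`. -/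
def IsApproxAlong (N : ℕ ≃ (Fin d → ℕ)) (f : AInfty Ω S) (p : Filter ℕ) (K : Set (Fin d → ℂ))
    (h : (Fin d → ℂ) → ℂ) : Prop :=
  ∀ L : Set (prodWithBdry Ω S), IsCompact L → ∀ α, ∀ ε > 0, ∀ᶠ m in p,
    (∀ ζ ∈ L, ∀ z ∈ K, ‖taylorDeriv N f m α ζ z - mixedDeriv α h z‖ < ε) ∧
    ∀ ζ ∈ L, ∀ z ∈ L, ‖taylorDeriv N f m α ζ z - f.extDeriv α z‖ < ε

variable {N : ℕ ≃ (Fin d → ℕ)}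

theorem IsApproxAlong.mono {f : AInfty Ω S} {p p' : Filter ℕ} {K K' : Set (Fin d → ℂ)}
    {h : (Fin d → ℂ) → ℂ} (H : IsApproxAlong N f p K h) (hp : p' ≤ p) (hK : K' ⊆ K) :
    IsApproxAlong N f p' K' h := fun L hL α ε hε =>
  ((H L hL α ε hε).filter_mono hp).mono fun _ hm => ⟨fun ζ hζ z hz => hm.1 ζ hζ z (hK hz), hm.2⟩

theorem norm_comb_lt {c a a' b b' : ℂ} {ε : ℝ} (h1 : ‖a - a'‖ < ε / (2 * (‖c‖ + 1)))
    (h2 : ‖b - b'‖ < ε / 2) : ‖(c * a + b) - (c * a' + b')‖ < ε := by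
  have h3 : (c * a + b) - (c * a' + b') = c * (a - a') + (b - b') := by ring
  have h4 : ‖c‖ * ‖a - a'‖ ≤ ε / 2 := by
    rw [lt_div_iff₀ (by positivity)] at h1
    nlinarith [norm_nonneg c, norm_nonneg (a - a')]
  rw [h3]
  refine (norm_add_le _ _).trans_lt ?_
  rw [norm_mul]
  linarith

theorem IsApproxAlong.smul_add (hS : ∀ i, S i ⊆ frontier (Ω i : Set ℂ)) {f g : AInfty Ω S}
    {p : Filter ℕ} {K : Set (Fin d → ℂ)} {h h' H : (Fin d → ℂ) → ℂ} (c : ℂ)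
    (hf : IsApproxAlong N f p K h) (hg : IsApproxAlong N g p K h')
    (hH : ∀ α, ∀ z ∈ K, mixedDeriv α H z = c * mixedDeriv α h z + mixedDeriv α h' z) :
    IsApproxAlong N (c • f + g) p K H := by
  intro L hL α ε hε
  filter_upwards [hf L hL α (ε / (2 * (‖c‖ + 1))) (by positivity),
    hg L hL α (ε / 2) (by positivity)] with m hm hm'
  have hT : ∀ ζ ∈ L, ∀ z, taylorDeriv N (c • f + g) m α ζ z
      = c * taylorDeriv N f m α ζ z + taylorDeriv N g m α ζ z := fun ζ _ z =>
    mixedDeriv_taylorSum_smul_add hS N c f g ζ.2 m α z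
  refine ⟨fun ζ hζ z hz => ?_, fun ζ hζ z hz => ?_⟩
  · rw [hT ζ hζ, hH α z hz]
    exact norm_comb_lt (hm.1 ζ hζ z hz) (hm'.1 ζ hζ z hz)
  · rw [hT ζ hζ, eqOn_extDeriv_smul_add hS c f g α z.2]
    exact norm_comb_lt (hm.2 ζ hζ z hz) (hm'.2 ζ hζ z hz)

theorem isApproxAlong_zero (hS : ∀ i, S i ⊆ frontier (Ω i : Set ℂ)) (p : Filter ℕ)
    (K : Set (Fin d → ℂ)) : IsApproxAlong N (0 : AInfty Ω S) p K (fun _ => 0) := by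
  intro L hL α ε hε
  have h0 : (-1 : ℂ) • (0 : AInfty Ω S) + 0 = 0 := by simp
  have h1 : ∀ ζ : prodWithBdry Ω S, ∀ m z, taylorDeriv N (0 : AInfty Ω S) m α ζ z = 0 := by
    intro ζ m z
    have := mixedDeriv_taylorSum_smul_add hS N (-1) (0 : AInfty Ω S) 0 ζ.2 m α z
    rw [h0] at this
    exact this.trans (by ring)
  have h2 : ∀ z : prodWithBdry Ω S, (0 : AInfty Ω S).extDeriv α z = 0 := by
    intro z
    have := eqOn_extDeriv_smul_add hS (-1) (0 : AInfty Ω S) 0 α z.2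
    rw [h0] at this
    exact this.trans (by ring)
  refine Eventually.of_forall fun m => ⟨fun ζ _ z _ => ?_, fun ζ _ z _ => ?_⟩
  · simpa [h1, mixedDeriv_const_zero] using hε
  · simpa [h1, h2] using hε

theorem tendstoUniformlyOn_const_iff {ι α β : Type*} [UniformSpace β] {F : ι → α → β} {b : β}
    {p : Filter ι} {s : Set α} :
    TendstoUniformlyOn F (fun _ => b) p s ↔
      Tendsto (fun q : ι × α => F q.1 q.2) (p ×ˢ 𝓟 s) (𝓝 b) := by
  rw [tendstoUniformlyOn_iff_tendsto, nhds_eq_comap_uniformity, tendsto_comap_iff]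
  rfl

/-- The convergence in the definition of universality, along a sequence of indices. -/
theorem isApproxAlong_map_iff (hS : ∀ i, S i ⊆ frontier (Ω i : Set ℂ)) {f : AInfty Ω S}
    {K : Set (Fin d → ℂ)} {h : OSpace K} {l : ℕ → ℕ} :
    (∀ L : Set (Fin d → ℂ), IsCompact L → L ⊆ prodWithBdry Ω S →
      TendstoUniformlyOn (fun n ζ => OSpace.ofPoly K (f.taylorSum N ζ (l n)))
          (fun _ => h) atTop L ∧
        TendstoUniformlyOn (fun n ζ => AInfty.ofPoly Ω S (f.taylorSum N ζ (l n)))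
          (fun _ => f) atTop L) ↔
      IsApproxAlong N f (map l atTop) K h.toFun := by
  simp only [tendstoUniformlyOn_const_iff, tendsto_oSpace_iff, tendsto_aInfty_iff hS,
    eventually_prod_principal_iff]
  constructor
  · intro H L hL α ε hε
    obtain ⟨h1, h2⟩ := H (Subtype.val '' L) (hL.image continuous_subtype_val)
      (by rintro _ ⟨z, -, rfl⟩; exact z.2)
    rw [eventually_map]
    filter_upwards [h1 α ε hε, h2 α L hL ε hε] with n hn hn'
    refine ⟨fun ζ hζ z hz => hn ζ ⟨ζ, hζ, rfl⟩ z hz, fun ζ hζ z hz => ?_⟩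
    have := hn' ζ ⟨ζ, hζ, rfl⟩ z hz
    rwa [eqOn_extDeriv_ofPoly hS _ α z.2] at this
  · intro H L hL hLW
    have hL' : IsCompact (Subtype.val ⁻¹' L : Set (prodWithBdry Ω S)) :=
      IsEmbedding.subtypeVal.isInducing.isCompact_preimage' hL (by rwa [Subtype.range_coe])
    refine ⟨fun α ε hε => ?_, fun α L' hL'' ε hε => ?_⟩
    · filter_upwards [eventually_map.1 (H _ hL' α ε hε)] with n hn ζ hζ z hz
      exact hn.1 ⟨ζ, hLW hζ⟩ hζ z hz
    · filter_upwards [eventually_map.1 (H _ (hL'.union hL'') α ε hε)] with n hn ζ hζ z hz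
      rw [eqOn_extDeriv_ofPoly hS _ α z.2]
      exact hn.2 ⟨ζ, hLW hζ⟩ (Or.inl hζ) z (Or.inr hz)

theorem atTop_inf_principal_range_le {l : ℕ → ℕ} (hl : StrictMono l) :
    atTop ⊓ 𝓟 (range l) ≤ map l atTop := by
  intro s hs
  obtain ⟨n₀, hn₀⟩ := mem_atTop_sets.1 (mem_map.1 hs)
  rw [mem_inf_principal]
  filter_upwards [mem_atTop (l n₀)] with m hm
  rintro ⟨k, rfl⟩
  exact hn₀ k (hl.le_iff_le.1 hm)

/-- The conditions on the compact sets `Kᵢ` in the definition of universality. -/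
structure IsAdmissible (Ω : Fin d → TopologicalSpace.Opens ℂ) (S : Fin d → Set ℂ)
    (K : Fin d → Set ℂ) : Prop where
  isCompact : ∀ i, IsCompact (K i)
  isConnected : ∀ i, IsConnected (K i)ᶜ
  disjoint : Disjoint (univ.pi K) (prodWithClosedBdry Ω S)

theorem isUniversal_iff (hS : ∀ i, S i ⊆ frontier (Ω i : Set ℂ)) {μ : Set ℕ} {f : AInfty Ω S} :
    IsUniversal N μ f ↔ ∀ K, IsAdmissible Ω S K → ∀ h : OSpace (univ.pi K),
      ∃ ν ⊆ μ, ν.Infinite ∧ IsApproxAlong N f (atTop ⊓ 𝓟 ν) (univ.pi K) h.toFun := by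
  constructor
  · intro H K hK h
    obtain ⟨l, hl, hlμ, hlim⟩ := H K hK.1 hK.2 hK.3 h
    refine ⟨range l, range_subset_iff.2 hlμ, infinite_range_of_injective hl.injective, ?_⟩
    exact ((isApproxAlong_map_iff hS).1 hlim).mono (atTop_inf_principal_range_le hl) Subset.rfl
  · intro H K h1 h2 h3 h
    obtain ⟨ν, hν, hinf, hap⟩ := H K ⟨h1, h2, h3⟩ h
    refine ⟨Nat.nth (· ∈ ν), Nat.nth_strictMono hinf, fun n => hν (Nat.nth_mem_of_infinite hinf n),
      (isApproxAlong_map_iff hS).2 (hap.mono (le_inf ?_ ?_) Subset.rfl)⟩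
    · exact (Nat.nth_strictMono hinf).tendsto_atTop
    · rw [le_principal_iff, mem_map]
      exact univ_mem' fun n => Nat.nth_mem_of_infinite hinf n

/-- The first `n + 1` mixed derivatives of the Taylor sum of length `m` are within `1 / (n + 1)` of
those of `h` on `K` and of those of `f` on the `n`-th set of an exhaustion, for centres
in that set. -/
def IsGood (N : ℕ ≃ (Fin d → ℕ)) (E : ℕ → Set (prodWithBdry Ω S)) (K : Set (Fin d → ℂ))
    (h : (Fin d → ℂ) → ℂ) (f : AInfty Ω S) (n m : ℕ) : Prop :=
  ∀ j ≤ n, (∀ ζ ∈ E n, ∀ z ∈ K,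
      ‖taylorDeriv N f m (N j) ζ z - mixedDeriv (N j) h z‖ < 1 / ((n : ℝ) + 1)) ∧
    ∀ ζ ∈ E n, ∀ z ∈ E n, ‖taylorDeriv N f m (N j) ζ z - f.extDeriv (N j) z‖ < 1 / ((n : ℝ) + 1)

theorem IsApproxAlong.frequently_isGood {E : ℕ → Set (prodWithBdry Ω S)}
    (hE : ∀ n, IsCompact (E n)) {f : AInfty Ω S} {ν : Set ℕ} (hν : ν.Infinite)
    {K : Set (Fin d → ℂ)} {h : (Fin d → ℂ) → ℂ} (H : IsApproxAlong N f (atTop ⊓ 𝓟 ν) K h) (n : ℕ) :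
    ∃ᶠ m in atTop, m ∈ ν ∧ IsGood N E K h f n m := by
  have h1 : ∀ᶠ m in atTop ⊓ 𝓟 ν, IsGood N E K h f n m := by
    have h2 : ∀ᶠ m in atTop ⊓ 𝓟 ν, ∀ j ∈ Iic n, _ := (finite_Iic n).eventually_all.2 fun j _ =>
      H (E n) (hE n) (N j) (1 / ((n : ℝ) + 1)) Nat.one_div_pos_of_nat
    exact h2
  rw [eventually_inf_principal] at h1
  exact ((Nat.frequently_atTop_iff_infinite.2 hν).and_eventually h1).mono
    fun m hm => ⟨hm.1, hm.2 hm.1⟩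

theorem exists_isApproxAlong (E : CompactExhaustion (prodWithBdry Ω S)) {f : AInfty Ω S}
    {μ : Set ℕ} {K : Set (Fin d → ℂ)} {h : (Fin d → ℂ) → ℂ}
    (H : ∀ n, ∃ m ∈ μ, n ≤ m ∧ IsGood N E K h f n m) :
    ∃ ν ⊆ μ, ν.Infinite ∧ IsApproxAlong N f (atTop ⊓ 𝓟 ν) K h := by
  have hanti : ∀ {n n' m}, n ≤ n' → IsGood N E K h f n' m → IsGood N E K h f n m := by
    intro n n' m hn hg j hj
    have hsub : E n ⊆ E n' := E.subset hn
    have hle : 1 / ((n' : ℝ) + 1) ≤ 1 / ((n : ℝ) + 1) := Nat.one_div_le_one_div hn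
    obtain ⟨h1, h2⟩ := hg j (hj.trans hn)
    exact ⟨fun ζ hζ z hz => (h1 ζ (hsub hζ) z hz).trans_le hle,
      fun ζ hζ z hz => (h2 ζ (hsub hζ) z (hsub hz)).trans_le hle⟩
  obtain ⟨l, hl, hlg⟩ := extraction_forall_of_frequently
    (P := fun n m => m ∈ μ ∧ IsGood N E K h f n m) fun n => by
      rw [frequently_atTop]
      intro a
      obtain ⟨m, hm, hnm, hg⟩ := H (max a n)
      exact ⟨m, (le_max_left a n).trans hnm, hm, hanti (le_max_right a n) hg⟩
  refine ⟨range l, range_subset_iff.2 fun n => (hlg n).1,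
    infinite_range_of_injective hl.injective, ?_⟩
  suffices IsApproxAlong N f (map l atTop) K h from
    this.mono (atTop_inf_principal_range_le hl) Subset.rfl
  intro L hL α ε hε
  obtain ⟨k, hk⟩ := E.exists_superset_of_isCompact hL
  obtain ⟨k', hk'⟩ := exists_nat_one_div_lt hε
  rw [eventually_map]
  filter_upwards [mem_atTop (max (max k k') (N.symm α))] with n hn
  have hn1 : k ≤ n := ((le_max_left _ _).trans (le_max_left _ _)).trans hn
  have hn2 : k' ≤ n := ((le_max_right _ _).trans (le_max_left _ _)).trans hn
  have hn3 : N.symm α ≤ n := (le_max_right _ _).trans hn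
  have hsub : L ⊆ E n := hk.trans (E.subset hn1)
  have hle : 1 / ((n : ℝ) + 1) < ε := (Nat.one_div_le_one_div hn2).trans_lt hk'
  obtain ⟨h1, h2⟩ := (hlg n).2 _ hn3
  rw [N.apply_symm_apply] at h1 h2
  exact ⟨fun ζ hζ z hz => (h1 ζ (hsub hζ) z hz).trans hle,
    fun ζ hζ z hz => (h2 ζ (hsub hζ) z (hsub hz)).trans hle⟩

theorem eventually_forall_lt_of_continuous {X Y : Type*} [TopologicalSpace X] [TopologicalSpace Y]
    {F : X × Y → ℝ} (hF : Continuous F) {K : Set Y} (hK : IsCompact K) {x₀ : X} {ε : ℝ}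
    (h : ∀ y ∈ K, F (x₀, y) < ε) : ∀ᶠ x in 𝓝 x₀, ∀ y ∈ K, F (x, y) < ε :=
  hK.eventually_forall_of_forall_eventually fun y hy =>
    hF.continuousAt.eventually (gt_mem_nhds (h y hy))

theorem continuous_taylorDeriv (hS : ∀ i, S i ⊆ frontier (Ω i : Set ℂ))
    [LocallyCompactSpace (prodWithBdry Ω S)] (m : ℕ) (α : Fin d → ℕ) :
    Continuous fun x : AInfty Ω S × prodWithBdry Ω S × (Fin d → ℂ) =>
      taylorDeriv N x.1 m α x.2.1 x.2.2 :=
  continuous_mixedDeriv_taylorSum hS N m α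

theorem isOpen_isGood (hS : ∀ i, S i ⊆ frontier (Ω i : Set ℂ))
    [LocallyCompactSpace (prodWithBdry Ω S)] {E : ℕ → Set (prodWithBdry Ω S)}
    (hE : ∀ n, IsCompact (E n)) {K : Set (Fin d → ℂ)} (hK : IsCompact K)
    (P : MvPolynomial (Fin d) ℂ) (n m : ℕ) :
    IsOpen {f : AInfty Ω S | IsGood N E K (fun z => MvPolynomial.eval z P) f n m} := by
  rw [isOpen_iff_mem_nhds]
  intro f hf
  have key : ∀ j ∈ Iic n, ∀ᶠ g in 𝓝 f,
      (∀ ζ ∈ E n, ∀ z ∈ K, ‖taylorDeriv N g m (N j) ζ z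
        - mixedDeriv (N j) (fun z => MvPolynomial.eval z P) z‖ < 1 / ((n : ℝ) + 1)) ∧
      ∀ ζ ∈ E n, ∀ z ∈ E n,
        ‖taylorDeriv N g m (N j) ζ z - g.extDeriv (N j) z‖ < 1 / ((n : ℝ) + 1) := by
    intro j hj
    have hT := continuous_taylorDeriv (N := N) hS m (N j)
    have hx := continuous_extDeriv_apply hS (N j)
    have hP : Continuous (mixedDeriv (N j) fun z => MvPolynomial.eval z P) :=
      continuousOn_univ.1 (mixedDeriv_eval_analyticOnNhd (N j) P).continuousOn
    obtain ⟨hf1, hf2⟩ := hf j hj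
    have hc1 : Continuous fun x : AInfty Ω S × prodWithBdry Ω S × (Fin d → ℂ) =>
        ‖taylorDeriv N x.1 m (N j) x.2.1 x.2.2
          - mixedDeriv (N j) (fun z => MvPolynomial.eval z P) x.2.2‖ :=
      (hT.sub (hP.comp (continuous_snd.comp continuous_snd))).norm
    have hc2 : Continuous fun x : AInfty Ω S × prodWithBdry Ω S × prodWithBdry Ω S =>
        ‖taylorDeriv N x.1 m (N j) x.2.1 x.2.2 - x.1.extDeriv (N j) x.2.2‖ :=
      ((hT.comp (continuous_fst.prodMk ((continuous_fst.comp continuous_snd).prodMk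
          (continuous_subtype_val.comp (continuous_snd.comp continuous_snd))))).sub
        (hx.comp (continuous_fst.prodMk (continuous_snd.comp continuous_snd)))).norm
    filter_upwards [eventually_forall_lt_of_continuous hc1 ((hE n).prod hK)
        (fun y hy => hf1 y.1 hy.1 y.2 hy.2),
      eventually_forall_lt_of_continuous hc2 ((hE n).prod (hE n))
        (fun y hy => hf2 y.1 hy.1 y.2 hy.2)] with g hg1 hg2
    exact ⟨fun ζ hζ z hz => hg1 (ζ, z) ⟨hζ, hz⟩, fun ζ hζ z hz => hg2 (ζ, z) ⟨hζ, hz⟩⟩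
  exact (finite_Iic n).eventually_all.2 key

/-! ### Admissible compact sets -/

theorem IsAdmissible.isFull {K : Fin d → Set ℂ} (hK : IsAdmissible Ω S K) (i : Fin d) :
    IsFull (K i) := isFull_of_isConnected_compl (hK.isCompact i) (hK.isConnected i)

theorem IsAdmissible.exists_disjoint {K : Fin d → Set ℂ} (hK : IsAdmissible Ω S K) :
    ∃ i, Disjoint (K i) ((Ω i : Set ℂ) ∪ closure (S i)) := by
  by_contra! h
  choose x hx hx' using fun i => Set.not_disjoint_iff.1 (h i)
  exact Set.disjoint_left.1 hK.disjoint (fun i _ => hx i) fun i _ => hx' i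

/-- The admissible products are contained in countably many of them. -/
theorem exists_countable_admissible (hΩ : ∀ i, IsConnected (Ω i : Set ℂ)) :
    ∃ T : Fin d × ℕ × ℕ → Fin d → Set ℂ, (∀ κ, IsAdmissible Ω S (T κ)) ∧
      ∀ K, IsAdmissible Ω S K → ∃ κ, univ.pi K ⊆ univ.pi (T κ) := by
  choose T hT hTK using fun i => exists_seq_full_disjoint (Ω i).isOpen (hΩ i)
    (isClosed_closure (s := S i))
  let B : ℕ → Set ℂ := fun R => Metric.closedBall 0 ((R : ℝ) + 1)
  have hB : ∀ R, IsFull (B R) := fun R => isFull_closedBall (by positivity)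
  refine ⟨fun κ j => if j = κ.1 then T j κ.2.1 else B κ.2.2,
    fun κ => ⟨fun j => ?_, fun j => ?_, ?_⟩,
    fun K hK => ?_⟩
  · dsimp only
    split_ifs
    exacts [(hT _ _).1, isCompact_closedBall _ _]
  · dsimp only
    split_ifs
    exacts [(hT _ _).2.1.isConnected_compl (hT _ _).1,
      (hB _).isConnected_compl (isCompact_closedBall _ _)]
  · rw [Set.disjoint_left]
    intro z hz hz'
    have h1 := hz κ.1 trivial
    simp only [if_true] at h1
    exact Set.disjoint_left.1 (hT _ _).2.2 h1 (hz' κ.1 trivial)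
  · obtain ⟨i, hi⟩ := hK.exists_disjoint
    obtain ⟨n, hn⟩ := hTK i (K i) (hK.isCompact i) (hK.isFull i) hi
    obtain ⟨R, hR⟩ := (isCompact_univ_pi hK.isCompact).isBounded.exists_norm_le
    obtain ⟨R', hR'⟩ := exists_nat_ge R
    refine ⟨(i, n, R'), fun z hz j _ => ?_⟩
    dsimp only
    split_ifs with hj
    · subst hj
      exact hn (hz j trivial)
    · have h1 := (norm_le_pi_norm z j).trans (hR z hz)
      simp only [B, mem_closedBall_zero_iff]
      linarith

/-- Polynomials approximate simultaneously a given function on an admissible product and a given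
polynomial in `A^∞(Ω, S)`. -/
theorem IsAdmissible.exists_seq_poly
    (hS : ∀ i, S i ⊆ frontier (Ω i : Set ℂ)) [LocallyCompactSpace (prodWithBdry Ω S)]
    (hconn : ∀ i, IsConnected ((fun z : ℂ => (z : OnePoint ℂ)) '' ((Ω i : Set ℂ) ∪ S i))ᶜ)
    (N : ℕ ≃ (Fin d → ℕ)) {K : Fin d → Set ℂ} (hK : IsAdmissible Ω S K) {h : (Fin d → ℂ) → ℂ}
    (hh : AnalyticOnNhd ℂ h (univ.pi K)) (g : MvPolynomial (Fin d) ℂ) :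
    ∃ Q : ℕ → MvPolynomial (Fin d) ℂ,
      Tendsto (fun k => AInfty.ofPoly Ω S (Q k)) atTop (𝓝 (AInfty.ofPoly Ω S g)) ∧
      ∀ α, ∀ ε > 0, ∀ᶠ k in atTop, ∀ z ∈ univ.pi K,
        ‖mixedDeriv α (fun z => MvPolynomial.eval z (Q k)) z - mixedDeriv α h z‖ < ε := by
  obtain ⟨i, hi⟩ := hK.exists_disjoint
  let E := CompactExhaustion.choice (prodWithBdry Ω S)
  have step : ∀ k : ℕ, ∃ Q : MvPolynomial (Fin d) ℂ, ∀ j ∈ Iic k,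
      (∀ z ∈ univ.pi K, ‖mixedDeriv (N j) (fun z => MvPolynomial.eval z Q) z
        - mixedDeriv (N j) h z‖ < 1 / ((k : ℝ) + 1)) ∧
      ∀ z ∈ E k, ‖mixedDeriv (N j) (fun z => MvPolynomial.eval z Q) z
        - mixedDeriv (N j) (fun z => MvPolynomial.eval z g) z‖ < 1 / ((k : ℝ) + 1) := by
    intro k
    have hpos : 0 < 1 / ((k : ℝ) + 1) := Nat.one_div_pos_of_nat
    have hLc : IsCompact (Subtype.val '' E k) := (E.isCompact k).image continuous_subtype_val
    let Li : Set ℂ := (fun z : Fin d → ℂ => z i) '' (Subtype.val '' E k)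
    have hLi : IsCompact Li := hLc.image (continuous_apply i)
    have hLiE : Li ⊆ (Ω i : Set ℂ) ∪ S i := by
      rintro _ ⟨_, ⟨z, -, rfl⟩, rfl⟩
      exact z.2 i trivial
    have hdis : Disjoint (K i) (hull Li) := hi.mono_right
      ((hull_subset_of_isConnected_sphere_compl (hconn i) hLi hLiE).trans
        (union_subset_union_right _ subset_closure))
    obtain ⟨P, hP⟩ := exists_seq_poly_simultaneous hK.isCompact hK.isFull hh g hLc i
      (isCompact_hull hLi) (isFull_hull Li) (fun z hz => subset_hull _ ⟨z, hz, rfl⟩) hdis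
    have hev : ∀ᶠ n in atTop, ∀ j ∈ Iic k,
        (∀ z ∈ univ.pi K, ‖mixedDeriv (N j) (fun z => MvPolynomial.eval z (P n)) z
          - mixedDeriv (N j) h z‖ < 1 / ((k : ℝ) + 1)) ∧
        ∀ z ∈ E k, ‖mixedDeriv (N j) (fun z => MvPolynomial.eval z (P n)) z
          - mixedDeriv (N j) (fun z => MvPolynomial.eval z g) z‖ < 1 / ((k : ℝ) + 1) := by
      refine (finite_Iic k).eventually_all.2 fun j _ => ?_
      have h1 := Metric.tendstoUniformlyOn_iff.1 (hP (N j)).1 _ hpos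
      have h2 := Metric.tendstoUniformlyOn_iff.1 (hP (N j)).2 _ hpos
      filter_upwards [h1, h2] with n hn hn'
      refine ⟨fun z hz => ?_, fun z hz => ?_⟩
      · rw [← dist_eq_norm, dist_comm]
        exact hn z hz
      · rw [← dist_eq_norm, dist_comm]
        exact hn' z ⟨z, hz, rfl⟩
    obtain ⟨n, hn⟩ := hev.exists
    exact ⟨P n, hn⟩
  choose Q hQ using step
  refine ⟨Q, (tendsto_aInfty_iff hS).2 fun α L hL ε hε => ?_, fun α ε hε => ?_⟩
  · obtain ⟨k, hk⟩ := E.exists_superset_of_isCompact hL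
    obtain ⟨k', hk'⟩ := exists_nat_one_div_lt hε
    filter_upwards [mem_atTop k, mem_atTop k', mem_atTop (N.symm α)] with n h1 h2 h3 z hz
    have := (hQ n (N.symm α) h3).2 z (E.subset h1 (hk hz))
    rw [N.apply_symm_apply] at this
    rw [eqOn_extDeriv_ofPoly hS _ α z.2, eqOn_extDeriv_ofPoly hS _ α z.2]
    exact this.trans ((Nat.one_div_le_one_div h2).trans_lt hk')
  · obtain ⟨k', hk'⟩ := exists_nat_one_div_lt hε
    filter_upwards [mem_atTop k', mem_atTop (N.symm α)] with n h2 h3 z hz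
    have := (hQ n (N.symm α) h3).1 z hz
    rw [N.apply_symm_apply] at this
    exact this.trans ((Nat.one_div_le_one_div h2).trans_lt hk')

end Approx

/-- There is a sequence of polynomials that is dense for uniform convergence on compact sets of all
derivatives. -/
theorem exists_dense_seq_poly (d : ℕ) : ∃ D : ℕ → MvPolynomial (Fin d) ℂ,
    ∀ P : MvPolynomial (Fin d) ℂ, ∃ k : ℕ → ℕ, ∀ K : Set (Fin d → ℂ), IsCompact K → ∀ α, ∀ ε > 0,
      ∀ᶠ n in atTop, ∀ z ∈ K, ‖mixedDeriv α (fun z => MvPolynomial.eval z (D (k n))) z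
        - mixedDeriv α (fun z => MvPolynomial.eval z P) z‖ < ε := by
  let Ω : Fin d → TopologicalSpace.Opens ℂ := fun _ => ⊤
  let S : Fin d → Set ℂ := fun _ => ∅
  have hS : ∀ i, S i ⊆ frontier (Ω i : Set ℂ) := fun i => empty_subset _
  have hW : ∀ z, z ∈ prodWithBdry Ω S := fun z i _ => Or.inl trivial
  have : LocallyCompactSpace (prodWithBdry Ω S) :=
    locallyCompactSpace_prodWithBdry fun i => ⟨∅, isOpen_empty, by simp [S]⟩
  have := secondCountableTopology_aInfty (Ω := Ω) hS
  have hne : Nonempty (range (AInfty.ofPoly Ω S)) := ⟨⟨_, 0, rfl⟩⟩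
  choose D hD using fun n =>
    (TopologicalSpace.denseSeq (range (AInfty.ofPoly Ω S)) n).2
  refine ⟨D, fun P => ?_⟩
  have h1 : (⟨_, P, rfl⟩ : range (AInfty.ofPoly Ω S))
      ∈ closure (range (TopologicalSpace.denseSeq (range (AInfty.ofPoly Ω S)))) :=
    TopologicalSpace.denseRange_denseSeq _ _
  obtain ⟨x, hx, hlim⟩ := mem_closure_iff_seq_limit.1 h1
  choose k hk using hx
  have h2 : Tendsto (fun n => AInfty.ofPoly Ω S (D (k n))) atTop (𝓝 (AInfty.ofPoly Ω S P)) := by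
    have h3 := (continuous_subtype_val.tendsto _).comp hlim
    refine h3.congr fun n => ?_
    rw [Function.comp_apply, ← hk, hD]
  refine ⟨k, fun K hK α ε hε => ?_⟩
  have hK' : IsCompact (Subtype.val ⁻¹' K : Set (prodWithBdry Ω S)) :=
    IsEmbedding.subtypeVal.isInducing.isCompact_preimage' hK
      (by rw [Subtype.range_coe]; exact fun z _ => hW z)
  filter_upwards [(tendsto_aInfty_iff hS).1 h2 α _ hK' ε hε] with n hn z hz
  have := hn ⟨z, hW z⟩ hz
  rwa [eqOn_extDeriv_ofPoly hS _ α (hW z), eqOn_extDeriv_ofPoly hS _ α (hW z)] at this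

section Generic

variable {Ω : Fin d → TopologicalSpace.Opens ℂ} {S : Fin d → Set ℂ} {N : ℕ ≃ (Fin d → ℕ)}

/-! ### Universality as a countable intersection of dense open conditions -/

/-- The functions with a Taylor sum, of length in `μ` and at least `n`, that is good to the
precision `1 / (n + 1)` for the target polynomial `P` on `K`. -/
def goodSet (N : ℕ ≃ (Fin d → ℕ)) (E : ℕ → Set (prodWithBdry Ω S)) (K : Set (Fin d → ℂ))
    (P : MvPolynomial (Fin d) ℂ) (n : ℕ) (μ : Set ℕ) : Set (AInfty Ω S) :=
  {f | ∃ m ∈ μ, n ≤ m ∧ IsGood N E K (fun z => MvPolynomial.eval z P) f n m}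

theorem isOpen_goodSet (hS : ∀ i, S i ⊆ frontier (Ω i : Set ℂ))
    [LocallyCompactSpace (prodWithBdry Ω S)] {E : ℕ → Set (prodWithBdry Ω S)}
    (hE : ∀ n, IsCompact (E n)) {K : Set (Fin d → ℂ)} (hK : IsCompact K)
    (P : MvPolynomial (Fin d) ℂ) (n : ℕ) (μ : Set ℕ) : IsOpen (goodSet N E K P n μ) := by
  have h : goodSet N E K P n μ
      = ⋃ m ∈ {m | m ∈ μ ∧ n ≤ m}, {f | IsGood N E K (fun z => MvPolynomial.eval z P) f n m} := by
    ext f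
    simp only [goodSet, mem_ofPred_eq, mem_iUnion, exists_prop, and_assoc]
  rw [h]
  exact isOpen_biUnion fun m _ => isOpen_isGood hS hE hK P n m

theorem isUniversal_iff_forall_mem_goodSet (hS : ∀ i, S i ⊆ frontier (Ω i : Set ℂ))
    [LocallyCompactSpace (prodWithBdry Ω S)]
    (hconn : ∀ i, IsConnected ((fun z : ℂ => (z : OnePoint ℂ)) '' ((Ω i : Set ℂ) ∪ S i))ᶜ)
    (E : CompactExhaustion (prodWithBdry Ω S)) {ι : Type*} {T : ι → Fin d → Set ℂ}
    (hT : ∀ κ, IsAdmissible Ω S (T κ))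
    (hTK : ∀ K, IsAdmissible Ω S K → ∃ κ, univ.pi K ⊆ univ.pi (T κ))
    {D : ℕ → MvPolynomial (Fin d) ℂ}
    (hD : ∀ P : MvPolynomial (Fin d) ℂ, ∃ k : ℕ → ℕ, ∀ K : Set (Fin d → ℂ), IsCompact K →
      ∀ α, ∀ ε > 0, ∀ᶠ n in atTop, ∀ z ∈ K,
        ‖mixedDeriv α (fun z => MvPolynomial.eval z (D (k n))) z
          - mixedDeriv α (fun z => MvPolynomial.eval z P) z‖ < ε)
    {μ : Set ℕ} {f : AInfty Ω S} :
    IsUniversal N μ f ↔ ∀ κ k n, f ∈ goodSet N E (univ.pi (T κ)) (D k) n μ := by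
  constructor
  · intro H κ k n
    obtain ⟨ν, hν, hinf, hap⟩ := (isUniversal_iff hS).1 H (T κ) (hT κ) (OSpace.ofPoly _ (D k))
    obtain ⟨m, hnm, hm, hg⟩ :=
      frequently_atTop.1 (hap.frequently_isGood (fun n => E.isCompact n) hinf n) n
    exact ⟨m, hν hm, hnm, hg⟩
  · intro H
    refine (isUniversal_iff hS).2 fun K hK h => exists_isApproxAlong E fun n => ?_
    obtain ⟨κ, hκ⟩ := hTK K hK
    have hpos : 0 < 1 / (4 * ((n : ℝ) + 1)) := by positivity
    obtain ⟨Q, -, hQ⟩ := hK.exists_seq_poly hS hconn N h.analytic 0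
    obtain ⟨q, hq⟩ := ((finite_Iic n).eventually_all.2 fun j _ => hQ (N j) _ hpos).exists
    obtain ⟨k, hk⟩ := hD (Q q)
    obtain ⟨p, hp⟩ := ((finite_Iic n).eventually_all.2 fun j _ =>
      hk _ (isCompact_univ_pi hK.isCompact) (N j) _ hpos).exists
    obtain ⟨m, hm, hnm, hg⟩ := H κ (k p) (2 * n + 1)
    have hsub : E n ⊆ E (2 * n + 1) := E.subset (by omega)
    have he : 1 / (((2 * n + 1 : ℕ) : ℝ) + 1) = 2 * (1 / (4 * ((n : ℝ) + 1))) := by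
      push_cast
      field_simp
      ring
    have he' : 1 / ((n : ℝ) + 1) = 4 * (1 / (4 * ((n : ℝ) + 1))) := by
      field_simp
    refine ⟨m, hm, by omega, fun j hj => ?_⟩
    obtain ⟨h1, h2⟩ := hg j (by omega)
    rw [he] at h1 h2
    rw [he']
    generalize 1 / (4 * ((n : ℝ) + 1)) = δ at *
    refine ⟨fun ζ hζ z hz => ?_, fun ζ hζ z hz => ?_⟩
    · have e1 := h1 ζ (hsub hζ) z (hκ hz)
      have e2 := hp j hj z hz
      have e3 := hq j hj z hz
      calc _ ≤ _ := norm_sub_le_norm_sub_add_norm_sub _ _ _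
        _ ≤ _ := add_le_add_right (norm_sub_le_norm_sub_add_norm_sub _ _ _) _
        _ < _ := by linarith
    · exact (h2 ζ (hsub hζ) z (hsub hz)).trans (by linarith)

/-- Density: the Taylor sums of a polynomial are eventually equal to it, and polynomials approximate
simultaneously in `A^∞(Ω, S)` and on admissible products. -/
theorem dense_goodSet (hS : ∀ i, S i ⊆ frontier (Ω i : Set ℂ))
    [LocallyCompactSpace (prodWithBdry Ω S)]
    (hconn : ∀ i, IsConnected ((fun z : ℂ => (z : OnePoint ℂ)) '' ((Ω i : Set ℂ) ∪ S i))ᶜ)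
    (E : ℕ → Set (prodWithBdry Ω S)) {K : Fin d → Set ℂ} (hK : IsAdmissible Ω S K)
    (P : MvPolynomial (Fin d) ℂ) (n : ℕ) {μ : Set ℕ} (hμ : μ.Infinite) :
    Dense {f : XInfty Ω S | f.1 ∈ goodSet N E (univ.pi K) P n μ} := by
  rw [Subtype.dense_iff]
  refine fun f hf => closure_minimal ?_ isClosed_closure hf
  rintro _ ⟨g, rfl⟩
  obtain ⟨Q, hQg, hQP⟩ := hK.exists_seq_poly hS hconn N
    (h := fun z => MvPolynomial.eval z P) (fun z _ => AnalyticOnNhd.eval_mvPolynomial P z trivial) g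
  refine mem_closure_of_tendsto hQg ?_
  have hev := (finite_Iic n).eventually_all.2 fun j _ =>
    hQP (N j) (1 / ((n : ℝ) + 1)) Nat.one_div_pos_of_nat
  filter_upwards [hev] with k hk
  obtain ⟨m₀, hm₀⟩ := exists_taylorSum_ofPoly hS N (Q k)
  obtain ⟨m, hm, hlt⟩ := hμ.exists_gt (max m₀ n)
  have hm' : m₀ ≤ m := (le_max_left _ _).trans hlt.le
  have hT : ∀ j, ∀ ζ : prodWithBdry Ω S, ∀ z,
      taylorDeriv N (AInfty.ofPoly Ω S (Q k)) m (N j) ζ z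
        = mixedDeriv (N j) (fun z => MvPolynomial.eval z (Q k)) z := fun j ζ z => by
    rw [taylorDeriv, hm₀ m hm' ζ ζ.2]
  refine ⟨⟨_, subset_closure ⟨Q k, rfl⟩⟩, ⟨m, hm, (le_max_right _ _).trans hlt.le,
    fun j hj => ⟨fun ζ _ z hz => ?_, fun ζ _ z _ => ?_⟩⟩, rfl⟩
  · rw [hT]
    exact hk j hj z hz
  · rw [hT, eqOn_extDeriv_ofPoly hS _ _ z.2, sub_self, norm_zero]
    exact Nat.one_div_pos_of_nat

theorem isGδ_and_dense_isUniversal (hΩ : ∀ i, IsConnected (Ω i : Set ℂ))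
    (hS : ∀ i, S i ⊆ frontier (Ω i : Set ℂ)) [LocallyCompactSpace (prodWithBdry Ω S)]
    (hconn : ∀ i, IsConnected ((fun z : ℂ => (z : OnePoint ℂ)) '' ((Ω i : Set ℂ) ∪ S i))ᶜ)
    {μ : Set ℕ} (hμ : μ.Infinite) :
    IsGδ {f : XInfty Ω S | IsUniversal N μ f.1} ∧ Dense {f : XInfty Ω S | IsUniversal N μ f.1} := by
  obtain ⟨T, hT, hTK⟩ := exists_countable_admissible (S := S) hΩ
  obtain ⟨D, hD⟩ := exists_dense_seq_poly d
  let E := CompactExhaustion.choice (prodWithBdry Ω S)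
  have hU : {f : XInfty Ω S | IsUniversal N μ f.1} = ⋂ x : (Fin d × ℕ × ℕ) × ℕ × ℕ,
      {f : XInfty Ω S | f.1 ∈ goodSet N E (univ.pi (T x.1)) (D x.2.1) x.2.2 μ} := by
    ext f
    simp only [mem_ofPred_eq, mem_iInter, Prod.forall]
    rw [isUniversal_iff_forall_mem_goodSet hS hconn E hT hTK hD]
    simp only [Prod.forall]
  have ho : ∀ x : (Fin d × ℕ × ℕ) × ℕ × ℕ,
      IsOpen {f : XInfty Ω S | f.1 ∈ goodSet N E (univ.pi (T x.1)) (D x.2.1) x.2.2 μ} := fun x =>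
    (isOpen_goodSet hS (fun n => E.isCompact n) (isCompact_univ_pi (hT x.1).isCompact) _ _
      _).preimage continuous_subtype_val
  have := baireSpace_xInfty (Ω := Ω) hS
  rw [hU]
  exact ⟨IsGδ.iInter fun x => (ho x).isGδ,
    dense_iInter_of_isOpen ho fun x => dense_goodSet hS hconn E (hT x.1) _ _ hμ⟩

/-! ### A dense subspace of universal functions -/

theorem continuous_smul_add (hS : ∀ i, S i ⊆ frontier (Ω i : Set ℂ)) (c : ℂ) :
    Continuous fun x : AInfty Ω S × AInfty Ω S => c • x.1 + x.2 := by
  rw [continuous_iff_continuousAt]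
  intro x
  refine (tendsto_aInfty_iff hS).2 fun α L hL ε hε => ?_
  have h1 := (tendsto_aInfty_iff hS).1 (continuous_fst.tendsto x) α L hL
    (ε / (2 * (‖c‖ + 1))) (by positivity)
  have h2 := (tendsto_aInfty_iff hS).1 (continuous_snd.tendsto x) α L hL (ε / 2) (by positivity)
  filter_upwards [h1, h2] with y hy hy' z hz
  rw [eqOn_extDeriv_smul_add hS c _ _ α z.2, eqOn_extDeriv_smul_add hS c _ _ α z.2]
  exact norm_comb_lt (hy z hz) (hy' z hz)

theorem ofPoly_smul_add (c : ℂ) (P Q : MvPolynomial (Fin d) ℂ) :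
    c • AInfty.ofPoly Ω S P + AInfty.ofPoly Ω S Q
      = AInfty.ofPoly Ω S (MvPolynomial.C c * P + Q) := by
  apply Subtype.ext
  funext z
  change c * MvPolynomial.eval (z : Fin d → ℂ) P + MvPolynomial.eval (z : Fin d → ℂ) Q
    = MvPolynomial.eval (z : Fin d → ℂ) (MvPolynomial.C c * P + Q)
  simp

/-- `X^∞(Ω, S)` as a vector subspace of `A^∞(Ω, S)`. -/
def xInftySubmodule (hS : ∀ i, S i ⊆ frontier (Ω i : Set ℂ)) : Submodule ℂ (AInfty Ω S) :=
  have hlin : ∀ (c : ℂ) {f g : AInfty Ω S}, f ∈ XInfty Ω S → g ∈ XInfty Ω S →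
      c • f + g ∈ XInfty Ω S := fun c f g hf hg =>
    map_mem_closure₂ (f := fun f g => c • f + g) (continuous_smul_add hS c) hf hg (by
      rintro _ ⟨P, rfl⟩ _ ⟨Q, rfl⟩
      exact ⟨_, (ofPoly_smul_add c P Q).symm⟩)
  have hzero : (0 : AInfty Ω S) ∈ XInfty Ω S := by
    refine subset_closure ⟨0, Subtype.ext (funext fun z => ?_)⟩
    exact map_zero (MvPolynomial.eval (z : Fin d → ℂ))
  { carrier := XInfty Ω S
    zero_mem' := hzero
    add_mem' := fun {f g} hf hg => by simpa using hlin 1 hf hg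
    smul_mem' := fun c f hf => by simpa using hlin c hf hzero }

/-- One step of the construction: a universal function for all given sets of indices, in a given
open set, whose Taylor sums tend to zero along suitable infinite subsets. -/
theorem exists_universal_approx_zero (hΩ : ∀ i, IsConnected (Ω i : Set ℂ))
    (hS : ∀ i, S i ⊆ frontier (Ω i : Set ℂ)) [LocallyCompactSpace (prodWithBdry Ω S)]
    (hconn : ∀ i, IsConnected ((fun z : ℂ => (z : OnePoint ℂ)) '' ((Ω i : Set ℂ) ∪ S i))ᶜ)
    {ι : Type*} [Countable ι] {T : ι → Fin d → Set ℂ} (hT : ∀ κ, IsAdmissible Ω S (T κ))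
    {ν : ι → Set ℕ} (hν : ∀ κ, (ν κ).Infinite) {O : Set (XInfty Ω S)} (hO : IsOpen O)
    (hne : O.Nonempty) :
    ∃ f ∈ O, ∃ ν' : ι → Set ℕ, (∀ κ, (ν' κ).Infinite) ∧ ∀ κ, IsUniversal N (ν κ) f.1 ∧ ν' κ ⊆ ν κ ∧
      IsApproxAlong N f.1 (atTop ⊓ 𝓟 (ν' κ)) (univ.pi (T κ)) fun _ => 0 := by
  have := baireSpace_xInfty (Ω := Ω) hS
  have hd : Dense (⋂ κ, {f : XInfty Ω S | IsUniversal N (ν κ) f.1}) := dense_iInter_of_Gδ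
    (fun κ => (isGδ_and_dense_isUniversal hΩ hS hconn (hν κ)).1)
    fun κ => (isGδ_and_dense_isUniversal hΩ hS hconn (hν κ)).2
  obtain ⟨f, hfO, hf⟩ := hd.inter_open_nonempty O hO hne
  rw [mem_iInter] at hf
  choose ν' hsub hinf hap using fun κ => (isUniversal_iff hS).1 (hf κ) (T κ) (hT κ)
    ⟨fun _ => 0, fun _ _ => analyticAt_const⟩
  exact ⟨f, hfO, ν', hinf, fun κ => ⟨hf κ, hsub κ, hap κ⟩⟩

/-- Linear combinations of the terms of the sequence are universal, because the Taylor sums of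
all but the last term can be made to vanish in the limit. -/
theorem isUniversal_of_mem_span (hS : ∀ i, S i ⊆ frontier (Ω i : Set ℂ)) {ι : Type*}
    {T : ι → Fin d → Set ℂ} (hTK : ∀ K, IsAdmissible Ω S K → ∃ κ, univ.pi K ⊆ univ.pi (T κ))
    {μ : Set ℕ} {ν : ℕ → ι → Set ℕ} (hνμ : ∀ n κ, ν n κ ⊆ μ) (hν : ∀ n κ, ν (n + 1) κ ⊆ ν n κ)
    {F : ℕ → AInfty Ω S} (hF : ∀ n κ, IsUniversal N (ν n κ) (F n))
    (hF0 : ∀ n κ, IsApproxAlong N (F n) (atTop ⊓ 𝓟 (ν (n + 1) κ)) (univ.pi (T κ)) fun _ => 0)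
    {f : AInfty Ω S} (hf : f ∈ Submodule.span ℂ (range F)) (hf0 : f ≠ 0) : IsUniversal N μ f := by
  have hanti : ∀ κ, Antitone fun n => ν n κ := fun κ => antitone_nat_of_succ_le fun n => hν n κ
  -- A nonzero combination has a last term `c • F n`, preceded by terms tending to zero.
  have hsplit : ∀ n, ∀ a : ℕ → ℂ, (∑ k ∈ Finset.range n, a k • F k) ≠ 0 →
      ∃ m, ∃ c : ℂ, c ≠ 0 ∧
        ∑ k ∈ Finset.range n, a k • F k = c • F m + ∑ k ∈ Finset.range m, a k • F k := by
    intro n a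
    induction n with
    | zero => simp
    | succ n ih =>
      intro h
      by_cases ha : a n = 0
      · rw [Finset.sum_range_succ, ha, zero_smul, add_zero] at h ⊢
        exact ih h
      · exact ⟨n, a n, ha, by rw [Finset.sum_range_succ, add_comm]⟩
  have hzero : ∀ n, ∀ a : ℕ → ℂ, ∀ κ, ∀ m, n ≤ m →
      IsApproxAlong N (∑ k ∈ Finset.range n, a k • F k) (atTop ⊓ 𝓟 (ν m κ)) (univ.pi (T κ))
        fun _ => 0 := by
    intro n a κ
    induction n with
    | zero =>
      intro m _
      rw [Finset.sum_range_zero]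
      exact isApproxAlong_zero hS _ _
    | succ n ih =>
      intro m hm
      rw [Finset.sum_range_succ, add_comm]
      refine IsApproxAlong.smul_add hS (a n) ((hF0 n κ).mono ?_ Subset.rfl) (ih m (by omega)) ?_
      · exact inf_le_inf_left _ (principal_mono.2 (hanti κ hm))
      · intro α z _
        simp [mixedDeriv_const_zero]
  obtain ⟨a, rfl⟩ := Finsupp.mem_span_range_iff_exists_finsupp.1 hf
  obtain ⟨n, hn⟩ := a.support.exists_nat_subset_range
  rw [Finsupp.sum_of_support_subset a hn (fun k b => b • F k) fun _ _ => zero_smul _ _] at hf0 ⊢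
  obtain ⟨m, c, hc, heq⟩ := hsplit n a hf0
  rw [heq]
  refine (isUniversal_iff hS).2 fun K hK h => ?_
  obtain ⟨κ, hκ⟩ := hTK K hK
  let h' : OSpace (univ.pi K) :=
    ⟨fun z => c⁻¹ * h.toFun z, fun z hz => analyticAt_const.mul (h.analytic z hz)⟩
  obtain ⟨ν', hsub, hinf, hap⟩ := (isUniversal_iff hS).1 (hF m κ) K hK h'
  refine ⟨ν', hsub.trans (hνμ m κ), hinf, IsApproxAlong.smul_add hS c hap
    ((hzero m a κ m le_rfl).mono (inf_le_inf_left _ (principal_mono.2 hsub)) hκ) fun α z hz => ?_⟩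
  have hU : IsOpen {z | AnalyticAt ℂ h.toFun z} := isOpen_analyticAt ℂ h.toFun
  exact mixedDeriv_lin hU α c (F := h'.toFun) (G := fun _ => 0) (H := h.toFun)
    (fun z hz => analyticAt_const.mul hz) (fun _ _ => analyticAt_const)
    (fun z _ => by simp [h', mul_inv_cancel_left₀ hc]) (h.analytic z hz)

/-- The generators are constructed one after the other, the `n`-th in the `n`-th set of a countable
basis, with sets of indices that decrease from step to step. -/
theorem exists_submodule_isUniversal (hΩ : ∀ i, IsConnected (Ω i : Set ℂ))
    (hS : ∀ i, S i ⊆ frontier (Ω i : Set ℂ)) [LocallyCompactSpace (prodWithBdry Ω S)]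
    (hconn : ∀ i, IsConnected ((fun z : ℂ => (z : OnePoint ℂ)) '' ((Ω i : Set ℂ) ∪ S i))ᶜ)
    {μ : Set ℕ} (hμ : μ.Infinite) :
    ∃ V : Submodule ℂ (AInfty Ω S), (V : Set (AInfty Ω S)) ⊆ XInfty Ω S ∧
      XInfty Ω S ⊆ closure (V : Set (AInfty Ω S)) ∧ ∀ f ∈ V, f ≠ 0 → IsUniversal N μ f := by
  obtain ⟨T, hT, hTK⟩ := exists_countable_admissible (S := S) hΩ
  have := secondCountableTopology_aInfty (Ω := Ω) hS
  have : Nonempty (XInfty Ω S) := ⟨⟨_, (xInftySubmodule hS).zero_mem⟩⟩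
  obtain ⟨B, hBc, hB0, hB⟩ := TopologicalSpace.exists_countable_basis (XInfty Ω S)
  obtain ⟨s, hs, -⟩ := hB.exists_subset_of_mem_open (mem_univ (Classical.arbitrary _)) isOpen_univ
  obtain ⟨O, rfl⟩ := hBc.exists_eq_range ⟨s, hs⟩
  have hO : ∀ n, IsOpen (O n) ∧ (O n).Nonempty := fun n =>
    ⟨hB.isOpen ⟨n, rfl⟩, nonempty_iff_ne_empty.2 fun h => hB0 ⟨n, h⟩⟩
  let Idx := {ν : Fin d × ℕ × ℕ → Set ℕ // ∀ κ, (ν κ).Infinite}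
  have step : ∀ (n : ℕ) (ν : Idx), ∃ f ∈ O n, ∃ ν' : Idx, ∀ κ,
      IsUniversal N (ν.1 κ) f.1 ∧ ν'.1 κ ⊆ ν.1 κ ∧
      IsApproxAlong N f.1 (atTop ⊓ 𝓟 (ν'.1 κ)) (univ.pi (T κ)) fun _ => 0 := fun n ν =>
    let ⟨f, hf, ν', hinf, h⟩ := exists_universal_approx_zero hΩ hS hconn hT ν.2 (hO n).1 (hO n).2
    ⟨f, hf, ⟨ν', hinf⟩, h⟩
  choose G hGO next hnext using step
  let ν : ℕ → Idx := fun n => Nat.rec ⟨fun _ => μ, fun _ => hμ⟩ next n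
  have hν : ∀ n κ, (ν (n + 1)).1 κ ⊆ (ν n).1 κ := fun n κ => (hnext n (ν n) κ).2.1
  have hνμ : ∀ n κ, (ν n).1 κ ⊆ μ := fun n κ => by
    induction n with
    | zero => exact Subset.rfl
    | succ n ih => exact (hν n κ).trans ih
  let F : ℕ → AInfty Ω S := fun n => (G n (ν n)).1
  refine ⟨Submodule.span ℂ (range F), ?_, fun f hf => ?_, fun f hf hf0 => ?_⟩
  · have h : Submodule.span ℂ (range F) ≤ xInftySubmodule hS :=
      Submodule.span_le.2 (range_subset_iff.2 fun n => (G n (ν n)).2)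
    exact h
  · have hd : Dense (range fun n => G n (ν n)) := hB.dense_iff.2 (by
      rintro _ ⟨n, rfl⟩ _
      exact ⟨_, hGO n (ν n), n, rfl⟩)
    have h1 := (Subtype.dense_iff.1 hd) hf
    refine closure_mono ?_ h1
    rintro _ ⟨_, ⟨n, rfl⟩, rfl⟩
    exact Submodule.subset_span ⟨n, rfl⟩
  · exact isUniversal_of_mem_span hS hTK (ν := fun n => (ν n).1) hνμ hν
      (fun n κ => (hnext n (ν n) κ).1) (fun n κ => (hnext n (ν n) κ).2.2) hf hf0

end Generic

end PartiallySmooth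

end

theorem theorem3p9 {d : ℕ} (Ω : Fin d → TopologicalSpace.Opens ℂ) (S : Fin d → Set ℂ)
    (hΩ : ∀ i, IsSimplyConnected (Ω i : Set ℂ))
    (hS : ∀ i, S i ⊆ frontier (Ω i : Set ℂ))
    (hSopen : ∀ i, ∃ U : Set ℂ, IsOpen U ∧ S i = U ∩ frontier (Ω i : Set ℂ))
    (hconn : ∀ i, IsConnected ((fun z : ℂ => (z : OnePoint ℂ)) '' ((Ω i : Set ℂ) ∪ S i))ᶜ)
    (N : ℕ ≃ (Fin d → ℕ)) (μ : Set ℕ) (hμ : μ.Infinite) :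
    (∃ f : PartiallySmooth.AInfty Ω S, PartiallySmooth.IsUniversal N μ f) ∧
    IsGδ {f : PartiallySmooth.XInfty Ω S | PartiallySmooth.IsUniversal N μ f.1} ∧
    Dense {f : PartiallySmooth.XInfty Ω S | PartiallySmooth.IsUniversal N μ f.1} ∧
    ∃ V : Submodule ℂ (PartiallySmooth.AInfty Ω S),
      (V : Set (PartiallySmooth.AInfty Ω S)) ⊆ PartiallySmooth.XInfty Ω S ∧
      PartiallySmooth.XInfty Ω S ⊆ closure (V : Set (PartiallySmooth.AInfty Ω S)) ∧
      ∀ f ∈ V, f ≠ 0 → PartiallySmooth.IsUniversal N μ f := by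
  have hΩ' : ∀ i, IsConnected (Ω i : Set ℂ) := fun i => (hΩ i).isPathConnected.isConnected
  have := PartiallySmooth.locallyCompactSpace_prodWithBdry hSopen
  obtain ⟨hG, hD⟩ :=
    PartiallySmooth.isGδ_and_dense_isUniversal (N := N) hΩ' hS hconn hμ
  have : Nonempty (PartiallySmooth.XInfty Ω S) :=
    ⟨⟨_, (PartiallySmooth.xInftySubmodule hS).zero_mem⟩⟩
  obtain ⟨f, hf⟩ := hD.nonempty
  exact ⟨⟨f.1, hf⟩, hG, hD, PartiallySmooth.exists_submodule_isUniversal hΩ' hS hconn hμ⟩
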